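/- **Setting.** Let $y_t$, $t\in\mathbb Z$, be a $d$-dimensional zero-mean, covariance-stationary process with $\Phi(L)y_t=\Theta(L)B\varepsilon_t$, where $\Phi(z)=I_d-\sum_{j=1}^p\Phi_jz^j$, $\Theta(z)=I_d+\sum_{j=1}^q\Theta_jz^j$, $B$ is invertible and $\det\Phi(z)\det\Theta(z)\ne0$ for $|z|=1$ (roots inside the unit circle are allowed). The shocks $\varepsilon_t$ are i.i.d. with mutually independent components (any number of which may be non-Gaussian), $E\varepsilon_t=0$, $E\varepsilon_t\varepsilon_t'=I_d$, $E\|\varepsilon_t\|^8<\infty$. **Reduced form.** Let $\vartheta_f=(\tilde\Phi_1,\dots,\tilde\Phi_{p_f},\tilde\Theta_1,\dots,\tilde\Theta_{q_f})$ be the coefficients of a fundamental VARMA representation of $y_t$: $\det\tilde\Phi(z)\det\tilde\Theta(z)\neq0$ for $|z|\le1$, and the reduced-form errors $u_t=\sum_{j\ge0}\pi_j(\vartheta_f)y_{t-j}$ are serially uncorrelated, where $\sum_{j\ge 0}\pi_j(\vartheta)z^j=\tilde\Theta(z)^{-1}\tilde\Phi(z)$. Let $\hat\vartheta_T$ be an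 estimator computed from $y_0,\dots,y_{T-1}$, with values in a compact set that contains $\vartheta_f$ and on which $\det\tilde\Phi(z)\det\tilde\Theta(z)\ne0$ for $|z|\le1$, and root-$T$ consistent in mean square: $\sup_{T\ge1}T\,E\|\hat\vartheta_T-\vartheta_f\|^2<\infty$. The residuals, computed with zero pre-sample values, are $\hat u_t=\sum_{j=0}^t\pi_j(\hat\vartheta_T)y_{t-j}$, $0\le t\le T-1$. **Spectrum estimators.** Let $k\in\{3,4\}$, $c\in\{1,\dots,d\}^k$, and $\lambda\in\mathbb R^k$ with $\sum_m\lambda_m\equiv0\pmod{2\pi}$. Let $W$ be a real weight function on the plane $\{\beta\in\mathbb R^k:\sum_m\beta_m=0\}$ with $W(-\beta)=W(\beta)$, $\int W(\beta_1,\dots,\beta_{k-1},-\sum_{m<k}\beta_m)\,d\beta_1\cdots d\beta_{k-1}=1$ and $|W(\beta)|\le A(1+\|\beta\|)^{-(k-1)-\eta}$ for some $A$ and $\eta>0$. Let $H_T>0$, $H_T\to0$, $TH_T^{k-1}\to\infty$, and $$W_T(a)=H_T^{-(k-1)}\sum_{j\in\mathbb Z^k:\ \sum_m(a_m+2\pi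 j_m)=0}W\big((a+2\pi j)/H_T\big).$$ For a series $x_0,\dots,x_{T-1}\in\mathbb R^d$ put $z_a(\mu)=\sum_{t=0}^{T-1}x_{a,t}e^{-i\mu t}$, and for a set $A\subseteq\{0,\dots,T-1\}^k$ put $$\hat g^{x,A}_{c,k}(\lambda)=\Big(\frac{2\pi}{T}\Big)^{k-1}\sum_{(t_1,\dots,t_k)\in A}W_T\Big(\lambda_1-\tfrac{2\pi t_1}T,\dots,\lambda_k-\tfrac{2\pi t_k}T\Big)\,\frac{1}{(2\pi)^{k-1}T}\prod_{m=1}^kz_{c_m}\Big(\tfrac{2\pi t_m}T\Big).$$ Let $A^{\mathrm{all}}_T=\{0,\dots,T-1\}^k$, and let $A^\circ_T$ be the set of tuples with $\sum_mt_m\equiv0\pmod T$ and $\sum_{m\in S}t_m\not\equiv0\pmod T$ for every nonempty proper subset $S\subset\{1,\dots,k\}$. **Proposition.** 1. There is a constant $C$ such that for all $T\ge1$, all $c$ and all $\lambda$ as above, the expectation exists and $$E\sqrt{H_T^{k-1}T}\,\big|\hat g^{u,A^\circ_T}_{c,k}(\lambda)-\hat g^{\hat u,A^\circ_T}_{c,k}(\lambda)\big|\le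 C\,H_T^{(k-1)/2}.$$ 2. For every $\lambda$ as above such that no $S\subset\{1,\dots,k\}$ with $2\le|S|\le k-2$ has $\sum_{m\in S}\lambda_m\equiv0\pmod{2\pi}$ (no condition if $k=3$), there is a constant $C$ such that the same holds for all $T\ge1$ and all $c$ with $A^{\mathrm{all}}_T$ in place of $A^\circ_T$. 3. Consequently, in both cases, the estimators based on $u_t$ and on $\hat u_t$ are asymptotically equivalent: for every such $c$ and $\lambda$, $E\sqrt{H_T^{k-1}T}\,|\hat g^{u}_{c,k}(\lambda)-\hat g^{\hat u}_{c,k}(\lambda)|\to0$ as $T\to\infty$. -/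

import Mathlib

open MeasureTheory ProbabilityTheory Filter Topology

noncomputable section

namespace SVARMA

/-- Coefficients `(Φ_1, …, Φ_p)` and `(Θ_1, …, Θ_q)` of a `d`-dimensional VARMA(`p`,`q`) model;
`θ.1 j` is `Φ_{j+1}` and `θ.2 j` is `Θ_{j+1}`. -/
abbrev Coeff (d p q : ℕ) : Type :=
  (Fin p → Matrix (Fin d) (Fin d) ℝ) × (Fin q → Matrix (Fin d) (Fin d) ℝ)

section Filters

variable {d p q : ℕ}

/-- `Φ(z) = I - ∑_j Φ_j z^j`. -/
def arPoly (θ : Coeff d p q) (z : ℂ) : Matrix (Fin d) (Fin d) ℂ :=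
  1 - ∑ j : Fin p, z ^ ((j : ℕ) + 1) • (θ.1 j).map Complex.ofReal

/-- `Θ(z) = I + ∑_j Θ_j z^j`. -/
def maPoly (θ : Coeff d p q) (z : ℂ) : Matrix (Fin d) (Fin d) ℂ :=
  1 + ∑ j : Fin q, z ^ ((j : ℕ) + 1) • (θ.2 j).map Complex.ofReal

/-- `Φ(L) x_t = x_t - ∑_j Φ_j x_{t-j}`. -/
def arFilter (θ : Coeff d p q) (x : ℤ → Fin d → ℝ) (t : ℤ) : Fin d → ℝ :=
  x t - ∑ j : Fin p, (θ.1 j).mulVec (x (t - ((j : ℕ) + 1 : ℤ)))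

/-- `Θ(L) x_t = x_t + ∑_j Θ_j x_{t-j}`. -/
def maFilter (θ : Coeff d p q) (x : ℤ → Fin d → ℝ) (t : ℤ) : Fin d → ℝ :=
  x t + ∑ j : Fin q, (θ.2 j).mulVec (x (t - ((j : ℕ) + 1 : ℤ)))

/-- The power series coefficients of `Φ(z)`: `I, -Φ_1, …, -Φ_p, 0, 0, …`. -/
def arCoeff (θ : Coeff d p q) : ℕ → Matrix (Fin d) (Fin d) ℝ
  | 0 => 1
  | n + 1 => if h : n < p then -θ.1 ⟨n, h⟩ else 0

/-- The power series coefficients `π_0, π_1, …` of the inverse filter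
`Ψ⁻¹(z) = Θ(z)⁻¹ Φ(z)`, from `Θ(z) ∑_n π_n z^n = Φ(z)`. -/
def invCoeff (θ : Coeff d p q) (n : ℕ) : Matrix (Fin d) (Fin d) ℝ :=
  arCoeff θ n - ∑ i : Fin q,
    if _h : (i : ℕ) + 1 ≤ n then θ.2 i * invCoeff θ (n - ((i : ℕ) + 1)) else 0
termination_by n
decreasing_by omega

/-- The reduced-form errors `u_t = Ψ⁻¹(L) y_t = ∑_{j ≥ 0} π_j y_{t-j}`. -/
def rfError (θ : Coeff d p q) (y : ℤ → Fin d → ℝ) (t : ℤ) : Fin d → ℝ :=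
  ∑' j : ℕ, (invCoeff θ j).mulVec (y (t - (j : ℤ)))

/-- The residuals computed from a sample `y_0, …, y_{T-1}`: the solution of
`Θ(L) û_t = Φ(L) y_t` with all pre-sample values set to zero, i.e.
`û_t = ∑_{s ≤ t} π_{t-s} y_s`. -/
def rfResidual (θ : Coeff d p q) {T : ℕ} (x : Fin T → Fin d → ℝ) (t : Fin T) : Fin d → ℝ :=
  ∑ s : Fin T, if s ≤ t then (invCoeff θ ((t : ℕ) - (s : ℕ))).mulVec (x s) else 0

/-- The sample `x_0, …, x_{T-1}` of a series. -/
def sample (x : ℤ → Fin d → ℝ) (T : ℕ) (t : Fin T) : Fin d → ℝ :=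
  x ((t : ℕ) : ℤ)

/-- Squared Euclidean distance of two coefficient vectors. -/
def distSq (θ θ' : Coeff d p q) : ℝ :=
  (∑ j, ∑ a, ∑ b, (θ.1 j a b - θ'.1 j a b) ^ 2) +
    ∑ j, ∑ a, ∑ b, (θ.2 j a b - θ'.2 j a b) ^ 2

/-- All roots of the autoregressive and moving-average polynomials lie outside the closed unit
disc. -/
def RootsOutside (θ : Coeff d p q) : Prop :=
  ∀ z : ℂ, ‖z‖ ≤ 1 → (arPoly θ z).det * (maPoly θ z).det ≠ 0

end Filters

section Series

variable {Ω : Type*} [MeasurableSpace Ω] {d p q : ℕ}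

/-- Structural shocks: i.i.d. over time, mutually independent components, zero mean, identity
covariance, finite eighth moments. The number of non-Gaussian components is unrestricted
(any value between `0` and `d`), so it gives no condition. -/
structure IsStructuralShock (P : Measure Ω) (ε : ℤ → Ω → Fin d → ℝ) : Prop where
  measurable : ∀ t, Measurable (ε t)
  indep : iIndepFun ε P
  ident : ∀ s t, IdentDistrib (ε s) (ε t) P P
  indep_comp : ∀ t, iIndepFun (fun (i : Fin d) (ω : Ω) => ε t ω i) P
  mean : ∀ t i, ∫ ω, ε t ω i ∂P = 0
  cov : ∀ t i j, ∫ ω, ε t ω i * ε t ω j ∂P = if i = j then 1 else 0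
  moment : ∀ t, MemLp (ε t) 8 P

/-- Zero-mean, covariance-stationary process. -/
structure IsStationary (P : Measure Ω) (y : ℤ → Ω → Fin d → ℝ) : Prop where
  memLp : ∀ t, MemLp (y t) 2 P
  mean : ∀ t i, ∫ ω, y t ω i ∂P = 0
  cov : ∀ s t h i j, ∫ ω, y (s + h) ω i * y s ω j ∂P = ∫ ω, y (t + h) ω i * y t ω j ∂P

/-- `y` is a stationary solution of `Φ(L) y_t = Θ(L) B ε_t`, where `B` is invertible and neither
polynomial has a root on the unit circle; roots inside the disc are allowed. -/
structure IsSVARMA (P : Measure Ω) (θ : Coeff d p q) (B : Matrix (Fin d) (Fin d) ℝ)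
    (ε y : ℤ → Ω → Fin d → ℝ) : Prop where
  fullRank : IsUnit B.det
  noUnitRoot : ∀ z : ℂ, ‖z‖ = 1 → (arPoly θ z).det * (maPoly θ z).det ≠ 0
  stationary : IsStationary P y
  equation : ∀ t, ∀ᵐ ω ∂P,
    arFilter θ (fun s => y s ω) t = maFilter θ (fun s => B.mulVec (ε s ω)) t

/-- `θf` gives the fundamental (Wold) VARMA representation of `y`: no roots in the closed unit
disc and serially uncorrelated reduced-form errors. -/
structure IsFundamental (P : Measure Ω) (y : ℤ → Ω → Fin d → ℝ) (θf : Coeff d p q) : Prop where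
  roots : RootsOutside θf
  uncorrelated : ∀ s t, s ≠ t → ∀ i j,
    ∫ ω, rfError θf (fun r => y r ω) s i * rfError θf (fun r => y r ω) t j ∂P = 0

/-- `est T` is an estimator of `θf` from `y_0, …, y_{T-1}` with values in a compact parameter
space of fundamental models containing `θf`, root-`T` consistent in mean square. -/
structure IsRootTEstimator (P : Measure Ω) (y : ℤ → Ω → Fin d → ℝ) (θf : Coeff d p q)
    (K : Set (Coeff d p q)) (est : (T : ℕ) → (Fin T → Fin d → ℝ) → Coeff d p q) : Prop where
  compact : IsCompact K
  roots : ∀ θ ∈ K, RootsOutside θ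
  true_mem : θf ∈ K
  measurable_ar : ∀ T j a b, Measurable fun x => (est T x).1 j a b
  measurable_ma : ∀ T j a b, Measurable fun x => (est T x).2 j a b
  mem : ∀ T x, est T x ∈ K
  rate : ∃ M : ℝ, ∀ T : ℕ, 1 ≤ T →
    ∫ ω, distSq (est T (sample (fun t => y t ω) T)) θf ∂P ≤ M / T

end Series

section Spectrum

/-- The point `(b_1, …, b_{k-1}, -∑ b)` of the plane `∑ β = 0` in `ℝ^k`. -/
def planePoint (k : ℕ) (b : Fin (k - 1) → ℝ) (m : Fin k) : ℝ :=
  if h : (m : ℕ) < k - 1 then b ⟨m, h⟩ else -∑ i, b i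

/-- Weight functions on the plane `∑ β = 0`: symmetric around `0`, of total mass one with respect
to `δ(∑ β) dβ`, and decaying faster than `|β|^{-(k-1)}`. -/
structure IsWeight (k : ℕ) (W : (Fin k → ℝ) → ℝ) : Prop where
  symm : ∀ β, ∑ m, β m = 0 → W (-β) = W β
  mass : ∫ b : Fin (k - 1) → ℝ, W (planePoint k b) = 1
  decay : ∃ A η : ℝ, 0 < η ∧ ∀ β, ∑ m, β m = 0 →
    |W β| ≤ A * (1 + ‖β‖) ^ (-(((k : ℝ) - 1) + η))

/-- The periodized weight
`W_T(a) = h^{-(k-1)} ∑_{j ∈ ℤ^k, ∑ (a_m + 2π j_m) = 0} W((a + 2π j) / h)`. -/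
def periodizedWeight {k : ℕ} (W : (Fin k → ℝ) → ℝ) (h : ℝ) (a : Fin k → ℝ) : ℝ :=
  (h ^ (k - 1))⁻¹ *
    ∑' j : {j : Fin k → ℤ // ∑ m, (a m + 2 * Real.pi * (j m : ℝ)) = 0},
      W (fun m => (a m + 2 * Real.pi * (j.1 m : ℝ)) / h)

/-- The Fourier frequency `2π s / T`. -/
def fourierFreq {T : ℕ} (s : Fin T) : ℝ := 2 * Real.pi * (s : ℕ) / T

variable {d k : ℕ}

/-- Discrete Fourier transform `∑_{t=0}^{T-1} x_{a,t} e^{-iμt}`. -/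
def dft {T : ℕ} (x : Fin T → Fin d → ℝ) (a : Fin d) (μ : ℝ) : ℂ :=
  ∑ t : Fin T, (x t a : ℂ) * Complex.exp (-Complex.I * μ * (t : ℕ))

/-- The `k`-th order periodogram at the Fourier frequencies `2π s_m / T`. -/
def periodogram {T : ℕ} (x : Fin T → Fin d → ℝ) (c : Fin k → Fin d) (s : Fin k → Fin T) : ℂ :=
  (1 / ((2 * Real.pi) ^ (k - 1) * T) : ℂ) * ∏ m, dft x (c m) (fourierFreq (s m))

/-- The kernel-smoothed `k`-th order spectrum estimator at `lam`, smoothing over the tuples of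
Fourier frequencies in `A`. The weight vanishes unless `∑ s_m = 0` modulo `T`. -/
def specEst {T : ℕ} (A : Finset (Fin k → Fin T)) (W : (Fin k → ℝ) → ℝ) (h : ℝ)
    (x : Fin T → Fin d → ℝ) (c : Fin k → Fin d) (lam : Fin k → ℝ) : ℂ :=
  (2 * Real.pi / T : ℂ) ^ (k - 1) *
    ∑ s ∈ A, (periodizedWeight W h (fun m => lam m - fourierFreq (s m)) : ℂ) * periodogram x c s

open Classical in
/-- The tuples whose total is `0` modulo `T` and none of whose proper nonempty subtuples has
total `0` modulo `T`. -/
def offSubmanifolds (k T : ℕ) : Finset (Fin k → Fin T) :=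
  Finset.univ.filter fun s => T ∣ ∑ m, (s m : ℕ) ∧
    ∀ S : Finset (Fin k), S.Nonempty → S ≠ Finset.univ → ¬ T ∣ ∑ m ∈ S, (s m : ℕ)

/-- `∑ λ = 0` modulo `2π` over the index set `S`. -/
def SumZeroMod (S : Finset (Fin k)) (lam : Fin k → ℝ) : Prop :=
  ∃ n : ℤ, ∑ m ∈ S, lam m = 2 * Real.pi * n

/-- `√(h^{k-1} T) |ĝ^u - ĝ^û|` for the series `y`: `ĝ^u` uses the reduced-form errors with the
true coefficients `θf`, `ĝ^û` the residuals of the sample with coefficients `θhat`. -/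
def discrepancy {p q : ℕ} (T : ℕ) (A : Finset (Fin k → Fin T)) (W : (Fin k → ℝ) → ℝ) (h : ℝ)
    (c : Fin k → Fin d) (lam : Fin k → ℝ) (θf θhat : Coeff d p q) (y : ℤ → Fin d → ℝ) : ℝ :=
  Real.sqrt (h ^ (k - 1) * T) *
    ‖specEst A W h (sample (rfError θf y) T) c lam
      - specEst A W h (rfResidual θhat (sample y T)) c lam‖

end Spectrum

end SVARMA

end

open SVARMA

/-!
A spectrum estimator is a multilinear form `∑_t K(t) ∏_m x_{c_m}(t_m)` in the sample, whose kernel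
`K` is the discrete Fourier transform of the frequency weights (`specEst_eq_spectralForm`). The
whole proof is the estimate `E |ĝ^u - ĝ^û| ≤ C T^{-1/2}` (`exists_lintegral_spectralForm_sub_le`),
which the normalization `√(H^{k-1} T)` turns into the rate `H^{(k-1)/2}`.

The difference of the two forms telescopes over the `k` slots. In the slot that changes,
`u_t - û_t` splits into the difference of the filters `π(ϑ_f) - π(ϑ̂)`, applied to the sample, and
the pre-sample part `∑_{j > t} π_j y_{t-j}` of the true filter. All series are expanded in the
shocks: the process is a two-sided moving average of them, since the polynomials have no zeros on
the unit circle (`IsSVARMA.exists_movingAverage`), and the inverse filters of all models in the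
compact parameter space decay at one geometric rate and are Lipschitz in the parameters, at the
same rate (`exists_invCoeff_bounds`). The expansion is taken pathwise and absolutely
(`enorm_spectralForm_rfError_sub_rfResidual_le`), so that the estimator, which depends on the
shocks, enters only through the scalar `‖ϑ̂ - ϑ_f‖`, and can be separated by the Cauchy–Schwarz
inequality.

What remains are forms in shocks with fixed lags. Their second moments are bounded, up to powers of
the lags, which the geometric coefficients absorb, and they are of order `1 / T` when the time of
one slot is frozen (`IsStructuralShock.lintegral_shockForm_sq_le`). The first case gives the order
`T^{-1/2}` for a slot with a difference of filters, because the estimation error has this order;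
the second gives it for a slot with the pre-sample part, which involves only a bounded number of
times at each lag.

The second moments are computed by splitting a form according to which of its shocks coincide and,
for each set of coinciding shocks, into the centred power and its mean. Pieces with centred powers
are orthogonal unless they contain the same shocks, so that a piece is controlled by the `ℓ²` norm
of the kernel summed over the sets that are replaced by their means (`integral_norm_sq_form_le`).
If nothing is summed, that is Parseval's identity. A sum over the common time of a set `B` of slots
leaves only the frequencies on the submanifold `∑_{m ∈ B} s_m ≡ 0 (mod T)`, up to boundary terms of
the order of the lags (`sum_norm_sq_pattern_truncKernel_le`). Hence all that matters is that the
weights have bounded mass, square sum and mass on these submanifolds, at the natural scales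
(`WeightBound`). The decay of `W` and `T H^{k-1} → ∞` yield this except on the submanifolds of
codimension two, which exist for `k = 4`; these are excluded from the smoothing
(`exists_weightBound_offSubmanifolds`), or they stay away from the frequency of interest, where the
weights are large (`exists_weightBound_univ`).
-/

noncomputable section

namespace SVARMA

/-! ### Orthogonality of products of independent variables -/

section AlmostOrthogonal

variable {Ω : Type*} [MeasurableSpace Ω] {P : Measure Ω}

lemma memLp_complexSum {α : Type*} (s : Finset α) (c : α → ℂ) (Q : α → Ω → ℝ)
    (hQ : ∀ x ∈ s, MemLp (Q x) 2 P) :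
    MemLp (fun ω => ∑ x ∈ s, c x * (Q x ω : ℂ)) 2 P := by
  refine memLp_finsetSum _ fun x hx => ?_
  exact ((hQ x hx).ofReal (K := ℂ)).const_mul (c x)

/-- A Bessel-type inequality: if every element of a family in `L²` is orthogonal to all but at most
`N` members of the family, the square of a linear combination is controlled by the squares of its
coefficients. -/
lemma integral_norm_sq_sum_le_of_almost_orthogonal {α : Type*} (s : Finset α) (c : α → ℂ)
    (Q : α → Ω → ℝ) (hQ : ∀ x ∈ s, MemLp (Q x) 2 P) {M : ℝ} (hM : 0 ≤ M)
    (hQM : ∀ x ∈ s, ∫ ω, Q x ω ^ 2 ∂P ≤ M) (r : α → α → Prop) [DecidableRel r]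
    (hr : ∀ x y, r x y → r y x)
    (horth : ∀ x ∈ s, ∀ y ∈ s, ¬ r x y → ∫ ω, Q x ω * Q y ω ∂P = 0) {N : ℕ}
    (hN : ∀ x ∈ s, (s.filter (r x)).card ≤ N) :
    ∫ ω, ‖∑ x ∈ s, c x * (Q x ω : ℂ)‖ ^ 2 ∂P ≤ N * M * ∑ x ∈ s, ‖c x‖ ^ 2 := by
  have hint : ∀ x ∈ s, ∀ y ∈ s, Integrable (fun ω => Q x ω * Q y ω) P := fun x hx y hy =>
    (hQ x hx).integrable_mul (hQ y hy)
  have hexp : ∀ ω, ‖∑ x ∈ s, c x * (Q x ω : ℂ)‖ ^ 2 =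
      ∑ x ∈ s, ∑ y ∈ s, ((c x).re * (c y).re + (c x).im * (c y).im) * (Q x ω * Q y ω) := by
    intro ω
    rw [Complex.sq_norm, Complex.normSq_apply, Complex.re_sum, Complex.im_sum,
      Finset.sum_mul_sum, Finset.sum_mul_sum, ← Finset.sum_add_distrib]
    refine Finset.sum_congr rfl fun x _ => ?_
    rw [← Finset.sum_add_distrib]
    refine Finset.sum_congr rfl fun y _ => ?_
    simp
    ring
  have hbd : ∀ x ∈ s, ∀ y ∈ s, |∫ ω, Q x ω * Q y ω ∂P| ≤ M := by
    intro x hx y hy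
    have hx2 : Integrable (fun ω => Q x ω ^ 2) P := (hQ x hx).integrable_sq
    have hy2 : Integrable (fun ω => Q y ω ^ 2) P := (hQ y hy).integrable_sq
    calc |∫ ω, Q x ω * Q y ω ∂P| ≤ ∫ ω, |Q x ω * Q y ω| ∂P := abs_integral_le_integral_abs
      _ ≤ ∫ ω, (Q x ω ^ 2 / 2 + Q y ω ^ 2 / 2) ∂P := by
          refine integral_mono (hint x hx y hy).abs ((hx2.div_const 2).add (hy2.div_const 2))
            fun ω => ?_
          show |Q x ω * Q y ω| ≤ Q x ω ^ 2 / 2 + Q y ω ^ 2 / 2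
          rw [abs_mul, ← sq_abs (Q x ω), ← sq_abs (Q y ω)]
          nlinarith [sq_nonneg (|Q x ω| - |Q y ω|)]
      _ ≤ M := by
          rw [integral_add (hx2.div_const 2) (hy2.div_const 2), integral_div, integral_div]
          linarith [hQM x hx, hQM y hy]
  have hterm : ∀ x ∈ s, ∀ y ∈ s,
      ((c x).re * (c y).re + (c x).im * (c y).im) * ∫ ω, Q x ω * Q y ω ∂P ≤
        if r x y then (‖c x‖ ^ 2 / 2 + ‖c y‖ ^ 2 / 2) * M else 0 := by
    intro x hx y hy
    split_ifs with h
    · have h1 : |(c x).re * (c y).re + (c x).im * (c y).im| ≤ ‖c x‖ ^ 2 / 2 + ‖c y‖ ^ 2 / 2 := by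
        rw [Complex.sq_norm, Complex.sq_norm, Complex.normSq_apply, Complex.normSq_apply, abs_le]
        constructor <;>
          nlinarith [sq_nonneg ((c x).re + (c y).re), sq_nonneg ((c x).im + (c y).im),
            sq_nonneg ((c x).re - (c y).re), sq_nonneg ((c x).im - (c y).im)]
      calc _ ≤ |((c x).re * (c y).re + (c x).im * (c y).im) * ∫ ω, Q x ω * Q y ω ∂P| := le_abs_self _
        _ ≤ _ := by
          rw [abs_mul]
          exact mul_le_mul h1 (hbd x hx y hy) (abs_nonneg _) (by positivity)
    · rw [horth x hx y hy h, mul_zero]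
  simp_rw [hexp]
  rw [integral_finsetSum _ fun x hx => integrable_finsetSum _ fun y hy =>
    (hint x hx y hy).const_mul _]
  have h2 : ∀ x ∈ s, ∫ ω, ∑ y ∈ s, ((c x).re * (c y).re + (c x).im * (c y).im) * (Q x ω * Q y ω) ∂P
      ≤ ∑ y ∈ s, if r x y then (‖c x‖ ^ 2 / 2 + ‖c y‖ ^ 2 / 2) * M else 0 := by
    intro x hx
    rw [integral_finsetSum _ fun y hy => (hint x hx y hy).const_mul _]
    refine Finset.sum_le_sum fun y hy => ?_
    rw [integral_const_mul]
    exact hterm x hx y hy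
  refine (Finset.sum_le_sum h2).trans ?_
  -- By the symmetry of `r` the two halves have the same double sum.
  have hsplit : ∑ x ∈ s, ∑ y ∈ s, (if r x y then (‖c x‖ ^ 2 / 2 + ‖c y‖ ^ 2 / 2) * M else 0) =
      ∑ x ∈ s, ∑ y ∈ s, (if r x y then ‖c x‖ ^ 2 * M else 0) := by
    have e1 : ∀ x y, (if r x y then (‖c x‖ ^ 2 / 2 + ‖c y‖ ^ 2 / 2) * M else 0) =
        (if r x y then ‖c x‖ ^ 2 * M else 0) / 2 + (if r y x then ‖c y‖ ^ 2 * M else 0) / 2 := by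
      intro x y
      by_cases h : r x y
      · simp [h, hr x y h]; ring
      · have : ¬ r y x := fun h' => h (hr y x h')
        simp [h, this]
    simp_rw [e1, Finset.sum_add_distrib]
    rw [Finset.sum_comm (f := fun x y => (if r y x then ‖c y‖ ^ 2 * M else 0) / 2)]
    rw [← Finset.sum_add_distrib]
    refine Finset.sum_congr rfl fun x _ => ?_
    rw [← Finset.sum_add_distrib]
    exact Finset.sum_congr rfl fun y _ => by ring
  rw [hsplit, Finset.mul_sum]
  refine Finset.sum_le_sum fun x hx => ?_
  rw [← Finset.sum_filter, Finset.sum_const, nsmul_eq_mul]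
  have : ((s.filter (r x)).card : ℝ) ≤ N := by exact_mod_cast hN x hx
  have h0 : 0 ≤ ‖c x‖ ^ 2 * M := by positivity
  nlinarith

end AlmostOrthogonal

section CenteredProducts

variable {Ω : Type*} [MeasurableSpace Ω] {P : Measure Ω} {V κ : Type*} [Fintype κ]
  {ξ : V → Ω → ℝ}

/-- Second moments of products of functions of distinct independent variables multiply. -/
lemma lintegral_prod_comp_le (hind : iIndepFun ξ P) (hmeas : ∀ v, Measurable (ξ v))
    (g : κ → ℝ → ℝ) (hg : ∀ m, Measurable (g m)) (f : κ → V) (hf : Function.Injective f)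
    {M : ENNReal} (hM : ∀ m, ∫⁻ ω, ‖g m (ξ (f m) ω)‖ₑ ^ 2 ∂P ≤ M) :
    ∫⁻ ω, ‖∏ m, g m (ξ (f m) ω)‖ₑ ^ 2 ∂P ≤ M ^ Fintype.card κ := by
  have h1 : iIndepFun (fun m ω => ‖g m (ξ (f m) ω)‖ₑ ^ 2) P :=
    (hind.precomp hf).comp (fun m x => ‖g m x‖ₑ ^ 2) fun m => ((hg m).enorm).pow_const 2
  have h2 : ∀ ω, ‖∏ m, g m (ξ (f m) ω)‖ₑ ^ 2 = ∏ m, ‖g m (ξ (f m) ω)‖ₑ ^ 2 := by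
    intro ω
    rw [Finset.prod_pow]
    congr 1
    simp [enorm_eq_nnnorm]
  simp_rw [h2]
  rw [lintegral_prod_eq_prod_lintegral_of_indepFun Finset.univ _ h1
    fun m => (((hg m).comp (hmeas _)).enorm).pow_const 2]
  exact (Finset.prod_le_prod' fun m _ => hM m).trans (by simp)

lemma memLp_two_of_lintegral_sq_ne_top {f : Ω → ℝ} (hf : AEStronglyMeasurable f P)
    (h : ∫⁻ ω, ‖f ω‖ₑ ^ 2 ∂P ≠ ⊤) : MemLp f 2 P := by
  refine ⟨hf, ?_⟩
  rw [eLpNorm_lt_top_iff_lintegral_rpow_enorm_lt_top (by norm_num) (by norm_num)]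
  simpa using h.lt_top

/-- Two products of functions of independent variables are orthogonal if the first has a centred
factor whose variable does not occur in the second. -/
lemma integral_prod_mul_prod_eq_zero (hind : iIndepFun ξ P) (hmeas : ∀ v, Measurable (ξ v))
    (g : κ → ℝ → ℝ) (hg : ∀ m, Measurable (g m)) (f f' : κ → V) (hf : Function.Injective f)
    (h0 : ∀ m, ∫ ω, g m (ξ (f m) ω) ∂P = 0) {m₀ : κ} (hm₀ : ∀ m, f' m ≠ f m₀) :
    ∫ ω, (∏ m, g m (ξ (f m) ω)) * ∏ m, g m (ξ (f' m) ω) ∂P = 0 := by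
  classical
  set R : Finset V := Finset.univ.image f ∪ Finset.univ.image f' with hR
  have hfR : ∀ m, f m ∈ R := fun m => by simp [hR]
  have hfR' : ∀ m, f' m ∈ R := fun m => by simp [hR]
  -- Both products are grouped by variable, which makes their product one product of functions of
  -- distinct variables; the factor at `f m₀` is then the centred function alone.
  let G : R → ℝ → ℝ := fun u x =>
    (∏ m ∈ Finset.univ.filter fun m => f m = u, g m x) *
      ∏ m ∈ Finset.univ.filter fun m => f' m = u, g m x
  have hG : ∀ u, Measurable (G u) := fun u =>
    (Finset.measurable_fun_prod _ fun m _ => hg m).mul (Finset.measurable_fun_prod _ fun m _ => hg m)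
  have hfib : ∀ (h : κ → V) (hh : ∀ m, h m ∈ R) (ω : Ω), ∏ m, g m (ξ (h m) ω) =
      ∏ u : R, ∏ m ∈ Finset.univ.filter fun m => h m = u, g m (ξ u ω) := by
    intro h hh ω
    rw [Finset.prod_coe_sort R (fun u => ∏ m ∈ Finset.univ.filter fun m => h m = u, g m (ξ u ω)),
      ← Finset.prod_fiberwise_of_maps_to (s := Finset.univ) (t := R) (g := h) (fun m _ => hh m)]
    refine Finset.prod_congr rfl fun u _ => Finset.prod_congr rfl fun m hm => ?_
    rw [(Finset.mem_filter.1 hm).2]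
  have h1 : ∀ ω, (∏ m, g m (ξ (f m) ω)) * ∏ m, g m (ξ (f' m) ω) = ∏ u : R, G u (ξ u ω) := by
    intro ω
    rw [hfib f hfR, hfib f' hfR', ← Finset.prod_mul_distrib]
  simp_rw [h1]
  have hindR : iIndepFun (fun (u : R) => ξ u) P := hind.precomp Subtype.val_injective
  rw [hindR.integral_fun_prod_comp (fun u => (hmeas u).aemeasurable)
    fun u => (hG u).aestronglyMeasurable]
  refine Finset.prod_eq_zero (i := ⟨f m₀, hfR m₀⟩) (Finset.mem_univ _) ?_
  have e1 : (Finset.univ.filter fun m => f m = f m₀) = {m₀} := by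
    ext m; simp [hf.eq_iff]
  have e2 : (Finset.univ.filter fun m => f' m = f m₀) = ∅ := by
    ext m; simp [hm₀]
  simp only [G, e1, e2]
  simpa using h0 m₀

/-- Homogeneous sums of products of centred functions of distinct independent variables are
controlled in `L²` by the `ℓ²` norm of their coefficients: two such products are orthogonal unless
they involve the same variables. -/
lemma integral_norm_sq_centered_sum_le (hind : iIndepFun ξ P) (hmeas : ∀ v, Measurable (ξ v))
    {ι : Type*} [Fintype ι] [DecidableEq κ] (v : κ → ι → V) (hv : ∀ m, Function.Injective (v m))
    (g : κ → ℝ → ℝ) (hg : ∀ m, Measurable (g m))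
    (h0 : ∀ m i, ∫ ω, g m (ξ (v m i) ω) ∂P = 0) {M : ℝ} (hM0 : 0 ≤ M)
    (hM : ∀ m i, ∫⁻ ω, ‖g m (ξ (v m i) ω)‖ₑ ^ 2 ∂P ≤ ENNReal.ofReal M)
    (c : (κ → ι) → ℂ) (hc : ∀ x, ¬ Function.Injective (fun m => v m (x m)) → c x = 0) :
    MemLp (fun ω => ∑ x : κ → ι, c x * ((∏ m, g m (ξ (v m (x m)) ω) : ℝ) : ℂ)) 2 P ∧
    ∫ ω, ‖∑ x : κ → ι, c x * ((∏ m, g m (ξ (v m (x m)) ω) : ℝ) : ℂ)‖ ^ 2 ∂P ≤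
      (Fintype.card κ : ℝ) ^ Fintype.card κ * M ^ Fintype.card κ * ∑ x, ‖c x‖ ^ 2 := by
  classical
  set s : Finset (κ → ι) := Finset.univ.filter fun x => Function.Injective (fun m => v m (x m))
  have hs : ∀ x, x ∈ s ↔ Function.Injective (fun m => v m (x m)) := fun x => by simp [s]
  have hsum : ∀ F : (κ → ι) → ℂ, ∑ x, c x * F x = ∑ x ∈ s, c x * F x := by
    intro F
    refine (Finset.sum_subset (Finset.subset_univ s) fun x _ hx => ?_).symm
    rw [hc x (fun h => hx ((hs x).2 h)), zero_mul]
  let Q : (κ → ι) → Ω → ℝ := fun x ω => ∏ m, g m (ξ (v m (x m)) ω)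
  have hQ2 : ∀ x ∈ s, ∫⁻ ω, ‖Q x ω‖ₑ ^ 2 ∂P ≤ ENNReal.ofReal M ^ Fintype.card κ := fun x hx =>
    lintegral_prod_comp_le hind hmeas g hg (fun m => v m (x m)) ((hs x).1 hx) fun m => hM m (x m)
  have hQm : ∀ x, Measurable (Q x) := fun x =>
    Finset.measurable_fun_prod _ fun m _ => (hg m).comp (hmeas _)
  have hQL : ∀ x ∈ s, MemLp (Q x) 2 P := fun x hx =>
    memLp_two_of_lintegral_sq_ne_top (hQm x).aestronglyMeasurable
      (ne_top_of_le_ne_top (by simp) (hQ2 x hx))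
  have hQM : ∀ x ∈ s, ∫ ω, Q x ω ^ 2 ∂P ≤ M ^ Fintype.card κ := by
    intro x hx
    rw [integral_eq_lintegral_of_nonneg_ae (Eventually.of_forall fun ω => sq_nonneg _)
      ((hQm x).pow_const 2).aestronglyMeasurable]
    refine ENNReal.toReal_le_of_le_ofReal (by positivity) ?_
    rw [ENNReal.ofReal_pow hM0]
    refine le_trans (le_of_eq ?_) (hQ2 x hx)
    refine lintegral_congr fun ω => ?_
    rw [← ofReal_norm, ← ENNReal.ofReal_pow (norm_nonneg _)]
    simp
  refine ⟨?_, ?_⟩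
  · simp_rw [hsum]
    exact memLp_complexSum s c Q hQL
  · simp_rw [hsum]
    let r : (κ → ι) → (κ → ι) → Prop := fun x y =>
      Finset.univ.image (fun m => v m (x m)) = Finset.univ.image fun m => v m (y m)
    have hkey := integral_norm_sq_sum_le_of_almost_orthogonal (P := P) s c Q hQL
      (by positivity : 0 ≤ M ^ Fintype.card κ) hQM r (fun x y h => h.symm) ?_
      (N := Fintype.card κ ^ Fintype.card κ) ?_
    · refine hkey.trans ?_
      push_cast
      refine mul_le_mul_of_nonneg_left ?_ (by positivity)
      exact Finset.sum_le_sum_of_subset_of_nonneg (Finset.subset_univ _) fun _ _ _ => by positivity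
    · intro x hx y hy hxy
      -- Equal cardinalities turn distinctness of the two index sets into an element of the first
      -- that is missing from the second.
      have : ∃ m₀, ∀ m, v m (y m) ≠ v m₀ (x m₀) := by
        by_contra! hcon
        apply hxy
        refine Finset.eq_of_subset_of_card_le ?_ ?_
        · intro u hu
          obtain ⟨m, -, rfl⟩ := Finset.mem_image.1 hu
          obtain ⟨m', hm'⟩ := hcon m
          exact Finset.mem_image.2 ⟨m', Finset.mem_univ _, hm'⟩
        · rw [Finset.card_image_of_injective _ ((hs x).1 hx),
            Finset.card_image_of_injective _ ((hs y).1 hy)]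
      obtain ⟨m₀, hm₀⟩ := this
      exact integral_prod_mul_prod_eq_zero hind hmeas g hg (fun m => v m (x m))
        (fun m => v m (y m)) ((hs x).1 hx) (fun m => h0 m (x m)) hm₀
    · intro x hx
      -- An index tuple over the same set of variables as `x` is a map from the slots into that set.
      have hinj : Function.Injective (fun (y : κ → ι) (m : κ) => v m (y m)) := by
        intro y y' h
        funext m
        exact hv m (congrFun h m)
      calc (s.filter (r x)).card
          = ((s.filter (r x)).image (fun (y : κ → ι) (m : κ) => v m (y m))).card :=
            (Finset.card_image_of_injective _ hinj).symm
        _ ≤ (Fintype.piFinset fun _ : κ => Finset.univ.image fun m => v m (x m)).card := by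
            refine Finset.card_le_card fun z hz => ?_
            obtain ⟨y, hy, rfl⟩ := Finset.mem_image.1 hz
            rw [Fintype.mem_piFinset]
            intro m
            rw [(Finset.mem_filter.1 hy).2]
            exact Finset.mem_image_of_mem _ (Finset.mem_univ m)
        _ ≤ _ := by
            rw [Fintype.card_piFinset]
            simp only [Finset.prod_const, Finset.card_univ]
            exact Nat.pow_le_pow_left (Finset.card_image_le.trans (by simp)) _

end CenteredProducts

/-! ### Second moments of multilinear forms in independent variables -/

section CollisionPattern

variable {κ V : Type*}

/-- The collision pattern of an index tuple `f`: a map that sends every slot to a representative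
of the set of slots at which `f` takes the same value. It depends only on the kernel of `f`. -/
def collisionPattern (f : κ → V) (m : κ) : κ :=
  (Quotient.mk (Setoid.ker f) m).out

lemma apply_collisionPattern (f : κ → V) (m : κ) : f (collisionPattern f m) = f m :=
  Quotient.exact (Quotient.out_eq (Quotient.mk (Setoid.ker f) m))

lemma collisionPattern_eq_iff (f : κ → V) (m m' : κ) :
    collisionPattern f m = collisionPattern f m' ↔ f m = f m' := by
  constructor
  · intro h
    exact (apply_collisionPattern f m).symm.trans
      ((congrArg f h).trans (apply_collisionPattern f m'))
  · intro h
    have : Quotient.mk (Setoid.ker f) m = Quotient.mk (Setoid.ker f) m' := Quotient.sound h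
    simp only [collisionPattern, this]

lemma collisionPattern_congr {V' : Type*} {f : κ → V} {g : κ → V'}
    (h : ∀ m m', f m = f m' ↔ g m = g m') : collisionPattern f = collisionPattern g := by
  have : Setoid.ker f = Setoid.ker g := by
    ext m m'; exact h m m'
  funext m
  unfold collisionPattern
  rw [this]

end CollisionPattern

section SecondMoment

variable {Ω : Type*} [MeasurableSpace Ω] {P : Measure Ω} {V κ ι : Type*} [Fintype κ]
  [DecidableEq κ] [Fintype ι] [DecidableEq ι] {ξ : V → Ω → ℝ}

/-- The constant in `integral_norm_sq_form_le`, for `q` slots and moment bound `M`. -/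
def formConst (q : ℕ) (M : ℝ) : ℝ :=
  (q ^ q * 2 ^ q : ℕ) ^ 2 * (((q : ℝ) + 1) ^ q * M ^ q * (M ^ q) ^ 2)

lemma formConst_nonneg (q : ℕ) {M : ℝ} (hM : 0 ≤ M) : 0 ≤ formConst q M := by
  unfold formConst; positivity

/-- Second moment of a multilinear form in independent variables. The form splits according to the
collision pattern `π` of the index tuple and the set `S` of blocks that carry a centred power; on
the other blocks the power is replaced by its mean, so that the kernel is summed there. Only blocks
of size at least two can be summed out because the variables have mean zero. -/
theorem integral_norm_sq_form_le (hind : iIndepFun ξ P)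
    (hmeas : ∀ v, Measurable (ξ v))
    (v : κ → ι → V) (hv : ∀ m, Function.Injective (v m)) (μ : κ → ℕ → ℝ)
    (hμ : ∀ m i n, ∫ ω, ξ (v m i) ω ^ n ∂P = μ m n) (hμ1 : ∀ m, μ m 1 = 0)
    {M : ℝ} (hM1 : 1 ≤ M) (hμM : ∀ m n, n ≤ Fintype.card κ → |μ m n| ≤ M)
    (hint : ∀ m i n, n ≤ Fintype.card κ → Integrable (fun ω => ξ (v m i) ω ^ n) P)
    (hvar : ∀ m i n, n ≤ Fintype.card κ →
      ∫⁻ ω, ‖ξ (v m i) ω ^ n - μ m n‖ₑ ^ 2 ∂P ≤ ENNReal.ofReal M)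
    (K : (κ → ι) → ℂ) {R : ℝ} (hR : 0 ≤ R)
    (hK : ∀ (π : κ → κ) (S : Finset κ), S ⊆ Finset.univ.image π →
      (∀ b ∈ Finset.univ.image π \ S, 2 ≤ (Finset.univ.filter fun m => π m = b).card) →
      ∑ x : S → ι, ‖∑ t : κ → ι with collisionPattern (fun m => v m (t m)) = π ∧
        (fun b : S => t b) = x, K t‖ ^ 2 ≤ R) :
    MemLp (fun ω => ∑ t : κ → ι, K t * ((∏ m, ξ (v m (t m)) ω : ℝ) : ℂ)) 2 P ∧
    ∫ ω, ‖∑ t : κ → ι, K t * ((∏ m, ξ (v m (t m)) ω : ℝ) : ℂ)‖ ^ 2 ∂P ≤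
      formConst (Fintype.card κ) M * R := by
  have := hind.isProbabilityMeasure
  set q := Fintype.card κ with hq
  let B : (κ → κ) → Finset κ := fun π => Finset.univ.image π
  let n : (κ → κ) → κ → ℕ := fun π b => (Finset.univ.filter fun m => π m = b).card
  have hn : ∀ π b, n π b ≤ q := fun π b => Finset.card_le_univ _
  let F : (κ → κ) → Finset (κ → ι) := fun π =>
    Finset.univ.filter fun t => collisionPattern (fun m => v m (t m)) = π
  let g : (κ → κ) → κ → ℝ → ℝ := fun π b x => x ^ n π b - μ b (n π b)
  let cc : (π : κ → κ) → (S : Finset κ) → (S → ι) → ℂ := fun π S x =>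
    ((∏ b ∈ B π \ S, μ b (n π b) : ℝ) : ℂ) *
      ∑ t : κ → ι with collisionPattern (fun m => v m (t m)) = π ∧ (fun b : S => t b) = x, K t
  let Y : (κ → κ) → Finset κ → Ω → ℂ := fun π S ω =>
    ∑ x : S → ι, cc π S x * ((∏ b : S, g π b (ξ (v b (x b)) ω) : ℝ) : ℂ)
  -- Each variable of `t` occurs as the power `n π b` of its block; writing the power as its centred
  -- part plus its mean and multiplying out gives the sum over `S`.
  have hprod : ∀ (π : κ → κ) (t : κ → ι), t ∈ F π → ∀ ω, ∏ m, ξ (v m (t m)) ω =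
      ∑ S ∈ (B π).powerset, (∏ b ∈ S, g π b (ξ (v b (t b)) ω)) * ∏ b ∈ B π \ S, μ b (n π b) := by
    intro π t ht ω
    have hpat : collisionPattern (fun m => v m (t m)) = π := (Finset.mem_filter.1 ht).2
    have h1 : ∀ m, v m (t m) = v (π m) (t (π m)) := fun m => by
      have := apply_collisionPattern (fun m => v m (t m)) m
      rw [hpat] at this
      exact this.symm
    calc ∏ m, ξ (v m (t m)) ω = ∏ m, ξ (v (π m) (t (π m))) ω :=
          Finset.prod_congr rfl fun m _ => by rw [h1 m]
      _ = ∏ b ∈ B π, ξ (v b (t b)) ω ^ n π b :=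
          Finset.prod_comp (s := Finset.univ) (fun b => ξ (v b (t b)) ω) π
      _ = ∏ b ∈ B π, (g π b (ξ (v b (t b)) ω) + μ b (n π b)) :=
          Finset.prod_congr rfl fun b _ => by simp [g]
      _ = _ := Finset.prod_add _ _ _
  have hX : ∀ ω, ∑ t : κ → ι, K t * ((∏ m, ξ (v m (t m)) ω : ℝ) : ℂ) =
      ∑ a ∈ Finset.univ.sigma fun π => (B π).powerset, Y a.1 a.2 ω := by
    intro ω
    rw [Finset.sum_sigma, ← Finset.sum_fiberwise (s := Finset.univ)
      (g := fun t : κ → ι => collisionPattern (fun m => v m (t m)))]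
    refine Finset.sum_congr rfl fun π _ => ?_
    have : ∀ t ∈ F π, K t * ((∏ m, ξ (v m (t m)) ω : ℝ) : ℂ) =
        ∑ S ∈ (B π).powerset, K t * (((∏ b ∈ S, g π b (ξ (v b (t b)) ω)) *
          ∏ b ∈ B π \ S, μ b (n π b) : ℝ) : ℂ) := by
      intro t ht
      rw [hprod π t ht ω, Complex.ofReal_sum, Finset.mul_sum]
    rw [Finset.sum_congr rfl this, Finset.sum_comm]
    refine Finset.sum_congr rfl fun S _ => ?_
    rw [← Finset.sum_fiberwise (s := F π) (g := fun (t : κ → ι) (b : S) => t b)]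
    refine Finset.sum_congr rfl fun x _ => ?_
    simp only [cc]
    rw [mul_assoc, Finset.sum_mul, Finset.mul_sum]
    rw [Finset.filter_filter]
    refine Finset.sum_congr rfl fun t ht => ?_
    have hx : (fun b : S => t b) = x := (Finset.mem_filter.1 ht).2.2
    have : ∏ b ∈ S, g π b (ξ (v b (t b)) ω) = ∏ b : S, g π b (ξ (v b (x b)) ω) := by
      rw [← hx, ← Finset.prod_coe_sort]
    rw [this]
    push_cast
    ring
  have hg0 : ∀ π b i, ∫ ω, g π b (ξ (v b i) ω) ∂P = 0 := by
    intro π b i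
    simp only [g]
    rw [integral_sub (hint b i _ (hn π b)) (integrable_const _), hμ]
    simp
  have hgm : ∀ π b, Measurable (g π b) := fun π b => by
    simp only [g]; fun_prop
  have hY : ∀ π, ∀ S ∈ (B π).powerset, MemLp (Y π S) 2 P ∧
      ∫ ω, ‖Y π S ω‖ ^ 2 ∂P ≤ ((q : ℝ) + 1) ^ q * M ^ q * (M ^ q) ^ 2 * R := by
    intro π S hS
    have hSB : S ⊆ B π := Finset.mem_powerset.1 hS
    have hcS : Fintype.card S ≤ q := by
      rw [Fintype.card_coe]; exact Finset.card_le_univ S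
    -- Distinct blocks carry distinct variables, so only injective tuples have coefficients.
    have hinj : ∀ x : S → ι, ¬ Function.Injective (fun b : S => v b (x b)) → cc π S x = 0 := by
      intro x hx
      simp only [cc]
      rw [Finset.sum_eq_zero, mul_zero]
      intro t ht
      exfalso
      obtain ⟨hp, hxt⟩ := (Finset.mem_filter.1 ht).2
      apply hx
      intro b b' hbb
      rw [← hxt] at hbb
      have hbb' : v b (t b) = v b' (t b') := hbb
      have h2 := (collisionPattern_eq_iff (fun m => v m (t m)) b b').2 hbb'
      -- Elements of the image of the pattern are fixed by the pattern.
      have hfix : ∀ b ∈ B π, collisionPattern (fun m => v m (t m)) b = b := by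
        intro b hb
        obtain ⟨m, -, rfl⟩ := Finset.mem_image.1 hb
        nth_rewrite 2 [← hp]
        rw [collisionPattern_eq_iff]
        have := apply_collisionPattern (fun m => v m (t m)) m
        rw [hp] at this
        exact this
      rw [hfix b (hSB b.2), hfix b' (hSB b'.2)] at h2
      exact Subtype.ext h2
    obtain ⟨hL, hI⟩ := integral_norm_sq_centered_sum_le hind hmeas (fun b : S => v b)
      (fun b => hv b) (fun b : S => g π b) (fun b => hgm π b) (fun b i => hg0 π b i)
      (by linarith : (0 : ℝ) ≤ M) (fun b i => hvar b i _ (hn π b)) (cc π S) hinj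
    refine ⟨hL, hI.trans ?_⟩
    have hMq : (Fintype.card S : ℝ) ^ Fintype.card S * M ^ Fintype.card S ≤
        ((q : ℝ) + 1) ^ q * M ^ q := by
      have h1 : (Fintype.card S : ℝ) ≤ q := by exact_mod_cast hcS
      refine mul_le_mul ?_ (pow_le_pow_right₀ hM1 hcS) (by positivity) (by positivity)
      calc (Fintype.card S : ℝ) ^ Fintype.card S ≤ ((q : ℝ) + 1) ^ Fintype.card S :=
            pow_le_pow_left₀ (by positivity) (by linarith) _
        _ ≤ _ := pow_le_pow_right₀ (by linarith [(Nat.cast_nonneg q : (0 : ℝ) ≤ q)]) hcS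
    have hcoef : ∑ x, ‖cc π S x‖ ^ 2 ≤ (M ^ q) ^ 2 * R := by
      -- A block of size one that is summed out contributes the factor `μ b 1 = 0`.
      by_cases hsz : ∀ b ∈ B π \ S, 2 ≤ n π b
      · have hmu : |∏ b ∈ B π \ S, μ b (n π b)| ≤ M ^ q := by
          rw [Finset.abs_prod]
          calc ∏ b ∈ B π \ S, |μ b (n π b)| ≤ ∏ _b ∈ B π \ S, M :=
                Finset.prod_le_prod (fun _ _ => abs_nonneg _) fun b _ => hμM b _ (hn π b)
            _ ≤ M ^ q := by
                rw [Finset.prod_const]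
                exact pow_le_pow_right₀ hM1 (Finset.card_le_univ _)
        calc ∑ x, ‖cc π S x‖ ^ 2 ≤ ∑ x : S → ι, (M ^ q) ^ 2 *
              ‖∑ t : κ → ι with collisionPattern (fun m => v m (t m)) = π ∧
                (fun b : S => t b) = x, K t‖ ^ 2 := by
              refine Finset.sum_le_sum fun x _ => ?_
              simp only [cc]
              rw [norm_mul, mul_pow, Complex.norm_real, Real.norm_eq_abs]
              gcongr
          _ ≤ _ := by
              rw [← Finset.mul_sum]
              exact mul_le_mul_of_nonneg_left (hK π S hSB hsz) (by positivity)
      · push Not at hsz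
        obtain ⟨b, hb, hb2⟩ := hsz
        have hb1 : n π b = 1 := by
          have : 0 < n π b := by
            obtain ⟨m, -, hm⟩ := Finset.mem_image.1 (Finset.mem_sdiff.1 hb).1
            exact Finset.card_pos.2 ⟨m, by simp [hm]⟩
          omega
        have : ∀ x, cc π S x = 0 := fun x => by
          simp only [cc]
          rw [Finset.prod_eq_zero hb (by rw [hb1, hμ1]), Complex.ofReal_zero, zero_mul]
        simp only [this, norm_zero]
        simp
        positivity
    calc _ ≤ (((q : ℝ) + 1) ^ q * M ^ q) * ((M ^ q) ^ 2 * R) :=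
          mul_le_mul hMq hcoef (Finset.sum_nonneg fun _ _ => by positivity) (by positivity)
      _ = _ := by ring
  simp_rw [hX]
  set I := Finset.univ.sigma fun π => (B π).powerset with hI
  have hcard : I.card ≤ q ^ q * 2 ^ q := by
    rw [hI, Finset.card_sigma]
    calc ∑ π, (B π).powerset.card ≤ ∑ _π : κ → κ, 2 ^ q := by
          refine Finset.sum_le_sum fun π _ => ?_
          rw [Finset.card_powerset]
          exact Nat.pow_le_pow_right (by norm_num) (Finset.card_le_univ _)
      _ = _ := by simp [hq]
  have hmem : ∀ a ∈ I, a.2 ∈ (B a.1).powerset := fun a ha => (Finset.mem_sigma.1 ha).2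
  refine ⟨memLp_finsetSum _ fun a ha => (hY a.1 a.2 (hmem a ha)).1, ?_⟩
  have hsq : ∀ a ∈ I, Integrable (fun ω => ‖Y a.1 a.2 ω‖ ^ 2) P := fun a ha =>
    (hY a.1 a.2 (hmem a ha)).1.integrable_norm_pow (by norm_num)
  calc ∫ ω, ‖∑ a ∈ I, Y a.1 a.2 ω‖ ^ 2 ∂P ≤ ∫ ω, I.card * ∑ a ∈ I, ‖Y a.1 a.2 ω‖ ^ 2 ∂P := by
        refine integral_mono_of_nonneg (Eventually.of_forall fun ω => sq_nonneg _)
          ((integrable_finsetSum _ hsq).const_mul _) (Eventually.of_forall fun ω => ?_)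
        exact (pow_le_pow_left₀ (norm_nonneg _) (norm_sum_le _ _) 2).trans
          sq_sum_le_card_mul_sum_sq
    _ = I.card * ∑ a ∈ I, ∫ ω, ‖Y a.1 a.2 ω‖ ^ 2 ∂P := by
        rw [integral_const_mul, integral_finsetSum _ hsq]
    _ ≤ I.card * ∑ a ∈ I, ((q : ℝ) + 1) ^ q * M ^ q * (M ^ q) ^ 2 * R := by
        gcongr with a ha
        exact (hY a.1 a.2 (hmem a ha)).2
    _ = (I.card : ℝ) ^ 2 * (((q : ℝ) + 1) ^ q * M ^ q * (M ^ q) ^ 2 * R) := by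
        rw [Finset.sum_const, nsmul_eq_mul]; ring
    _ ≤ _ := by
        unfold formConst
        have : (I.card : ℝ) ≤ (q ^ q * 2 ^ q : ℕ) := by exact_mod_cast hcard
        refine (mul_le_mul_of_nonneg_right (pow_le_pow_left₀ (Nat.cast_nonneg _) this 2)
          (by positivity)).trans_eq (by ring)

end SecondMoment

/-! ### The kernel of a spectrum estimator in the time domain -/

section Phase

/-- The additive character `n ↦ e^{-2πi n / T}` of the integers. -/
def phase (T : ℕ) (n : ℤ) : ℂ := Complex.exp (-Complex.I * (2 * Real.pi * n / T))

lemma phase_add (T : ℕ) (m n : ℤ) : phase T (m + n) = phase T m * phase T n := by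
  unfold phase
  rw [← Complex.exp_add]
  congr 1
  push_cast
  ring

lemma phase_zero (T : ℕ) : phase T 0 = 1 := by simp [phase]

lemma norm_phase (T : ℕ) (n : ℤ) : ‖phase T n‖ = 1 := by
  have : -Complex.I * (2 * Real.pi * n / T) = ((-(2 * Real.pi * n / T) : ℝ) : ℂ) * Complex.I := by
    push_cast; ring
  rw [phase, this, Complex.norm_exp_ofReal_mul_I]

lemma star_phase (T : ℕ) (n : ℤ) : (starRingEnd ℂ) (phase T n) = phase T (-n) := by
  unfold phase
  rw [← Complex.exp_conj]
  congr 1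
  simp [Complex.conj_ofNat]
  ring

lemma phase_sum {α : Type*} (T : ℕ) (s : Finset α) (f : α → ℤ) :
    phase T (∑ a ∈ s, f a) = ∏ a ∈ s, phase T (f a) := by
  classical
  induction s using Finset.induction_on with
  | empty => simp [phase_zero]
  | insert a s ha ih => rw [Finset.sum_insert ha, Finset.prod_insert ha, phase_add, ih]

lemma phase_eq_one_iff {T : ℕ} (hT : 1 ≤ T) (n : ℤ) : phase T n = 1 ↔ (T : ℤ) ∣ n := by
  have hT0 : (T : ℂ) ≠ 0 := by exact_mod_cast (by omega : T ≠ 0)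
  have hpi : (2 * Real.pi * Complex.I : ℂ) ≠ 0 := by
    simp [Real.pi_ne_zero]
  unfold phase
  rw [Complex.exp_eq_one_iff]
  constructor
  · rintro ⟨m, hm⟩
    refine ⟨-m, ?_⟩
    have h1 : (2 * Real.pi * Complex.I) * (n : ℂ) = (2 * Real.pi * Complex.I) * (-(T * m)) := by
      field_simp at hm
      linear_combination (-Complex.I) * Real.pi * 2 * hm
    have h2 := mul_left_cancel₀ hpi h1
    have : (n : ℂ) = ((T * -m : ℤ) : ℂ) := by rw [h2]; push_cast; ring
    exact_mod_cast this
  · rintro ⟨m, rfl⟩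
    refine ⟨-m, ?_⟩
    push_cast
    field_simp

lemma sum_phase_mul {T : ℕ} (hT : 1 ≤ T) (n : ℤ) :
    ∑ t : Fin T, phase T (n * (t : ℕ)) = if (T : ℤ) ∣ n then (T : ℂ) else 0 := by
  have hpow : ∀ t : ℕ, phase T (n * t) = phase T n ^ t := by
    intro t
    induction t with
    | zero => simp [phase_zero]
    | succ t ih => rw [pow_succ, ← ih, ← phase_add]; congr 1; push_cast; ring
  rw [Fin.sum_univ_eq_sum_range (fun t => phase T (n * (t : ℕ)))]
  simp_rw [hpow]
  split_ifs with h
  · rw [(phase_eq_one_iff hT n).2 h]; simp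
  · have h1 : phase T n ≠ 1 := fun h' => h ((phase_eq_one_iff hT n).1 h')
    rw [geom_sum_eq h1, ← hpow, (phase_eq_one_iff hT _).2 (Dvd.intro_left n rfl)]
    simp

/-- Parseval's identity for a trigonometric sum whose frequencies `a s` are
distinct where the coefficient does not vanish. -/
lemma sum_norm_sq_trig_eq {T : ℕ} (hT : 1 ≤ T) {κ σ : Type*} [Fintype κ] [DecidableEq κ] [Fintype σ]
    (a : σ → κ → Fin T) (f : σ → ℂ) (hinj : ∀ s s', f s ≠ 0 → f s' ≠ 0 → a s = a s' → s = s') :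
    ∑ t : κ → Fin T, ‖∑ s, f s * ∏ m, phase T ((a s m : ℕ) * (t m : ℕ))‖ ^ 2 =
      (T : ℝ) ^ Fintype.card κ * ∑ s, ‖f s‖ ^ 2 := by
  classical
  have key : ((∑ t : κ → Fin T, ‖∑ s, f s * ∏ m, phase T ((a s m : ℕ) * (t m : ℕ))‖ ^ 2 : ℝ) : ℂ) =
      (((T : ℝ) ^ Fintype.card κ * ∑ s, ‖f s‖ ^ 2 : ℝ) : ℂ) := by
    have h1 : ∀ z : ℂ, ((‖z‖ ^ 2 : ℝ) : ℂ) = z * (starRingEnd ℂ) z := fun z => by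
      rw [Complex.mul_conj, Complex.normSq_eq_norm_sq]
    rw [Complex.ofReal_sum]
    simp_rw [h1, map_sum, Finset.sum_mul_sum]
    rw [Finset.sum_comm]
    rw [Complex.ofReal_mul, Complex.ofReal_sum, Finset.mul_sum]
    refine Finset.sum_congr rfl fun s _ => ?_
    rw [Finset.sum_comm]
    have h2 : ∀ s', ∑ t : κ → Fin T, (f s * ∏ m, phase T ((a s m : ℕ) * (t m : ℕ))) *
        (starRingEnd ℂ) (f s' * ∏ m, phase T ((a s' m : ℕ) * (t m : ℕ))) =
        f s * (starRingEnd ℂ) (f s') * if a s = a s' then (T : ℂ) ^ Fintype.card κ else 0 := by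
      intro s'
      have h3 : ∀ t : κ → Fin T, (f s * ∏ m, phase T ((a s m : ℕ) * (t m : ℕ))) *
          (starRingEnd ℂ) (f s' * ∏ m, phase T ((a s' m : ℕ) * (t m : ℕ))) =
          f s * (starRingEnd ℂ) (f s') *
            ∏ m, phase T ((((a s m : ℕ) : ℤ) - (a s' m : ℕ)) * (t m : ℕ)) := by
        intro t
        rw [map_mul, map_prod, mul_mul_mul_comm, ← Finset.prod_mul_distrib]
        congr 1
        refine Finset.prod_congr rfl fun m _ => ?_
        rw [star_phase, ← phase_add]
        congr 1
        ring
      simp_rw [h3]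
      rw [← Finset.mul_sum]
      congr 1
      have h4 := Finset.prod_univ_sum (fun _ : κ => (Finset.univ : Finset (Fin T)))
        (fun m t => phase T ((((a s m : ℕ) : ℤ) - (a s' m : ℕ)) * (t : ℕ)))
      rw [Fintype.piFinset_univ] at h4
      rw [← h4]
      simp_rw [sum_phase_mul hT]
      have h5 : ∀ m, ((T : ℤ) ∣ ((a s m : ℕ) : ℤ) - (a s' m : ℕ)) ↔ a s m = a s' m := by
        intro m
        constructor
        · intro h
          have hlt : |((a s m : ℕ) : ℤ) - (a s' m : ℕ)| < T := by
            have := (a s m).2; have := (a s' m).2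
            rw [abs_lt]; constructor <;> omega
          have := Int.eq_zero_of_abs_lt_dvd h hlt
          exact Fin.ext (by omega)
        · intro h; rw [h]; simp
      simp_rw [h5]
      split_ifs with h
      · rw [Finset.prod_congr rfl (g := fun _ => (T : ℂ)) fun m _ => by rw [if_pos (congrFun h m)]]
        simp
      · obtain ⟨m, hm⟩ := Function.ne_iff.1 h
        exact Finset.prod_eq_zero (Finset.mem_univ m) (if_neg hm)
    simp_rw [h2]
    rw [Finset.sum_eq_single s]
    · rw [if_pos rfl, ← h1]
      push_cast
      ring
    · intro s' _ hs'
      by_cases hf : f s = 0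
      · simp [hf]
      by_cases hf' : f s' = 0
      · simp [hf']
      rw [if_neg fun h => hs' (hinj s s' hf hf' h).symm, mul_zero]
    · simp
  exact_mod_cast key

end Phase

section Kernel

variable {k T : ℕ}

/-- The time-domain kernel of a spectrum estimator with frequency weights `w`: the coefficient of
`∏ x_{t_m}` in the estimator. It is defined at all integer times. -/
def timeKernel (w : (Fin k → Fin T) → ℝ) (z : Fin k → ℤ) : ℂ :=
  ((T : ℂ) ^ k)⁻¹ * ∑ s, (w s : ℂ) * ∏ m, phase T ((s m : ℕ) * z m)

/-- Bounds on the frequency weights of a spectrum estimator that give a second-moment bound for it: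
weights of total mass `T^{k-1}` and sup norm `T`, concentrated on tuples with total `0` modulo `T`,
and with little mass on each of the proper submanifolds `∑_{m ∈ B} s_m ≡ 0`. -/
structure WeightBound (w : (Fin k → Fin T) → ℝ) (C : ℝ) : Prop where
  supp : ∀ s, w s ≠ 0 → T ∣ ∑ m, (s m : ℕ)
  l1 : ∑ s, |w s| ≤ C * (T : ℝ) ^ k / T
  l2 : ∑ s, w s ^ 2 ≤ C * (T : ℝ) ^ k
  block : ∀ B : Finset (Fin k), 2 ≤ B.card → B.card < k →
    (T : ℝ) ^ (k - B.card) *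
      (T * ((T : ℝ) ^ k)⁻¹ * ∑ s with T ∣ ∑ m ∈ B, (s m : ℕ), |w s|) ^ 2 ≤ C

lemma norm_timeKernel_le (w : (Fin k → Fin T) → ℝ) (z : Fin k → ℤ) :
    ‖timeKernel w z‖ ≤ ((T : ℝ) ^ k)⁻¹ * ∑ s, |w s| := by
  unfold timeKernel
  rw [norm_mul, norm_inv, norm_pow, Complex.norm_natCast]
  refine mul_le_mul_of_nonneg_left ((norm_sum_le _ _).trans (Finset.sum_le_sum fun s _ => ?_))
    (by positivity)
  rw [norm_mul, norm_prod]
  simp [norm_phase]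

lemma WeightBound.norm_timeKernel_le (hT : 1 ≤ T) {w : (Fin k → Fin T) → ℝ} {C : ℝ}
    (hw : WeightBound w C) (z : Fin k → ℤ) : ‖timeKernel w z‖ ≤ C / T := by
  have hT0 : (0 : ℝ) < T := by exact_mod_cast hT
  refine (SVARMA.norm_timeKernel_le w z).trans ?_
  calc ((T : ℝ) ^ k)⁻¹ * ∑ s, |w s| ≤ ((T : ℝ) ^ k)⁻¹ * (C * (T : ℝ) ^ k / T) :=
        mul_le_mul_of_nonneg_left hw.l1 (by positivity)
    _ = C / T := by field_simp

/-- Summing the kernel over a common time shift of the slots in `B` leaves only the frequencies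
with `∑_{m ∈ B} s_m ≡ 0`. -/
lemma norm_sum_timeKernel_shift_le (hT : 1 ≤ T) (w : (Fin k → Fin T) → ℝ) (B : Finset (Fin k))
    (a z : Fin k → ℤ) :
    ‖∑ τ : Fin T, timeKernel w (fun m => if m ∈ B then ((τ : ℕ) : ℤ) + a m else z m)‖ ≤
      T * ((T : ℝ) ^ k)⁻¹ * ∑ s with T ∣ ∑ m ∈ B, (s m : ℕ), |w s| := by
  unfold timeKernel
  rw [← Finset.mul_sum, Finset.sum_comm]
  have h1 : ∀ s : Fin k → Fin T, ∑ τ : Fin T, (w s : ℂ) *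
      ∏ m, phase T ((s m : ℕ) * (if m ∈ B then ((τ : ℕ) : ℤ) + a m else z m)) =
      (w s : ℂ) * (∏ m, phase T ((s m : ℕ) * (if m ∈ B then a m else z m))) *
        if T ∣ ∑ m ∈ B, (s m : ℕ) then (T : ℂ) else 0 := by
    intro s
    have h2 : ∀ τ : Fin T,
        ∏ m, phase T ((s m : ℕ) * (if m ∈ B then ((τ : ℕ) : ℤ) + a m else z m)) =
        (∏ m, phase T ((s m : ℕ) * (if m ∈ B then a m else z m))) *
          phase T (((∑ m ∈ B, (s m : ℕ) : ℕ) : ℤ) * (τ : ℕ)) := by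
      intro τ
      rw [Nat.cast_sum, Finset.sum_mul, phase_sum, ← Fintype.prod_ite_mem B,
        ← Finset.prod_mul_distrib]
      refine Finset.prod_congr rfl fun m _ => ?_
      split_ifs
      · rw [← phase_add]; congr 1; ring
      · simp
    simp_rw [h2, ← mul_assoc]
    rw [← Finset.mul_sum, sum_phase_mul hT]
    congr 1
    simp only [Int.natCast_dvd_natCast]
  simp_rw [h1]
  rw [norm_mul, norm_inv, norm_pow, Complex.norm_natCast, mul_comm (T : ℝ), mul_assoc]
  refine mul_le_mul_of_nonneg_left ?_ (by positivity)
  refine (norm_sum_le _ _).trans ?_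
  rw [Finset.sum_filter, Finset.mul_sum]
  refine Finset.sum_le_sum fun s _ => ?_
  rw [norm_mul, norm_mul, norm_prod]
  split_ifs <;> simp [norm_phase, mul_comm]

/-- The integer times obtained from sample times for the slots in `M` and the fixed times `r` for
the others. -/
def extendTimes (M : Finset (Fin k)) (r : Fin k → Fin T) (t : M → Fin T) (m : Fin k) : ℤ :=
  if h : m ∈ M then ((t ⟨m, h⟩ : ℕ) : ℤ) else ((r m : ℕ) : ℤ)

/-- Parseval for the kernel with at most one slot fixed. A fixed slot loses no frequencies since
the weights live on tuples with total `0`, which are determined by any `k - 1` entries. -/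
lemma WeightBound.sum_norm_sq_timeKernel_le (hT : 1 ≤ T) {w : (Fin k → Fin T) → ℝ} {C : ℝ}
    (hw : WeightBound w C) (M : Finset (Fin k)) (hM : k ≤ M.card + 1) (r : Fin k → Fin T) :
    ∑ t : M → Fin T, ‖timeKernel w (extendTimes M r t)‖ ^ 2 ≤ C / (T : ℝ) ^ (k - M.card) := by
  classical
  have hT0 : (0 : ℝ) < T := by exact_mod_cast hT
  have hMk : M.card ≤ k := by simpa using Finset.card_le_univ M
  let f : (Fin k → Fin T) → ℂ := fun s =>
    (w s : ℂ) * ∏ m : {m // m ∉ M}, phase T ((s m : ℕ) * (r m : ℕ))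
  have hf : ∀ s, ‖f s‖ = |w s| := by
    intro s
    simp only [f]
    rw [norm_mul, norm_prod]
    simp [norm_phase]
  have hK : ∀ t : M → Fin T, timeKernel w (extendTimes M r t) =
      ((T : ℂ) ^ k)⁻¹ * ∑ s, f s * ∏ m : M, phase T ((s m : ℕ) * (t m : ℕ)) := by
    intro t
    unfold timeKernel
    congr 1
    refine Finset.sum_congr rfl fun s _ => ?_
    rw [← Fintype.prod_subtype_mul_prod_subtype (fun m => m ∈ M)]
    simp only [f]
    rw [mul_assoc, mul_comm (∏ m : {m // m ∉ M}, _)]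
    congr 2
    · refine Finset.prod_congr (by ext; simp) fun m _ => ?_
      rw [extendTimes, dif_pos m.2]
    · refine Finset.prod_congr rfl fun m _ => ?_
      rw [extendTimes, dif_neg m.2]
  -- Two frequency tuples that agree on `M` differ in one entry at most, and there by a multiple of
  -- `T`.
  have hinj : ∀ s s' : Fin k → Fin T, f s ≠ 0 → f s' ≠ 0 →
      (fun m : M => s m) = (fun m : M => s' m) → s = s' := by
    intro s s' hs hs' heq
    have hws : ∀ s, f s ≠ 0 → w s ≠ 0 := fun s h h0 => h (by simp [f, h0])
    have hMc : Mᶜ.card ≤ 1 := by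
      rw [Finset.card_compl, Fintype.card_fin]; omega
    have hin : ∀ m ∈ M, s m = s' m := fun m hm => congrFun heq ⟨m, hm⟩
    by_contra hne
    obtain ⟨m₀, hm₀⟩ := Function.ne_iff.1 hne
    have hothers : ∀ m, m ≠ m₀ → s m = s' m := by
      intro m hm
      by_contra h
      have h1 : m ∈ Mᶜ := Finset.mem_compl.2 fun h' => h (hin m h')
      have h2 : m₀ ∈ Mᶜ := Finset.mem_compl.2 fun h' => hm₀ (hin m₀ h')
      exact hm (Finset.card_le_one.1 hMc m h1 m₀ h2)
    have d1 : (T : ℤ) ∣ ∑ m, ((s m : ℕ) : ℤ) := by exact_mod_cast hw.supp s (hws s hs)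
    have d2 : (T : ℤ) ∣ ∑ m, ((s' m : ℕ) : ℤ) := by exact_mod_cast hw.supp s' (hws s' hs')
    have d3 := dvd_sub d1 d2
    rw [← Finset.sum_sub_distrib, Finset.sum_eq_single m₀ (fun m _ hm => by
      rw [hothers m hm, sub_self]) (by simp)] at d3
    have hlt : |((s m₀ : ℕ) : ℤ) - (s' m₀ : ℕ)| < T := by
      have := (s m₀).2; have := (s' m₀).2
      rw [abs_lt]; constructor <;> omega
    have := Int.eq_zero_of_abs_lt_dvd d3 hlt
    exact hm₀ (Fin.ext (by omega))
  simp_rw [hK, norm_mul, mul_pow]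
  rw [← Finset.mul_sum, sum_norm_sq_trig_eq hT (fun s (m : M) => s m) f hinj]
  simp_rw [hf, sq_abs]
  rw [norm_inv, norm_pow, Complex.norm_natCast, Fintype.card_coe]
  calc ((T : ℝ) ^ k)⁻¹ ^ 2 * ((T : ℝ) ^ M.card * ∑ s, w s ^ 2)
      ≤ ((T : ℝ) ^ k)⁻¹ ^ 2 * ((T : ℝ) ^ M.card * (C * (T : ℝ) ^ k)) := by
        gcongr; exact hw.l2
    _ = C / (T : ℝ) ^ (k - M.card) := by
        have : (T : ℝ) ^ k = (T : ℝ) ^ M.card * (T : ℝ) ^ (k - M.card) := by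
          rw [← pow_add]; congr 1; omega
        rw [this]
        field_simp

end Kernel

/-! ### Sums of the kernel over collision patterns -/

section PatternSums

variable {V κ ι : Type*} [Fintype κ] [DecidableEq κ] [Fintype ι] [DecidableEq ι]

/-- Sums over the index tuples with collision pattern `π` when all blocks carry a centred power:
the tuple is determined by its values on the blocks. -/
lemma sum_norm_sq_pattern_le_of_full (v : κ → ι → V) (hv : ∀ m, Function.Injective (v m))
    (π : κ → κ) (K : (κ → ι) → ℂ) :
    ∑ x : ↥(Finset.univ.image π) → ι,
      ‖∑ t : κ → ι with collisionPattern (fun m => v m (t m)) = π ∧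
        (fun b : ↥(Finset.univ.image π) => t b) = x, K t‖ ^ 2 ≤ ∑ t, ‖K t‖ ^ 2 := by
  rw [← Finset.sum_fiberwise (s := Finset.univ)
    (g := fun (t : κ → ι) (b : ↥(Finset.univ.image π)) => t b)]
  refine Finset.sum_le_sum fun x _ => ?_
  set Fx : Finset (κ → ι) := Finset.univ.filter fun t =>
    collisionPattern (fun m => v m (t m)) = π ∧
      (fun b : ↥(Finset.univ.image π) => t b) = x
  -- The pattern together with the values at the representatives determines the tuple.
  have hFx : Fx.card ≤ 1 := by
    rw [Finset.card_le_one]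
    intro t ht t' ht'
    obtain ⟨hp, hx⟩ := (Finset.mem_filter.1 ht).2
    obtain ⟨hp', hx'⟩ := (Finset.mem_filter.1 ht').2
    funext m
    apply hv m
    have e1 := apply_collisionPattern (fun m => v m (t m)) m
    have e2 := apply_collisionPattern (fun m => v m (t' m)) m
    rw [hp] at e1
    rw [hp'] at e2
    have e3 : t (π m) = t' (π m) :=
      congrFun (hx.trans hx'.symm) ⟨π m, Finset.mem_image_of_mem π (Finset.mem_univ m)⟩
    rw [← e1, ← e2]
    simp only [e3]
  calc ‖∑ t ∈ Fx, K t‖ ^ 2 ≤ (∑ t ∈ Fx, ‖K t‖) ^ 2 :=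
        pow_le_pow_left₀ (norm_nonneg _) (norm_sum_le _ _) 2
    _ ≤ Fx.card * ∑ t ∈ Fx, ‖K t‖ ^ 2 := sq_sum_le_card_mul_sum_sq
    _ ≤ 1 * ∑ t ∈ Fx, ‖K t‖ ^ 2 := by
        refine mul_le_mul_of_nonneg_right (by exact_mod_cast hFx)
          (Finset.sum_nonneg fun _ _ => by positivity)
    _ ≤ _ := by
        rw [one_mul]
        refine Finset.sum_le_sum_of_subset_of_nonneg (fun t ht => ?_) fun _ _ _ => by positivity
        exact Finset.mem_filter.2 ⟨Finset.mem_univ t, (Finset.mem_filter.1 ht).2.2⟩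

/-- Sums over the index tuples with collision pattern `π` when the block of `b` is summed out: it
is enough to bound the sum over the position of that block, all other positions being fixed. -/
lemma sum_norm_sq_pattern_le_of_block [Nonempty ι] (v : κ → ι → V)
    (hv : ∀ m, Function.Injective (v m))
    (π : κ → κ) (S : Finset κ) (hS : S ⊆ Finset.univ.image π)
    (hsz : ∀ b ∈ Finset.univ.image π \ S, 2 ≤ (Finset.univ.filter fun m => π m = b).card)
    {b : κ} (hb : b ∈ Finset.univ.image π \ S) (K : (κ → ι) → ℂ) {γ : ℝ} (hγ0 : 0 ≤ γ)
    (hγ : ∀ y : κ → ι, ‖∑ t : κ → ι with collisionPattern (fun m => v m (t m)) = π ∧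
      ∀ m, π m ≠ b → t m = y m, K t‖ ≤ γ) :
    ∑ x : S → ι, ‖∑ t : κ → ι with collisionPattern (fun m => v m (t m)) = π ∧
        (fun b : S => t b) = x, K t‖ ^ 2 ≤
      (Fintype.card ι : ℝ) ^ (Fintype.card κ - (Finset.univ.filter fun m => π m = b).card) *
        γ ^ 2 := by
  classical
  set B := Finset.univ.image π with hB
  set E := (B \ S).erase b with hE
  set N : ℝ := ((Fintype.card ι : ℕ) : ℝ) with hN
  have hN1 : 1 ≤ N := by
    rw [hN]; exact_mod_cast Fintype.card_pos (α := ι)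
  have hbound : ∀ x : S → ι, ‖∑ t : κ → ι with collisionPattern (fun m => v m (t m)) = π ∧
        (fun b : S => t b) = x, K t‖ ≤ N ^ E.card * γ := by
    intro x
    set Fx : Finset (κ → ι) := Finset.univ.filter fun t =>
      collisionPattern (fun m => v m (t m)) = π ∧ (fun b : S => t b) = x with hFx
    let rest : (κ → ι) → {m // π m ≠ b} → ι := fun t m => t m
    have hmem : ∀ t ∈ Fx, collisionPattern (fun m => v m (t m)) = π ∧ (fun b : S => t b) = x :=
      fun t ht => (Finset.mem_filter.1 ht).2
    have hYc : ∀ y ∈ Fx.image rest, ∃ t ∈ Fx, rest t = y := fun y hy => Finset.mem_image.1 hy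
    have hfix : ∀ t ∈ Fx, ∀ m ∈ B, π m = m := by
      intro t ht m hm
      obtain ⟨m', -, rfl⟩ := Finset.mem_image.1 hm
      have hp := (hmem t ht).1
      have h1 := apply_collisionPattern (fun m => v m (t m)) m'
      rw [hp] at h1
      have h2 := (collisionPattern_eq_iff (fun m => v m (t m)) (π m') m').2 h1
      rw [hp] at h2
      exact h2
    -- Given `x`, the positions of the blocks in `E` determine all positions outside the block of
    -- `b`.
    have hcard : (Fx.image rest).card ≤ Fintype.card ι ^ E.card := by
      choose! pick hpick using hYc
      have := Finset.card_le_card_of_injOn (s := Fx.image rest)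
        (t := (Finset.univ : Finset (E → ι))) (fun y e => pick y e) (fun _ _ => Finset.mem_coe.2
          (Finset.mem_univ _)) ?_
      · simpa using this
      · intro y hy y' hy' hyy
        obtain ⟨ht, hty⟩ := hpick y hy
        obtain ⟨ht', hty'⟩ := hpick y' hy'
        have hx := ((hmem _ ht).2).trans ((hmem _ ht').2).symm
        have hagree : ∀ m ∈ B, m ≠ b → pick y m = pick y' m := by
          intro m hm hmb
          by_cases hmS : m ∈ S
          · exact congrFun hx ⟨m, hmS⟩
          · exact congrFun hyy ⟨m, Finset.mem_erase.2 ⟨hmb, Finset.mem_sdiff.2 ⟨hm, hmS⟩⟩⟩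
        rw [← hty, ← hty']
        funext m
        apply hv m
        have e1 := apply_collisionPattern (fun m => v m (pick y m)) m
        have e2 := apply_collisionPattern (fun m => v m (pick y' m)) m
        rw [(hmem _ ht).1] at e1
        rw [(hmem _ ht').1] at e2
        have e3 := hagree (π m) (Finset.mem_image_of_mem π (Finset.mem_univ _)) m.2
        show v m (pick y m) = v m (pick y' m)
        rw [← e1, ← e2]
        simp only [e3]
    calc ‖∑ t ∈ Fx, K t‖ = ‖∑ y ∈ Fx.image rest, ∑ t ∈ Fx with rest t = y, K t‖ := by
          rw [Finset.sum_fiberwise_of_maps_to (fun t ht => Finset.mem_image_of_mem rest ht)]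
      _ ≤ ∑ y ∈ Fx.image rest, ‖∑ t ∈ Fx with rest t = y, K t‖ := norm_sum_le _ _
      _ ≤ ∑ _y ∈ Fx.image rest, γ := by
          refine Finset.sum_le_sum fun y hy => ?_
          obtain ⟨t₀, ht₀, rfl⟩ := Finset.mem_image.1 hy
          refine le_trans (le_of_eq ?_) (hγ t₀)
          congr 1
          refine Finset.sum_congr ?_ fun _ _ => rfl
          ext t
          simp only [hFx, Finset.mem_filter, Finset.mem_univ, true_and, rest]
          constructor
          · rintro ⟨⟨hp, -⟩, hr⟩
            exact ⟨hp, fun m hm => congrFun hr ⟨m, hm⟩⟩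
          · rintro ⟨hp, hr⟩
            refine ⟨⟨hp, ?_⟩, funext fun m => hr m m.2⟩
            rw [← (hmem t₀ ht₀).2]
            funext s
            refine hr s ?_
            rw [hfix t₀ ht₀ s (hS s.2)]
            intro h
            exact (Finset.mem_sdiff.1 hb).2 (h ▸ s.2)
      _ = (Fx.image rest).card * γ := by rw [Finset.sum_const, nsmul_eq_mul]
      _ ≤ N ^ E.card * γ := by
          refine mul_le_mul_of_nonneg_right ?_ hγ0
          rw [hN]; exact_mod_cast hcard
  -- The blocks in `E` have at least two slots each, so that the factor `N ^ E.card` is counted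
  -- twice within the number of slots outside the block of `b`.
  have hcount : S.card + 2 * E.card ≤
      Fintype.card κ - (Finset.univ.filter fun m => π m = b).card := by
    have h1 : Fintype.card κ = ∑ b' ∈ B, (Finset.univ.filter fun m => π m = b').card :=
      Finset.card_eq_sum_card_image π Finset.univ
    have hbB : b ∈ B \ S := hb
    have h2 : ∑ b' ∈ B, (Finset.univ.filter fun m => π m = b').card =
        ∑ b' ∈ B \ S, (Finset.univ.filter fun m => π m = b').card +
          ∑ b' ∈ S, (Finset.univ.filter fun m => π m = b').card :=
      (Finset.sum_sdiff hS).symm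
    have h3 : ∑ b' ∈ E, (Finset.univ.filter fun m => π m = b').card +
        (Finset.univ.filter fun m => π m = b).card =
          ∑ b' ∈ B \ S, (Finset.univ.filter fun m => π m = b').card :=
      Finset.sum_erase_add _ _ hbB
    have h4 : E.card * 2 ≤ ∑ b' ∈ E, (Finset.univ.filter fun m => π m = b').card := by
      rw [← smul_eq_mul]
      exact Finset.card_nsmul_le_sum _ _ _ fun b' hb' => hsz b' (Finset.mem_of_mem_erase hb')
    have h5 : S.card * 1 ≤ ∑ b' ∈ S, (Finset.univ.filter fun m => π m = b').card := by
      rw [← smul_eq_mul]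
      refine Finset.card_nsmul_le_sum _ _ _ fun b' hb' => ?_
      obtain ⟨m, -, hm⟩ := Finset.mem_image.1 (hS hb')
      exact Finset.card_pos.2 ⟨m, by simp [hm]⟩
    omega
  calc _ ≤ ∑ _x : S → ι, (N ^ E.card * γ) ^ 2 :=
        Finset.sum_le_sum fun x _ => pow_le_pow_left₀ (norm_nonneg _) (hbound x) 2
    _ = N ^ (S.card + 2 * E.card) * γ ^ 2 := by
        rw [Finset.sum_const, nsmul_eq_mul, Finset.card_univ, Fintype.card_fun, Fintype.card_coe]
        push_cast
        ring
    _ ≤ _ := mul_le_mul_of_nonneg_right (pow_le_pow_right₀ hN1 hcount) (by positivity)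

end PatternSums

section KernelPattern

variable {k T d : ℕ}

lemma card_filter_shift_not_mem_le {T : ℕ} (a : ℤ) (lo : ℕ) :
    (Finset.univ.filter fun τ : Fin T => ¬ ((lo : ℤ) ≤ (τ : ℕ) + a ∧ ((τ : ℕ) : ℤ) + a < T)).card ≤
      a.natAbs + lo := by
  -- Bad positions form an initial segment of length `lo - a` and a final one of length `a`.
  have hsub : (Finset.univ.filter fun τ : Fin T =>
      ¬ ((lo : ℤ) ≤ (τ : ℕ) + a ∧ ((τ : ℕ) : ℤ) + a < T)).map Fin.valEmbedding ⊆
      Finset.range ((lo : ℤ) - a).toNat ∪ Finset.Ico (T - a.toNat) T := by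
    intro n hn
    obtain ⟨τ, hτ, rfl⟩ := Finset.mem_map.1 hn
    have h := (Finset.mem_filter.1 hτ).2
    have h2 := τ.2
    simp only [Fin.valEmbedding_apply, Finset.mem_union, Finset.mem_range, Finset.mem_Ico]
    omega
  calc _ = _ := (Finset.card_map Fin.valEmbedding).symm
    _ ≤ _ := Finset.card_le_card hsub
    _ ≤ _ := Finset.card_union_le _ _
    _ ≤ _ := by
      rw [Finset.card_range, Nat.card_Ico]
      omega

/-- The index of the shock in a slot with component `e` and lag `j`, as a function of time. -/
def shockIndex {T : ℕ} (j : ℤ) (e : Fin d) (t : Fin T) : ℤ × Fin d := (((t : ℕ) : ℤ) - j, e)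

lemma shockIndex_injective {T : ℕ} (j : ℤ) (e : Fin d) :
    Function.Injective (shockIndex (T := T) j e) := by
  intro t t' h
  have := (Prod.ext_iff.1 h).1
  simp only [shockIndex] at this
  exact Fin.ext (by omega)

/-- The kernel with the slots in `M` running over sample times from `lo` on and the other slots
fixed at `r`. -/
def truncKernel (w : (Fin k → Fin T) → ℝ) (M : Finset (Fin k)) (r : Fin k → Fin T) (lo : M → ℕ)
    (t : M → Fin T) : ℂ :=
  if ∀ m, lo m ≤ (t m : ℕ) then timeKernel w (extendTimes M r t) else 0

lemma norm_truncKernel_sq_le (w : (Fin k → Fin T) → ℝ) (M : Finset (Fin k)) (r : Fin k → Fin T)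
    (lo : M → ℕ) (t : M → Fin T) :
    ‖truncKernel w M r lo t‖ ^ 2 ≤ ‖timeKernel w (extendTimes M r t)‖ ^ 2 := by
  unfold truncKernel
  split_ifs
  · rfl
  · simp

/-- The sum of the kernel over the position of one block of coinciding shocks, the positions of
the other blocks being fixed, differs from a full cyclic sum by a number of terms of the order of
the lags. -/
lemma norm_sum_block_le (hT : 1 ≤ T) {w : (Fin k → Fin T) → ℝ} {C : ℝ}
    (hw : WeightBound w C) (M : Finset (Fin k)) (hM4 : M.card ≤ 4) (r : Fin k → Fin T)
    (j : M → ℤ) (e : M → Fin d) (lo : M → ℕ) {ℓ : ℕ} (hℓ : 1 ≤ ℓ) (hj : ∀ m, (j m).natAbs ≤ ℓ)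
    (hlo : ∀ m, lo m ≤ ℓ) (π : M → M) {b : M}
    (hb : b ∈ Finset.univ.image π) (y : M → Fin T) :
    ‖∑ t : M → Fin T with collisionPattern (fun m => shockIndex (j m) (e m) (t m)) = π ∧
        ∀ m, π m ≠ b → t m = y m, truncKernel w M r lo t‖ ≤
      T * ((T : ℝ) ^ k)⁻¹ * (∑ s with T ∣ ∑ m ∈ (Finset.univ.filter fun m => π m = b).map
        (Function.Embedding.subtype _), (s m : ℕ), |w s|) + 16 * ℓ * (C / T) := by
  classical
  have hC : 0 ≤ C / T := (norm_nonneg _).trans (hw.norm_timeKernel_le hT 0)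
  set Bl : Finset (Fin k) := (Finset.univ.filter fun m => π m = b).map
    (Function.Embedding.subtype _) with hBl
  have hmemBl : ∀ m : M, (m : Fin k) ∈ Bl ↔ π m = b := by
    intro m
    simp [hBl]
  have hBlM : ∀ m ∈ Bl, m ∈ M := by
    intro m hm
    obtain ⟨m', -, rfl⟩ := Finset.mem_map.1 hm
    exact m'.2
  set F : Finset (M → Fin T) := Finset.univ.filter fun t =>
    (collisionPattern (fun m => shockIndex (j m) (e m) (t m)) = π ∧
      ∀ m, π m ≠ b → t m = y m) ∧ ∀ m, lo m ≤ (t m : ℕ) with hF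
  have hsum : ∑ t : M → Fin T with collisionPattern (fun m => shockIndex (j m) (e m) (t m)) = π ∧
        ∀ m, π m ≠ b → t m = y m, truncKernel w M r lo t =
      ∑ t ∈ F, timeKernel w (extendTimes M r t) := by
    unfold truncKernel
    rw [← Finset.sum_filter, Finset.filter_filter]
  rw [hsum]
  have hnn : 0 ≤ T * ((T : ℝ) ^ k)⁻¹ * (∑ s with T ∣ ∑ m ∈ Bl, (s m : ℕ), |w s|) :=
    mul_nonneg (by positivity) (Finset.sum_nonneg fun _ _ => abs_nonneg _)
  rcases F.eq_empty_or_nonempty with hF0 | ⟨t₀, ht₀⟩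
  · rw [hF0, Finset.sum_empty, norm_zero]
    positivity
  have hmem : ∀ t ∈ F, (collisionPattern (fun m => shockIndex (j m) (e m) (t m)) = π ∧
      ∀ m, π m ≠ b → t m = y m) ∧ ∀ m, lo m ≤ (t m : ℕ) := fun t ht => (Finset.mem_filter.1 ht).2
  have hrel : ∀ t ∈ F, ∀ m m', shockIndex (j m) (e m) (t m) = shockIndex (j m') (e m') (t m') ↔
      π m = π m' := by
    intro t ht m m'
    rw [← (hmem t ht).1.1]
    exact (collisionPattern_eq_iff (fun m => shockIndex (j m) (e m) (t m)) m m').symm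
  have hbπ : π b = b := by
    obtain ⟨m', -, hm'⟩ := Finset.mem_image.1 hb
    have h1 := apply_collisionPattern (fun m => shockIndex (j m) (e m) (t₀ m)) m'
    rw [(hmem t₀ ht₀).1.1, hm'] at h1
    exact ((hrel t₀ ht₀ b m').1 h1).trans hm'
  set a : Fin k → ℤ := fun m => if h : m ∈ M then j ⟨m, h⟩ - j b else 0 with ha
  set z₀ : Fin k → ℤ := extendTimes M r t₀ with hz₀
  -- The times of the form when the block of `b` is moved rigidly to the position `τ` of slot `b`.
  let Z : Fin T → Fin k → ℤ := fun τ m => if m ∈ Bl then ((τ : ℕ) : ℤ) + a m else z₀ m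
  have hshift : ∀ t ∈ F, ∀ m, π m = b →
      ((t m : ℕ) : ℤ) = (t b : ℕ) + (j m - j b) ∧ e m = e b := by
    intro t ht m hm
    have h := (hrel t ht m b).2 (by rw [hm, hbπ])
    have h1 := congrArg Prod.fst h
    have h2 := congrArg Prod.snd h
    simp only [shockIndex] at h1 h2
    exact ⟨by omega, h2⟩
  have hinj : Set.InjOn (fun t : M → Fin T => t b) F := by
    intro t ht t' ht' htt
    have htt' : t b = t' b := htt
    funext m
    by_cases hm : π m = b
    · have h1 := (hshift t ht m hm).1
      have h2 := (hshift t' ht' m hm).1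
      rw [htt'] at h1
      exact Fin.ext (by omega)
    · rw [(hmem t ht).1.2 m hm, (hmem t' ht').1.2 m hm]
  have hZ : ∀ t ∈ F, extendTimes M r t = Z (t b) := by
    intro t ht
    funext m
    simp only [Z, hz₀]
    by_cases hm : m ∈ M
    · by_cases hmB : m ∈ Bl
      · rw [if_pos hmB, extendTimes, dif_pos hm, ha]
        simp only [dif_pos hm]
        exact (hshift t ht ⟨m, hm⟩ ((hmemBl ⟨m, hm⟩).1 hmB)).1
      · have hπ : π ⟨m, hm⟩ ≠ b := fun h => hmB ((hmemBl ⟨m, hm⟩).2 h)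
        rw [if_neg hmB, extendTimes, extendTimes, dif_pos hm, dif_pos hm, (hmem t ht).1.2 _ hπ,
          (hmem t₀ ht₀).1.2 _ hπ]
    · rw [if_neg fun h => hm (hBlM m h), extendTimes, extendTimes, dif_neg hm, dif_neg hm]
  set G : Finset (Fin T) := F.image fun t => t b with hG
  have hsumG : ∑ t ∈ F, timeKernel w (extendTimes M r t) = ∑ τ ∈ G, timeKernel w (Z τ) := by
    rw [hG, Finset.sum_image hinj]
    exact Finset.sum_congr rfl fun t ht => by rw [hZ t ht]
  -- A position is missed only if a slot of the block leaves the sample there, which excludes at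
  -- most `4 ℓ` positions per slot, or if the block meets another one, which excludes one position.
  have hbad : (Finset.univ \ G).card ≤ 16 * ℓ := by
    let Bad : M → Finset (Fin T) := fun m =>
      if π m = b then Finset.univ.filter fun τ : Fin T =>
        ¬ ((lo m : ℤ) ≤ (τ : ℕ) + (j m - j b) ∧ ((τ : ℕ) : ℤ) + (j m - j b) < T)
      else Finset.univ.filter fun τ : Fin T => ((τ : ℕ) : ℤ) - j b = (t₀ m : ℕ) - j m
    have hBad : ∀ m, (Bad m).card ≤ 4 * ℓ := by
      intro m
      simp only [Bad]
      split_ifs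
      · refine (card_filter_shift_not_mem_le _ _).trans ?_
        have := hj m; have := hj b; have := hlo m
        omega
      · refine le_trans (Finset.card_le_one.2 ?_) (by omega : 1 ≤ 4 * ℓ)
        intro τ hτ τ' hτ'
        have h1 := (Finset.mem_filter.1 hτ).2
        have h2 := (Finset.mem_filter.1 hτ').2
        exact Fin.ext (by omega)
    have hsub : Finset.univ \ G ⊆ Finset.univ.biUnion Bad := by
      intro τ hτ
      by_contra hcon
      have hgood : ∀ m, τ ∉ Bad m := fun m h =>
        hcon (Finset.mem_biUnion.2 ⟨m, Finset.mem_univ m, h⟩)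
      have hrange : ∀ m, π m = b →
          (lo m : ℤ) ≤ (τ : ℕ) + (j m - j b) ∧ ((τ : ℕ) : ℤ) + (j m - j b) < T := by
        intro m hm
        by_contra h
        refine hgood m ?_
        simp only [Bad, if_pos hm]
        exact Finset.mem_filter.2 ⟨Finset.mem_univ _, h⟩
      have hfree : ∀ m, π m ≠ b → ((τ : ℕ) : ℤ) - j b ≠ (t₀ m : ℕ) - j m := by
        intro m hm h
        refine hgood m ?_
        simp only [Bad, if_neg hm]
        exact Finset.mem_filter.2 ⟨Finset.mem_univ _, h⟩
      let t : M → Fin T := fun m =>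
        if h : π m = b then ⟨(((τ : ℕ) : ℤ) + (j m - j b)).toNat, by
          have := hrange m h; omega⟩ else t₀ m
      have ht1 : ∀ m, π m = b → ((t m : ℕ) : ℤ) = (τ : ℕ) + (j m - j b) := by
        intro m hm
        have := hrange m hm
        simp only [t, dif_pos hm]
        omega
      have ht2 : ∀ m, π m ≠ b → t m = t₀ m := fun m hm => by simp only [t, dif_neg hm]
      have hidx1 : ∀ m, π m = b → shockIndex (j m) (e m) (t m) = (((τ : ℕ) : ℤ) - j b, e b) := by
        intro m hm
        rw [shockIndex, ht1 m hm, (hshift t₀ ht₀ m hm).2]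
        congr 1
        ring
      have hne : ∀ m, π m ≠ b → (((τ : ℕ) : ℤ) - j b, e b) ≠ shockIndex (j m) (e m) (t m) := by
        intro m hm h
        have := congrArg Prod.fst h
        rw [ht2 m hm] at this
        exact hfree m hm this
      have htF : t ∈ F := by
        refine Finset.mem_filter.2 ⟨Finset.mem_univ _, ⟨?_, ?_⟩, ?_⟩
        · rw [← (hmem t₀ ht₀).1.1]
          refine collisionPattern_congr fun m m' => ?_
          rw [hrel t₀ ht₀]
          by_cases hm : π m = b
          · by_cases hm' : π m' = b
            · rw [hidx1 m hm, hidx1 m' hm', hm, hm']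
              simp
            · rw [hidx1 m hm, hm]
              exact ⟨fun h => absurd h (hne m' hm'), fun h => absurd h.symm hm'⟩
          · by_cases hm' : π m' = b
            · rw [hidx1 m' hm', hm']
              exact ⟨fun h => absurd h.symm (hne m hm), fun h => absurd h hm⟩
            · rw [ht2 m hm, ht2 m' hm', hrel t₀ ht₀]
        · intro m hm
          rw [ht2 m hm]
          exact (hmem t₀ ht₀).1.2 m hm
        · intro m
          by_cases hm : π m = b
          · have h1 := (hrange m hm).1
            rw [← ht1 m hm] at h1
            exact_mod_cast h1
          · rw [ht2 m hm]
            exact (hmem t₀ ht₀).2 m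
      refine (Finset.mem_sdiff.1 hτ).2 (Finset.mem_image.2 ⟨t, htF, Fin.ext ?_⟩)
      have := ht1 b hbπ
      omega
    calc (Finset.univ \ G).card ≤ (Finset.univ.biUnion Bad).card := Finset.card_le_card hsub
      _ ≤ ∑ m, (Bad m).card := Finset.card_biUnion_le
      _ ≤ ∑ _m : M, 4 * ℓ := Finset.sum_le_sum fun m _ => hBad m
      _ = M.card * (4 * ℓ) := by simp
      _ ≤ 4 * (4 * ℓ) := Nat.mul_le_mul_right _ hM4
      _ = 16 * ℓ := by ring
  have hsplit : ∑ τ ∈ G, timeKernel w (Z τ) =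
      ∑ τ, timeKernel w (Z τ) - ∑ τ ∈ Finset.univ \ G, timeKernel w (Z τ) := by
    rw [← Finset.sum_sdiff (Finset.subset_univ G)]
    ring
  rw [hsumG, hsplit]
  refine (norm_sub_le _ _).trans (add_le_add (norm_sum_timeKernel_shift_le hT w Bl a z₀) ?_)
  calc ‖∑ τ ∈ Finset.univ \ G, timeKernel w (Z τ)‖
      ≤ ∑ τ ∈ Finset.univ \ G, C / T :=
        (norm_sum_le _ _).trans (Finset.sum_le_sum fun τ _ => hw.norm_timeKernel_le hT _)
    _ = (Finset.univ \ G).card * (C / T) := by rw [Finset.sum_const, nsmul_eq_mul]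
    _ ≤ 16 * ℓ * (C / T) := by
        refine mul_le_mul_of_nonneg_right ?_ hC
        exact_mod_cast hbad

/-- The bound on pattern sums of the kernel that `integral_norm_sq_form_le` asks for. -/
theorem sum_norm_sq_pattern_truncKernel_le (hT : 1 ≤ T) (hk4 : k ≤ 4) {w : (Fin k → Fin T) → ℝ}
    {C : ℝ} (hC : 0 ≤ C) (hw : WeightBound w C) (M : Finset (Fin k)) (hM : k ≤ M.card + 1)
    (r : Fin k → Fin T)
    (j : M → ℤ) (e : M → Fin d) (lo : M → ℕ) {ℓ : ℕ} (hℓ : 1 ≤ ℓ) (hj : ∀ m, (j m).natAbs ≤ ℓ)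
    (hlo : ∀ m, lo m ≤ ℓ) (π : M → M) (S : Finset M) (hS : S ⊆ Finset.univ.image π)
    (hsz : ∀ b ∈ Finset.univ.image π \ S, 2 ≤ (Finset.univ.filter fun m => π m = b).card) :
    ∑ x : S → Fin T,
      ‖∑ t : M → Fin T with collisionPattern (fun m => shockIndex (j m) (e m) (t m)) = π ∧
        (fun b : S => t b) = x, truncKernel w M r lo t‖ ^ 2 ≤
      (3 * C + 512 * C ^ 2) * ℓ ^ 2 / (T : ℝ) ^ (k - M.card) := by
  classical
  have : NeZero T := ⟨by omega⟩
  have hT0 : (0 : ℝ) < T := by exact_mod_cast hT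
  have hT1 : (1 : ℝ) ≤ T := by exact_mod_cast hT
  have hℓ1 : (1 : ℝ) ≤ ℓ := by exact_mod_cast hℓ
  have hℓ2 : (1 : ℝ) ≤ (ℓ : ℝ) ^ 2 := one_le_pow₀ hℓ1
  have hMk : M.card ≤ k := by simpa using Finset.card_le_univ M
  have hv : ∀ m : M, Function.Injective (shockIndex (T := T) (j m) (e m)) := fun m =>
    shockIndex_injective _ _
  rcases (Finset.univ.image π \ S).eq_empty_or_nonempty with h0 | ⟨b, hb⟩
  · have hSeq : S = Finset.univ.image π :=
      Finset.Subset.antisymm hS (Finset.sdiff_eq_empty_iff_subset.1 h0)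
    subst hSeq
    refine (sum_norm_sq_pattern_le_of_full (fun m => shockIndex (j m) (e m)) hv π
      (truncKernel w M r lo)).trans ?_
    refine (Finset.sum_le_sum fun t _ => norm_truncKernel_sq_le w M r lo t).trans ?_
    refine (hw.sum_norm_sq_timeKernel_le hT M hM r).trans ?_
    gcongr
    nlinarith [mul_le_mul_of_nonneg_left hℓ2 hC, mul_nonneg (sq_nonneg C) (sq_nonneg (ℓ : ℝ)),
      mul_nonneg hC (sq_nonneg (ℓ : ℝ))]
  set Bl : Finset (Fin k) := (Finset.univ.filter fun m => π m = b).map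
    (Function.Embedding.subtype _) with hBl
  set cyc : ℝ := T * ((T : ℝ) ^ k)⁻¹ * ∑ s with T ∣ ∑ m ∈ Bl, (s m : ℕ), |w s| with hcyc
  have hcyc0 : 0 ≤ cyc := mul_nonneg (by positivity) (Finset.sum_nonneg fun _ _ => abs_nonneg _)
  have hBlc : Bl.card = (Finset.univ.filter fun m => π m = b).card := Finset.card_map _
  have hBl2 : 2 ≤ Bl.card := hBlc ▸ hsz b hb
  have hBlM : Bl.card ≤ M.card := by
    rw [hBlc]
    exact (Finset.card_le_univ _).trans_eq (Fintype.card_coe M)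
  set γ := cyc + 16 * ℓ * (C / T) with hγ
  have hγ0 : 0 ≤ γ := by positivity
  refine (sum_norm_sq_pattern_le_of_block (fun m => shockIndex (j m) (e m)) hv π S hS hsz hb
    (truncKernel w M r lo) hγ0 fun y => norm_sum_block_le hT hw M (hMk.trans hk4) r j e lo hℓ hj
      hlo π (Finset.mem_sdiff.1 hb).1 y).trans ?_
  rw [← hBlc, Fintype.card_fin, Fintype.card_coe, le_div_iff₀ (by positivity)]
  have hpow : (T : ℝ) ^ (M.card - Bl.card) * (T : ℝ) ^ (k - M.card) = (T : ℝ) ^ (k - Bl.card) := by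
    rw [← pow_add]; congr 1; omega
  rw [mul_right_comm, hpow]
  rcases (hBlM.trans hMk).lt_or_eq with hlt | heq
  · have h1 := hw.block Bl hBl2 hlt
    have h2 : (T : ℝ) ^ (k - Bl.card) * (1 / (T : ℝ) ^ 2) ≤ 1 := by
      rw [mul_one_div, div_le_one (by positivity)]
      exact pow_le_pow_right₀ hT1 (by omega)
    have h3 : γ ^ 2 ≤ 2 * cyc ^ 2 + 2 * (16 * ℓ * (C / T)) ^ 2 := by
      rw [hγ]; nlinarith [sq_nonneg (cyc - 16 * ℓ * (C / T))]
    calc (T : ℝ) ^ (k - Bl.card) * γ ^ 2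
        ≤ (T : ℝ) ^ (k - Bl.card) * (2 * cyc ^ 2 + 2 * (16 * ℓ * (C / T)) ^ 2) := by gcongr
      _ = 2 * ((T : ℝ) ^ (k - Bl.card) * cyc ^ 2) +
          512 * C ^ 2 * ℓ ^ 2 * ((T : ℝ) ^ (k - Bl.card) * (1 / (T : ℝ) ^ 2)) := by
          field_simp; ring
      _ ≤ 2 * C + 512 * C ^ 2 * ℓ ^ 2 * 1 := by gcongr
      _ ≤ _ := by nlinarith [mul_le_mul_of_nonneg_left hℓ2 hC, mul_nonneg hC (sq_nonneg (ℓ : ℝ))]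
  -- All slots of the form lie in one block: the total mass of the weights is enough.
  · have hcycC : cyc ≤ C := by
      have h1 : ∑ s with T ∣ ∑ m ∈ Bl, (s m : ℕ), |w s| ≤ C * (T : ℝ) ^ k / T :=
        (Finset.sum_le_sum_of_subset_of_nonneg (Finset.filter_subset _ _)
          fun _ _ _ => abs_nonneg _).trans hw.l1
      calc cyc ≤ T * ((T : ℝ) ^ k)⁻¹ * (C * (T : ℝ) ^ k / T) := by rw [hcyc]; gcongr
        _ = C := by field_simp
    have hCT : C / T ≤ C := div_le_self hC hT1
    have hγC : γ ≤ 17 * C * ℓ := by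
      have e1 : 16 * (ℓ : ℝ) * (C / T) ≤ 16 * ℓ * C := by gcongr
      have e2 : C ≤ C * ℓ := le_mul_of_one_le_right hC hℓ1
      rw [hγ]; nlinarith
    rw [heq, Nat.sub_self, pow_zero, one_mul]
    calc γ ^ 2 ≤ (17 * C * ℓ) ^ 2 := by gcongr
      _ ≤ _ := by nlinarith [mul_nonneg hC (sq_nonneg (ℓ : ℝ)), mul_nonneg (sq_nonneg C) (sq_nonneg (ℓ : ℝ))]

end KernelPattern

/-! ### Forms in lagged shocks -/

section ShockForms

variable {Ω : Type*} [MeasurableSpace Ω] {P : Measure Ω} {d : ℕ}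
  {ε : ℤ → Ω → Fin d → ℝ}

lemma IsStructuralShock.measurable_comp (hε : IsStructuralShock P ε) (t : ℤ) (a : Fin d) :
    Measurable fun ω => ε t ω a :=
  (measurable_pi_apply a).comp (hε.measurable t)

lemma IsStructuralShock.iIndepFun_comp (hε : IsStructuralShock P ε) :
    iIndepFun (fun (p : ℤ × Fin d) ω => ε p.1 ω p.2) P :=
  iIndepFun_uncurry' (X := fun t a ω => ε t ω a) (fun t a => hε.measurable_comp t a)
    hε.indep hε.indep_comp

lemma IsStructuralShock.memLp_comp (hε : IsStructuralShock P ε) (t : ℤ) (a : Fin d) :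
    MemLp (fun ω => ε t ω a) 8 P :=
  (hε.moment t).of_le (hε.measurable_comp t a).aestronglyMeasurable
    (Eventually.of_forall fun ω => norm_le_pi_norm (ε t ω) a)

lemma IsStructuralShock.memLp_pow (hε : IsStructuralShock P ε) (t : ℤ) (a : Fin d) {n : ℕ}
    (hn : n ≤ 4) : MemLp (fun ω => ε t ω a ^ n) 2 P := by
  have := hε.indep.isProbabilityMeasure
  rcases Nat.eq_zero_or_pos n with rfl | hpos
  · simpa using memLp_const (1 : ℝ)
  have h1 : MemLp (fun ω => ε t ω a) ((2 * n : ℕ) : ENNReal) P :=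
    (hε.memLp_comp t a).mono_exponent (by exact_mod_cast (by omega : 2 * n ≤ 8))
  refine memLp_two_of_lintegral_sq_ne_top
    ((hε.measurable_comp t a).pow_const n).aestronglyMeasurable ?_
  have h2 := h1.eLpNorm_lt_top
  rw [eLpNorm_lt_top_iff_lintegral_rpow_enorm_lt_top (by exact_mod_cast (by omega : 2 * n ≠ 0))
    (ENNReal.natCast_ne_top _)] at h2
  refine ne_of_lt (lt_of_eq_of_lt (lintegral_congr fun ω => ?_) h2)
  rw [enorm_pow, ← pow_mul, mul_comm n 2, ENNReal.toReal_natCast, ENNReal.rpow_natCast]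

lemma IsStructuralShock.integral_comp_eq (hε : IsStructuralShock P ε) (s t : ℤ) (a : Fin d)
    {g : ℝ → ℝ} (hg : Measurable g) : ∫ ω, g (ε s ω a) ∂P = ∫ ω, g (ε t ω a) ∂P :=
  ((hε.ident s t).comp (hg.comp (measurable_pi_apply a))).integral_eq

/-- A bound on the variances of the powers of the shocks up to the fourth, and on their means. -/
def shockMomentBound (P : Measure Ω) (ε : ℤ → Ω → Fin d → ℝ) : ℝ :=
  1 + ∑ a, ∑ n ∈ Finset.range 5, (|∫ ω, ε 0 ω a ^ n ∂P| +
    ∫ ω, (ε 0 ω a ^ n - ∫ ω', ε 0 ω' a ^ n ∂P) ^ 2 ∂P)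

lemma moment_le_shockMomentBound (a : Fin d) {n : ℕ} (hn : n ≤ 4) :
    1 + (|∫ ω, ε 0 ω a ^ n ∂P| + ∫ ω, (ε 0 ω a ^ n - ∫ ω', ε 0 ω' a ^ n ∂P) ^ 2 ∂P) ≤
      shockMomentBound P ε := by
  have hnn : ∀ (a : Fin d) (n : ℕ), 0 ≤ |∫ ω, ε 0 ω a ^ n ∂P| +
      ∫ ω, (ε 0 ω a ^ n - ∫ ω', ε 0 ω' a ^ n ∂P) ^ 2 ∂P := fun a n =>
    add_nonneg (abs_nonneg _) (integral_nonneg fun _ => sq_nonneg _)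
  refine (add_le_add_iff_left 1).2 ?_
  refine le_trans ?_ (Finset.single_le_sum (f := fun a => ∑ n ∈ Finset.range 5,
    (|∫ ω, ε 0 ω a ^ n ∂P| + ∫ ω, (ε 0 ω a ^ n - ∫ ω', ε 0 ω' a ^ n ∂P) ^ 2 ∂P))
    (fun a _ => Finset.sum_nonneg fun n _ => hnn a n) (Finset.mem_univ a))
  exact Finset.single_le_sum (f := fun n => |∫ ω, ε 0 ω a ^ n ∂P| +
    ∫ ω, (ε 0 ω a ^ n - ∫ ω', ε 0 ω' a ^ n ∂P) ^ 2 ∂P) (fun n _ => hnn a n)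
    (Finset.mem_range.2 (by omega))

lemma one_le_shockMomentBound : 1 ≤ shockMomentBound P ε :=
  le_add_of_nonneg_right (Finset.sum_nonneg fun _ _ => Finset.sum_nonneg fun _ _ =>
    add_nonneg (abs_nonneg _) (integral_nonneg fun _ => sq_nonneg _))

variable {k T : ℕ}

/-- The part of a spectrum estimator in which the slots in `M` carry the shocks with components `e`
and lags `j` at sample times from `lo` on, the times of the other slots being fixed at `r`. -/
def shockForm (ε : ℤ → Ω → Fin d → ℝ) (w : (Fin k → Fin T) → ℝ) (M : Finset (Fin k))
    (r : Fin k → Fin T) (j : M → ℤ) (e : M → Fin d) (lo : M → ℕ) (ω : Ω) : ℂ :=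
  ∑ t : M → Fin T, truncKernel w M r lo t *
    ((∏ m, ε (((t m : ℕ) : ℤ) - j m) ω (e m) : ℝ) : ℂ)

/-- The second moment of a spectrum-type form in lagged shocks is bounded up to the square of the
lag bound `ℓ`, and it gains a factor `1 / T` when the time of one slot is fixed. -/
theorem IsStructuralShock.lintegral_shockForm_sq_le (hε : IsStructuralShock P ε) (hk4 : k ≤ 4)
    (hT : 1 ≤ T) {C : ℝ} (hC : 0 ≤ C) {w : (Fin k → Fin T) → ℝ} (hw : WeightBound w C)
    (M : Finset (Fin k)) (hM : k ≤ M.card + 1) (r : Fin k → Fin T)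
    (j : M → ℤ) (e : M → Fin d) (lo : M → ℕ) {ℓ : ℕ} (hℓ : 1 ≤ ℓ) (hj : ∀ m, (j m).natAbs ≤ ℓ)
    (hlo : ∀ m, lo m ≤ ℓ) :
    ∫⁻ ω, ‖shockForm ε w M r j e lo ω‖ₑ ^ 2 ∂P ≤
      ENNReal.ofReal (formConst M.card (shockMomentBound P ε) * (3 * C + 512 * C ^ 2) * ℓ ^ 2 /
        (T : ℝ) ^ (k - M.card)) := by
  have := hε.indep.isProbabilityMeasure
  have hM4 : M.card ≤ 4 := (Finset.card_le_univ M).trans (by simpa using hk4)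
  have hcard : Fintype.card M = M.card := Fintype.card_coe M
  have hmom : ∀ (t : ℤ) (a : Fin d) (n : ℕ), ∫ ω, ε t ω a ^ n ∂P = ∫ ω, ε 0 ω a ^ n ∂P :=
    fun t a n => hε.integral_comp_eq t 0 a (measurable_id.pow_const n)
  have hvarR : ∀ (t : ℤ) (a : Fin d) (n : ℕ), n ≤ 4 →
      ∫⁻ ω, ‖ε t ω a ^ n - ∫ ω', ε 0 ω' a ^ n ∂P‖ₑ ^ 2 ∂P ≤
        ENNReal.ofReal (shockMomentBound P ε) := by
    intro t a n hn
    have hL : MemLp (fun ω => ε t ω a ^ n - ∫ ω', ε 0 ω' a ^ n ∂P) 2 P :=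
      (hε.memLp_pow t a hn).sub (memLp_const _)
    have h1 : ∫⁻ ω, ‖ε t ω a ^ n - ∫ ω', ε 0 ω' a ^ n ∂P‖ₑ ^ 2 ∂P =
        ENNReal.ofReal (∫ ω, (ε t ω a ^ n - ∫ ω', ε 0 ω' a ^ n ∂P) ^ 2 ∂P) := by
      rw [ofReal_integral_eq_lintegral_ofReal hL.integrable_sq
        (Eventually.of_forall fun _ => sq_nonneg _)]
      refine lintegral_congr fun ω => ?_
      rw [← ofReal_norm, ← ENNReal.ofReal_pow (norm_nonneg _), Real.norm_eq_abs, sq_abs]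
    rw [h1]
    refine ENNReal.ofReal_le_ofReal ?_
    rw [hε.integral_comp_eq t 0 a (g := fun x => (x ^ n - ∫ ω', ε 0 ω' a ^ n ∂P) ^ 2)
      (by fun_prop)]
    have := moment_le_shockMomentBound (P := P) (ε := ε) a hn
    linarith [abs_nonneg (∫ ω, ε 0 ω a ^ n ∂P)]
  have hT0 : (0 : ℝ) < T := by exact_mod_cast hT
  -- Four slots involve powers up to the fourth, whose variances need eighth moments.
  obtain ⟨hL, hI⟩ := integral_norm_sq_form_le (P := P) hε.iIndepFun_comp
    (fun p => hε.measurable_comp p.1 p.2) (fun m : M => shockIndex (T := T) (j m) (e m))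
    (fun m => shockIndex_injective _ _) (fun m n => ∫ ω, ε 0 ω (e m) ^ n ∂P)
    (fun m i n => hmom _ _ n) (fun m => by simpa using hε.mean 0 (e m))
    (one_le_shockMomentBound (P := P) (ε := ε))
    (fun m n hn => by
      have h1 := moment_le_shockMomentBound (P := P) (ε := ε) (e m) (hn.trans (hcard ▸ hM4))
      have h2 : 0 ≤ ∫ ω, (ε 0 ω (e m) ^ n - ∫ ω', ε 0 ω' (e m) ^ n ∂P) ^ 2 ∂P :=
        integral_nonneg fun _ => sq_nonneg _
      linarith)
    (fun m i n hn => (hε.memLp_pow _ _ (hn.trans (hcard ▸ hM4))).integrable (by norm_num))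
    (fun m i n hn => hvarR _ _ n (hn.trans (hcard ▸ hM4)))
    (truncKernel w M r lo)
    (by positivity : 0 ≤ (3 * C + 512 * C ^ 2) * ℓ ^ 2 / (T : ℝ) ^ (k - M.card))
    (fun π S hS hsz => sum_norm_sq_pattern_truncKernel_le hT hk4 hC hw M hM r j e lo hℓ hj hlo π S
      hS hsz)
  replace hL : MemLp (shockForm ε w M r j e lo) 2 P := hL
  have h1 : ∫⁻ ω, ‖shockForm ε w M r j e lo ω‖ₑ ^ 2 ∂P =
      ENNReal.ofReal (∫ ω, ‖shockForm ε w M r j e lo ω‖ ^ 2 ∂P) := by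
    rw [ofReal_integral_eq_lintegral_ofReal (hL.integrable_norm_pow (by norm_num))
      (Eventually.of_forall fun _ => sq_nonneg _)]
    refine lintegral_congr fun ω => ?_
    rw [← ofReal_norm, ← ENNReal.ofReal_pow (norm_nonneg _)]
  rw [h1]
  refine ENNReal.ofReal_le_ofReal (hI.trans (le_of_eq ?_))
  rw [hcard]
  ring

lemma IsStructuralShock.measurable_shockForm (hε : IsStructuralShock P ε)
    (w : (Fin k → Fin T) → ℝ) (M : Finset (Fin k))
    (r : Fin k → Fin T) (j : M → ℤ) (e : M → Fin d) (lo : M → ℕ) :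
    Measurable (shockForm ε w M r j e lo) := by
  refine Finset.measurable_fun_sum _ fun t _ => Measurable.const_mul ?_ _
  exact Complex.measurable_ofReal.comp
    (Finset.measurable_fun_prod _ fun m _ => hε.measurable_comp _ _)

end ShockForms

/-! ### Lattice sums and the periodized weight -/

section LatticeSums

lemma tsum_pi_prod_le {κ α : Type*} [Fintype κ] (f : κ → α → ENNReal) :
    ∑' x : κ → α, ∏ m, f m (x m) ≤ ∏ m, ∑' a, f m a := by
  classical
  rw [ENNReal.tsum_eq_iSup_sum]
  refine iSup_le fun s => ?_
  calc ∑ x ∈ s, ∏ m, f m (x m)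
      ≤ ∑ x ∈ Fintype.piFinset fun m => s.image fun x => x m, ∏ m, f m (x m) := by
        refine Finset.sum_le_sum_of_subset fun x hx => ?_
        rw [Fintype.mem_piFinset]
        exact fun m => Finset.mem_image_of_mem (fun x : κ → α => x m) hx
    _ = ∏ m, ∑ a ∈ s.image fun x => x m, f m a := (Finset.prod_univ_sum _ _).symm
    _ ≤ _ := Finset.prod_le_prod' fun m _ => ENNReal.sum_le_tsum _

/-- Comparison of a lattice sum of an integrable power decay with its integral. -/
lemma exists_tsum_one_add_abs_rpow_le {p : ℝ} (hp : 1 < p) :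
    ∃ C : ℝ, 0 < C ∧ ∀ x a : ℝ, 0 < a →
      ∑' n : ℤ, ENNReal.ofReal ((1 + |x + n * a|) ^ (-p)) ≤ ENNReal.ofReal (C * (1 + 1 / a)) := by
  set I : ENNReal := ∫⁻ y : ℝ, ENNReal.ofReal ((1 + ‖y‖) ^ (-p)) with hI
  have hIfin : I < ⊤ := finite_integral_one_add_norm (by simpa using hp)
  refine ⟨2 ^ p * (I.toReal + 1), by positivity, fun x a ha => ?_⟩
  set b := min a 1 with hb
  have hb0 : 0 < b := lt_min ha one_pos
  have hb1 : b ≤ 1 := min_le_right _ _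
  -- Disjoint cells of length at most one, on which the decay is constant up to the factor `2 ^ p`.
  let cell : ℤ → Set ℝ := fun n => Set.Ico (x + n * a) (x + n * a + b)
  have hterm : ∀ n : ℤ, ENNReal.ofReal ((1 + |x + n * a|) ^ (-p)) ≤
      ENNReal.ofReal (2 ^ p / b) * ∫⁻ y in cell n, ENNReal.ofReal ((1 + ‖y‖) ^ (-p)) := by
    intro n
    have h1 : ∀ y ∈ cell n, ENNReal.ofReal (2 ^ (-p) * (1 + |x + n * a|) ^ (-p)) ≤
        ENNReal.ofReal ((1 + ‖y‖) ^ (-p)) := by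
      intro y hy
      refine ENNReal.ofReal_le_ofReal ?_
      rw [← Real.mul_rpow (by norm_num) (by positivity)]
      refine Real.rpow_le_rpow_of_nonpos (by positivity) ?_ (by linarith)
      have h2 : |y - (x + n * a)| ≤ 1 := by
        rw [abs_le]; constructor <;> linarith [hy.1, hy.2]
      have h3 : ‖y‖ ≤ |x + n * a| + |y - (x + n * a)| := by
        rw [Real.norm_eq_abs]
        calc |y| = |(x + n * a) + (y - (x + n * a))| := by ring_nf
          _ ≤ _ := abs_add_le _ _
      linarith [abs_nonneg (x + n * a)]
    have h4 : ENNReal.ofReal (2 ^ (-p) * (1 + |x + n * a|) ^ (-p)) * ENNReal.ofReal b ≤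
        ∫⁻ y in cell n, ENNReal.ofReal ((1 + ‖y‖) ^ (-p)) := by
      have : volume (cell n) = ENNReal.ofReal b := by
        simp only [cell, Real.volume_Ico]; congr 1; ring
      rw [← this, ← setLIntegral_const]
      exact setLIntegral_mono' measurableSet_Ico h1
    calc ENNReal.ofReal ((1 + |x + n * a|) ^ (-p))
        = ENNReal.ofReal (2 ^ p / b) *
          (ENNReal.ofReal (2 ^ (-p) * (1 + |x + n * a|) ^ (-p)) * ENNReal.ofReal b) := by
          rw [← ENNReal.ofReal_mul (by positivity), ← ENNReal.ofReal_mul (by positivity)]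
          congr 1
          rw [Real.rpow_neg (by norm_num : (0 : ℝ) ≤ 2)]
          field_simp
      _ ≤ _ := by gcongr
  have hdisj : Pairwise (Function.onFun Disjoint cell) := by
    intro n n' hnn
    have key : ∀ n n' : ℤ, n < n' → Disjoint (cell n) (cell n') := by
      intro n n' h
      rw [Set.disjoint_left]
      intro y hy hy'
      have h1 : (n : ℝ) + 1 ≤ n' := by exact_mod_cast h
      have h2 := hy.2
      have h3 := hy'.1
      have h4 : b ≤ a := min_le_left _ _
      nlinarith
    rcases lt_or_gt_of_ne hnn with h | h
    · exact key n n' h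
    · exact (key n' n h).symm
  calc ∑' n : ℤ, ENNReal.ofReal ((1 + |x + n * a|) ^ (-p))
      ≤ ∑' n : ℤ, ENNReal.ofReal (2 ^ p / b) *
          ∫⁻ y in cell n, ENNReal.ofReal ((1 + ‖y‖) ^ (-p)) := ENNReal.tsum_le_tsum hterm
    _ = ENNReal.ofReal (2 ^ p / b) *
          ∫⁻ y in ⋃ n, cell n, ENNReal.ofReal ((1 + ‖y‖) ^ (-p)) := by
        rw [ENNReal.tsum_mul_left, lintegral_iUnion (fun n => measurableSet_Ico) hdisj]
    _ ≤ ENNReal.ofReal (2 ^ p / b) * I := by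
        gcongr
        exact setLIntegral_le_lintegral _ _
    _ = ENNReal.ofReal (2 ^ p / b * I.toReal) := by
        rw [ENNReal.ofReal_mul (by positivity), ENNReal.ofReal_toReal hIfin.ne]
    _ ≤ _ := by
        refine ENNReal.ofReal_le_ofReal ?_
        have h1 : 1 / b ≤ 1 + 1 / a := by
          rcases min_choice a 1 with h | h
          · rw [hb, h]; linarith
          · rw [hb, h]
            have : 0 < 1 / a := by positivity
            linarith
        have h2 : 0 ≤ I.toReal := ENNReal.toReal_nonneg
        calc 2 ^ p / b * I.toReal = 2 ^ p * I.toReal * (1 / b) := by ring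
          _ ≤ 2 ^ p * (I.toReal + 1) * (1 + 1 / a) := by gcongr; linarith

/-- The periodization `∑_j (1 + |x + 2πj| / h)^{-p}` of a power decay at scale `h`. -/
def decaySum (p h x : ℝ) : ENNReal :=
  ∑' j : ℤ, ENNReal.ofReal ((1 + |x + 2 * Real.pi * j| / h) ^ (-p))

/-- A bounded periodization, and the bound `O(T h)` for its sum over the Fourier frequencies. -/
lemma exists_decaySum_le {p : ℝ} (hp : 1 < p) : ∃ C : ℝ, 0 < C ∧
    (∀ h x : ℝ, 0 < h → decaySum p h x ≤ ENNReal.ofReal (C * (1 + h))) ∧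
    ∀ (h x : ℝ) (T : ℕ), 0 < h → 1 ≤ T →
      ∑ s : Fin T, decaySum p h (x - fourierFreq s) ≤ ENNReal.ofReal (C * (1 + T * h)) := by
  obtain ⟨C, hC, hsum⟩ := exists_tsum_one_add_abs_rpow_le hp
  have hpi : 1 ≤ 2 * Real.pi := by linarith [Real.pi_gt_three]
  have hpi0 := Real.pi_pos
  refine ⟨C, hC, fun h x hh => ?_, fun h x T hh hT => ?_⟩
  · have h1 := hsum (x / h) (2 * Real.pi / h) (by positivity)
    refine le_trans (le_of_eq ?_) (h1.trans (ENNReal.ofReal_le_ofReal ?_))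
    · unfold decaySum
      refine tsum_congr fun j => ?_
      congr 3
      rw [← abs_of_pos hh, ← abs_div, abs_of_pos hh]
      congr 1
      ring
    · rw [one_div_div]
      gcongr
      exact div_le_self hh.le hpi
  · have hT0 : (0 : ℝ) < T := by exact_mod_cast hT
    have h1 := hsum (x / h) (2 * Real.pi / (T * h)) (by positivity)
    have h2 : ∑ s : Fin T, decaySum p h (x - fourierFreq s) =
        ∑' q : Fin T × ℤ, ENNReal.ofReal
          ((1 + |x / h + ((q.2 * T - (q.1 : ℕ) : ℤ) : ℝ) * (2 * Real.pi / (T * h))|) ^ (-p)) := by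
      rw [ENNReal.tsum_prod', tsum_fintype]
      refine Finset.sum_congr rfl fun s _ => ?_
      unfold decaySum
      refine tsum_congr fun j => ?_
      congr 3
      rw [← abs_of_pos hh, ← abs_div, abs_of_pos hh]
      congr 1
      unfold fourierFreq
      push_cast
      field_simp
      ring
    -- The Fourier frequencies and their shifts by multiples of `2π` are together the lattice of
    -- mesh `2π / T`, each point being taken once.
    have hinj : Function.Injective fun q : Fin T × ℤ => q.2 * T - ((q.1 : ℕ) : ℤ) := by
      rintro ⟨s, j⟩ ⟨s', j'⟩ hq
      simp only at hq
      have h3 : (T : ℤ) ∣ ((s : ℕ) : ℤ) - (s' : ℕ) := ⟨j - j', by linear_combination -hq⟩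
      have hlt : |((s : ℕ) : ℤ) - (s' : ℕ)| < T := by
        have := s.2; have := s'.2
        rw [abs_lt]; constructor <;> omega
      have h4 := Int.eq_zero_of_abs_lt_dvd h3 hlt
      have hs : s = s' := Fin.ext (by omega)
      subst hs
      have h5 : (j - j') * (T : ℤ) = 0 := by linear_combination hq
      have h6 : j - j' = 0 := by
        rcases mul_eq_zero.1 h5 with h | h
        · exact h
        · omega
      rw [Prod.mk.injEq]
      exact ⟨rfl, by omega⟩
    rw [h2]
    refine (ENNReal.tsum_comp_le_tsum_of_injective hinj (fun n : ℤ => ENNReal.ofReal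
      ((1 + |x / h + (n : ℝ) * (2 * Real.pi / (T * h))|) ^ (-p)))).trans (h1.trans
        (ENNReal.ofReal_le_ofReal ?_))
    rw [one_div_div]
    gcongr
    exact div_le_self (by positivity) hpi

end LatticeSums

section PeriodizedWeight

variable {k : ℕ}

/-- The periodized weight is dominated by a product of one-dimensional periodizations over any
`k - 1` of the coordinates, because the summation index is determined by these coordinates. The
scale `h'` of the bound may differ from the bandwidth `h`, which serves away from the origin, where
the weight is bounded at scale one with a small factor `D`. -/
lemma enorm_periodizedWeight_le (hk : 2 ≤ k) (W : (Fin k → ℝ) → ℝ) {h h' D η : ℝ} (hh : 0 < h)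
    (hh' : 0 < h') (hD : 0 ≤ D) (hη : 0 < η) (a : Fin k → ℝ)
    (hW : ∀ j : Fin k → ℤ, ∑ m, (a m + 2 * Real.pi * (j m : ℝ)) = 0 →
      |W fun m => (a m + 2 * Real.pi * (j m : ℝ)) / h| ≤
        D * (1 + ‖fun m => a m + 2 * Real.pi * (j m : ℝ)‖ / h') ^ (-(((k : ℝ) - 1) + η)))
    (m₀ : Fin k) :
    ‖periodizedWeight W h a‖ₑ ≤ ENNReal.ofReal ((h ^ (k - 1))⁻¹ * D) *
      ∏ m : {m // m ≠ m₀}, decaySum (1 + η / (k - 1)) h' (a m) := by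
  have hk1 : (0 : ℝ) < (k : ℝ) - 1 := by
    have : (2 : ℝ) ≤ k := by exact_mod_cast hk
    linarith
  set p := 1 + η / ((k : ℝ) - 1) with hp
  have hp0 : 0 < p := by positivity
  have hkp : ((k : ℝ) - 1) * p = ((k : ℝ) - 1) + η := by rw [hp]; field_simp
  have hcard : Fintype.card {m // m ≠ m₀} = k - 1 := by
    rw [Fintype.card_subtype_compl, Fintype.card_fin, Fintype.card_subtype_eq]
  let g : Fin k → ℤ → ENNReal := fun m j =>
    ENNReal.ofReal ((1 + |a m + 2 * Real.pi * j| / h') ^ (-p))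
  have hterm : ∀ j : {j : Fin k → ℤ // ∑ m, (a m + 2 * Real.pi * (j m : ℝ)) = 0},
      ‖W fun m => (a m + 2 * Real.pi * (j.1 m : ℝ)) / h‖ₑ ≤
        ENNReal.ofReal D * ∏ m : {m // m ≠ m₀}, g m (j.1 m) := by
    intro j
    set N := ‖fun m => a m + 2 * Real.pi * (j.1 m : ℝ)‖ with hN
    have h1 : (1 + N / h') ^ (-(((k : ℝ) - 1) + η)) =
        ∏ _m : {m // m ≠ m₀}, (1 + N / h') ^ (-p) := by
      rw [Finset.prod_const, Finset.card_univ, hcard, ← Real.rpow_natCast,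
        ← Real.rpow_mul (by positivity), Nat.cast_sub (by omega), ← hkp]
      congr 1
      push_cast
      ring
    have h2 : ∏ _m : {m // m ≠ m₀}, (1 + N / h') ^ (-p) ≤ ∏ m : {m // m ≠ m₀},
        (1 + |a m + 2 * Real.pi * (j.1 m : ℝ)| / h') ^ (-p) := by
      refine Finset.prod_le_prod (fun _ _ => by positivity) fun m _ => ?_
      refine Real.rpow_le_rpow_of_nonpos (by positivity) ?_ (by linarith)
      have := norm_le_pi_norm (fun m => a m + 2 * Real.pi * (j.1 m : ℝ)) m
      rw [Real.norm_eq_abs] at this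
      gcongr
    rw [← ofReal_norm, Real.norm_eq_abs]
    calc ENNReal.ofReal |W fun m => (a m + 2 * Real.pi * (j.1 m : ℝ)) / h|
        ≤ ENNReal.ofReal (D * ∏ m : {m // m ≠ m₀},
            (1 + |a m + 2 * Real.pi * (j.1 m : ℝ)| / h') ^ (-p)) := by
          refine ENNReal.ofReal_le_ofReal ((hW j.1 j.2).trans ?_)
          rw [← hN, h1]
          gcongr
      _ = _ := by
          rw [ENNReal.ofReal_mul hD, ENNReal.ofReal_prod_of_nonneg fun _ _ => by positivity]
  have hinj : Function.Injective
      fun (j : {j : Fin k → ℤ // ∑ m, (a m + 2 * Real.pi * (j m : ℝ)) = 0})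
        (m : {m // m ≠ m₀}) => j.1 m := by
    intro j j' hjj
    have hoff : ∀ m, m ≠ m₀ → j.1 m = j'.1 m := fun m hm => congrFun hjj ⟨m, hm⟩
    have h3 : ∑ m, ((a m + 2 * Real.pi * (j.1 m : ℝ)) - (a m + 2 * Real.pi * (j'.1 m : ℝ))) = 0 := by
      rw [Finset.sum_sub_distrib, j.2, j'.2, sub_zero]
    rw [Finset.sum_eq_single m₀ (fun m _ hm => by rw [hoff m hm, sub_self]) (by simp)] at h3
    have h4 : (j.1 m₀ : ℝ) = j'.1 m₀ := by
      have : 2 * Real.pi * ((j.1 m₀ : ℝ) - j'.1 m₀) = 0 := by linear_combination h3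
      rcases mul_eq_zero.1 this with h | h
      · exact absurd h (by positivity)
      · linarith
    refine Subtype.ext (funext fun m => ?_)
    by_cases hm : m = m₀
    · rw [hm]; exact_mod_cast h4
    · exact hoff m hm
  unfold periodizedWeight
  rw [enorm_mul, ENNReal.ofReal_mul (by positivity), mul_assoc]
  refine mul_le_mul' (le_of_eq ?_) ?_
  · rw [← ofReal_norm, Real.norm_eq_abs, abs_of_pos (by positivity)]
  calc ‖∑' j : {j : Fin k → ℤ // ∑ m, (a m + 2 * Real.pi * (j m : ℝ)) = 0},
        W fun m => (a m + 2 * Real.pi * (j.1 m : ℝ)) / h‖ₑ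
      ≤ ∑' j : {j : Fin k → ℤ // ∑ m, (a m + 2 * Real.pi * (j m : ℝ)) = 0},
          ‖W fun m => (a m + 2 * Real.pi * (j.1 m : ℝ)) / h‖ₑ := enorm_tsum_le_tsum_enorm
    _ ≤ ∑' j : {j : Fin k → ℤ // ∑ m, (a m + 2 * Real.pi * (j m : ℝ)) = 0},
          ENNReal.ofReal D * ∏ m : {m // m ≠ m₀}, g m (j.1 m) := ENNReal.tsum_le_tsum hterm
    _ = ENNReal.ofReal D * ∑' j : {j : Fin k → ℤ // ∑ m, (a m + 2 * Real.pi * (j m : ℝ)) = 0},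
          ∏ m : {m // m ≠ m₀}, g m (j.1 m) := ENNReal.tsum_mul_left
    _ ≤ ENNReal.ofReal D * ∑' x : {m // m ≠ m₀} → ℤ, ∏ m : {m // m ≠ m₀}, g m (x m) := by
        gcongr
        exact ENNReal.tsum_comp_le_tsum_of_injective hinj
          fun x : {m // m ≠ m₀} → ℤ => ∏ m : {m // m ≠ m₀}, g m (x m)
    _ ≤ _ := by
        gcongr
        exact tsum_pi_prod_le fun (m : {m // m ≠ m₀}) => g m

/-- The periodized weight vanishes at tuples of Fourier frequencies whose total is not `0`. -/
lemma dvd_of_periodizedWeight_ne_zero {T : ℕ} (hT : 1 ≤ T) (W : (Fin k → ℝ) → ℝ) (h : ℝ)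
    {lam : Fin k → ℝ} (hlam : SumZeroMod Finset.univ lam) (s : Fin k → Fin T)
    (hs : periodizedWeight W h (fun m => lam m - fourierFreq (s m)) ≠ 0) :
    T ∣ ∑ m, (s m : ℕ) := by
  have hT0 : (T : ℝ) ≠ 0 := by exact_mod_cast (by omega : T ≠ 0)
  by_contra hdvd
  apply hs
  have : IsEmpty {j : Fin k → ℤ //
      ∑ m, (lam m - fourierFreq (s m) + 2 * Real.pi * (j m : ℝ)) = 0} := by
    refine ⟨fun j => hdvd ?_⟩
    obtain ⟨n, hn⟩ := hlam
    have h1 := j.2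
    rw [Finset.sum_add_distrib, Finset.sum_sub_distrib, hn] at h1
    unfold fourierFreq at h1
    rw [← Finset.sum_div, ← Finset.mul_sum, ← Finset.mul_sum] at h1
    have h2 : 2 * Real.pi * (∑ m, ((s m : ℕ) : ℝ)) = 2 * Real.pi * (T * (n + ∑ m, (j.1 m : ℝ))) := by
      field_simp at h1
      linear_combination -h1
    have h3 := mul_left_cancel₀ (by positivity) h2
    have h4 : ((∑ m, (s m : ℕ) : ℕ) : ℤ) = T * (n + ∑ m, j.1 m) := by
      have : ((∑ m, (s m : ℕ) : ℕ) : ℝ) = ((T * (n + ∑ m, j.1 m) : ℤ) : ℝ) := by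
        push_cast; exact h3
      exact_mod_cast this
    exact_mod_cast Dvd.intro _ h4.symm
  rw [periodizedWeight, tsum_empty, mul_zero]

end PeriodizedWeight

/-! ### Weights dominated by a product kernel -/

section WeightBounds

lemma exists_pos_forall_le {u : ℕ → ℝ} (hpos : ∀ T, 1 ≤ T → 0 < u T) (hu : Tendsto u atTop atTop) :
    ∃ c, 0 < c ∧ ∀ T, 1 ≤ T → c ≤ u T := by
  obtain ⟨N, hN⟩ := eventually_atTop.1 (hu.eventually_ge_atTop 1)
  obtain ⟨T₀, hT₀, hmin⟩ := Finset.exists_min_image (Finset.Icc 1 (N + 1)) u ⟨1, by simp⟩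
  have hT₀1 : 1 ≤ T₀ := (Finset.mem_Icc.1 hT₀).1
  refine ⟨min 1 (u T₀), lt_min one_pos (hpos T₀ hT₀1), fun T hT => ?_⟩
  by_cases h : T ≤ N + 1
  · exact (min_le_right _ _).trans (hmin T (Finset.mem_Icc.2 ⟨hT, h⟩))
  · exact (min_le_left _ _).trans (hN T (by omega))

/-- Uniform consequences of the bandwidth conditions `H → 0` and `T H^{k-1} → ∞`. -/
lemma exists_bandwidth_bounds {k : ℕ} (hk : 3 ≤ k) {H : ℕ → ℝ} (hHpos : ∀ T, 1 ≤ T → 0 < H T)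
    (hH : Tendsto H atTop (𝓝 0))
    (hTH : Tendsto (fun T : ℕ => (T : ℝ) * H T ^ (k - 1)) atTop atTop) :
    ∃ Hm c : ℝ, 0 < Hm ∧ 0 < c ∧ ∀ T, 1 ≤ T → H T ≤ Hm ∧ c ≤ T * H T ^ (k - 1) ∧
      c ≤ T * H T ^ 2 ∧ c ≤ T * H T := by
  obtain ⟨b, hb⟩ := hH.bddAbove_range
  have hbH : ∀ T, H T ≤ b := fun T => hb ⟨T, rfl⟩
  obtain ⟨c, hc, hcT⟩ := exists_pos_forall_le (u := fun T : ℕ => (T : ℝ) * H T ^ (k - 1))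
    (fun T hT => mul_pos (by exact_mod_cast hT) (pow_pos (hHpos T hT) _)) hTH
  set Hm := max b 1 with hHm
  have hHm1 : 1 ≤ Hm := le_max_right _ _
  have hle : ∀ T, H T ≤ Hm := fun T => (hbH T).trans (le_max_left _ _)
  have hkey : ∀ T, 1 ≤ T → ∀ i, i ≤ k - 1 → c / Hm ^ (k - 1) ≤ T * H T ^ i := by
    intro T hT i hi
    have hp := hHpos T hT
    rw [div_le_iff₀ (by positivity)]
    calc c ≤ T * H T ^ (k - 1) := hcT T hT
      _ = T * H T ^ i * H T ^ (k - 1 - i) := by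
          rw [mul_assoc, ← pow_add]; congr 2; omega
      _ ≤ T * H T ^ i * Hm ^ (k - 1 - i) := by gcongr; exact hle T
      _ ≤ T * H T ^ i * Hm ^ (k - 1) := by
          refine mul_le_mul_of_nonneg_left (pow_le_pow_right₀ hHm1 (Nat.sub_le _ _)) (by positivity)
  refine ⟨Hm, c / Hm ^ (k - 1), by linarith, by positivity, fun T hT => ⟨hle T, ?_, ?_, ?_⟩⟩
  · exact hkey T hT (k - 1) le_rfl
  · exact hkey T hT 2 (by omega)
  · simpa using hkey T hT 1 (by omega)

variable {k T : ℕ}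

/-- An entry of a frequency tuple is determined by the others on a set with total `0` modulo `T`.
-/
lemma eq_of_dvd_sum_sub {s s' : Fin k → Fin T} {X : Finset (Fin k)} {m₀ : Fin k} (hm₀ : m₀ ∈ X)
    (hs : T ∣ ∑ m ∈ X, (s m : ℕ)) (hs' : T ∣ ∑ m ∈ X, (s' m : ℕ))
    (h : ∀ m ∈ X, m ≠ m₀ → s m = s' m) : s m₀ = s' m₀ := by
  have d1 : (T : ℤ) ∣ ∑ m ∈ X, ((s m : ℕ) : ℤ) := by exact_mod_cast hs
  have d2 : (T : ℤ) ∣ ∑ m ∈ X, ((s' m : ℕ) : ℤ) := by exact_mod_cast hs'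
  have d3 := dvd_sub d1 d2
  rw [← Finset.sum_sub_distrib, Finset.sum_eq_single_of_mem m₀ hm₀ (fun m hm hne => by
    rw [h m hm hne, sub_self])] at d3
  have hlt : |((s m₀ : ℕ) : ℤ) - (s' m₀ : ℕ)| < T := by
    have := (s m₀).2; have := (s' m₀).2
    rw [abs_lt]; constructor <;> omega
  have := Int.eq_zero_of_abs_lt_dvd d3 hlt
  exact Fin.ext (by omega)

/-- Mass of weights dominated by a product over `k - 1` coordinates; the remaining coordinate is
determined by the others. -/
lemma sum_abs_le_of_dominated {w : (Fin k → Fin T) → ℝ}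
    (hsupp : ∀ s, w s ≠ 0 → T ∣ ∑ m, (s m : ℕ)) {D : ℝ} (hD : 0 ≤ D) (f : Fin k → Fin T → ℝ)
    (hf : ∀ m t, 0 ≤ f m t) (m₀ : Fin k)
    (hdom : ∀ s, |w s| ≤ D * ∏ m : {m // m ≠ m₀}, f m (s m)) (I : Fin k → Finset (Fin T)) :
    ∑ s with ∀ m, m ≠ m₀ → s m ∈ I m, |w s| ≤
      D * ∏ m : {m // m ≠ m₀}, ∑ t ∈ I m, f m t := by
  classical
  set A : Finset (Fin k → Fin T) := Finset.univ.filter fun s =>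
    (∀ m, m ≠ m₀ → s m ∈ I m) ∧ w s ≠ 0 with hA
  have h1 : ∑ s with ∀ m, m ≠ m₀ → s m ∈ I m, |w s| = ∑ s ∈ A, |w s| := by
    rw [hA, ← Finset.filter_filter]
    refine (Finset.sum_filter_of_ne fun s _ hs => ?_).symm
    exact fun h => hs (by rw [h, abs_zero])
  rw [h1, Finset.prod_univ_sum, Finset.mul_sum]
  let ρ : (Fin k → Fin T) → {m // m ≠ m₀} → Fin T := fun s m => s m
  have hinj : Set.InjOn ρ A := by
    intro s hs s' hs' h
    have hoff : ∀ m, m ≠ m₀ → s m = s' m := fun m hm => congrFun h ⟨m, hm⟩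
    funext m
    by_cases hm : m = m₀
    · rw [hm]
      exact eq_of_dvd_sum_sub (Finset.mem_univ m₀) (hsupp s (Finset.mem_filter.1 hs).2.2)
        (hsupp s' (Finset.mem_filter.1 hs').2.2) fun m _ hm => hoff m hm
    · exact hoff m hm
  calc ∑ s ∈ A, |w s| ≤ ∑ s ∈ A, D * ∏ m : {m // m ≠ m₀}, f m (ρ s m) :=
        Finset.sum_le_sum fun s _ => hdom s
    _ = ∑ x ∈ A.image ρ, D * ∏ m : {m // m ≠ m₀}, f m (x m) :=
        (Finset.sum_image hinj (f := fun x => D * ∏ m : {m // m ≠ m₀}, f m (x m))).symm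
    _ ≤ _ := by
        refine Finset.sum_le_sum_of_subset_of_nonneg ?_ fun x _ _ =>
          mul_nonneg hD (Finset.prod_nonneg fun m _ => hf m _)
        intro x hx
        obtain ⟨s, hs, rfl⟩ := Finset.mem_image.1 hx
        rw [Fintype.mem_piFinset]
        exact fun m => (Finset.mem_filter.1 hs).2.1 m m.2

/-- For `k = 4` a submanifold of codimension two has at most `T ^ 2` points: one entry in `B` and
one in its complement determine the others. -/
lemma card_filter_two_blocks_le (hk : k = 4) (B : Finset (Fin k)) (hB : B.card = 2) :
    (Finset.univ.filter fun s : Fin k → Fin T =>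
      T ∣ ∑ m ∈ B, (s m : ℕ) ∧ T ∣ ∑ m, (s m : ℕ)).card ≤ T ^ 2 := by
  classical
  have hBc : Bᶜ.card = 2 := by rw [Finset.card_compl, Fintype.card_fin, hB]; omega
  obtain ⟨b, b₁, hbb, rfl⟩ := Finset.card_eq_two.1 hB
  obtain ⟨c, c₁, hcc, hc⟩ := Finset.card_eq_two.1 hBc
  have hcard : Fintype.card (Fin T × Fin T) = T ^ 2 := by simp [sq]
  rw [← hcard, ← Finset.card_univ]
  refine Finset.card_le_card_of_injOn (fun s => (s b, s c)) (fun _ _ => Finset.mem_coe.2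
    (Finset.mem_univ _)) ?_
  intro s hs s' hs' h
  obtain ⟨h1, h2⟩ := (Finset.mem_filter.1 hs).2
  obtain ⟨h1', h2'⟩ := (Finset.mem_filter.1 hs').2
  obtain ⟨hb, hc'⟩ := Prod.mk.inj h
  have hcompl : ∀ s : Fin k → Fin T, T ∣ ∑ m ∈ ({b, b₁} : Finset (Fin k)), (s m : ℕ) →
      T ∣ ∑ m, (s m : ℕ) → T ∣ ∑ m ∈ ({c, c₁} : Finset (Fin k)), (s m : ℕ) := by
    intro s h1 h2
    rw [← Finset.sum_add_sum_compl ({b, b₁} : Finset (Fin k)), hc] at h2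
    exact (Nat.dvd_add_right h1).1 h2
  have e1 : s b₁ = s' b₁ := by
    refine eq_of_dvd_sum_sub (by simp : b₁ ∈ ({b, b₁} : Finset (Fin k))) h1 h1' ?_
    intro m hm hne
    rcases Finset.mem_insert.1 hm with rfl | hm
    · exact hb
    · exact absurd (Finset.mem_singleton.1 hm) hne
  have e2 : s c₁ = s' c₁ := by
    refine eq_of_dvd_sum_sub (by simp : c₁ ∈ ({c, c₁} : Finset (Fin k))) (hcompl s h1 h2)
      (hcompl s' h1' h2') ?_
    intro m hm hne
    rcases Finset.mem_insert.1 hm with rfl | hm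
    · exact hc'
    · exact absurd (Finset.mem_singleton.1 hm) hne
  funext m
  by_cases hm : m ∈ ({b, b₁} : Finset (Fin k))
  · rcases Finset.mem_insert.1 hm with rfl | hm
    · exact hb
    · rw [Finset.mem_singleton.1 hm]; exact e1
  · have : m ∈ ({c, c₁} : Finset (Fin k)) := hc ▸ Finset.mem_compl.2 hm
    rcases Finset.mem_insert.1 this with rfl | hm
    · exact hc'
    · rw [Finset.mem_singleton.1 hm]; exact e2

/-- Weights with the size and decay of a kernel of bandwidth `h` satisfy `WeightBound`, provided
that they are bounded on the submanifolds of codimension two. The submanifolds of codimension one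
carry little mass because `T h²` is bounded below. -/
lemma weightBound_of_dominated (hk : k = 3 ∨ k = 4) (hT : 1 ≤ T) {w : (Fin k → Fin T) → ℝ}
    (hsupp : ∀ s, w s ≠ 0 → T ∣ ∑ m, (s m : ℕ)) {A C₁ C₂ C₄ c h : ℝ} (hh : 0 < h) (hA : 0 ≤ A)
    (hC₁ : 0 ≤ C₁) (hC₂ : 0 ≤ C₂) (hc : 0 < c) (hch : c ≤ T * h ^ (k - 1))
    (hch2 : c ≤ T * h ^ 2) (f : Fin k → Fin T → ℝ)
    (hf : ∀ m t, 0 ≤ f m t) (hfC : ∀ m t, f m t ≤ C₁) (hfs : ∀ m, ∑ t, f m t ≤ C₂ * (T * h))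
    (hdom : ∀ m₀ s, |w s| ≤ (h ^ (k - 1))⁻¹ * A * ∏ m : {m : Fin k // m ≠ m₀}, f m (s m))
    (hsub : ∀ B : Finset (Fin k), 2 ≤ B.card → B.card + 2 ≤ k → ∀ s, T ∣ ∑ m ∈ B, (s m : ℕ) →
      |w s| ≤ C₄) :
    WeightBound w (A * C₂ ^ (k - 1) + A * C₁ ^ (k - 1) * (A * C₂ ^ (k - 1)) / c +
      (A * C₁ * C₂ ^ (k - 2)) ^ 2 / c + C₄ ^ 2) := by
  classical
  have hk3 : 3 ≤ k := by omega
  have hT0 : (0 : ℝ) < T := by exact_mod_cast hT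
  have hcard : ∀ m₀ : Fin k, Fintype.card {m // m ≠ m₀} = k - 1 := fun m₀ => by
    rw [Fintype.card_subtype_compl, Fintype.card_fin, Fintype.card_subtype_eq]
  have hD : 0 ≤ (h ^ (k - 1))⁻¹ * A := by positivity
  let m₀ : Fin k := ⟨0, by omega⟩
  have hl1 : ∑ s, |w s| ≤ A * C₂ ^ (k - 1) * (T : ℝ) ^ (k - 1) := by
    have h1 := sum_abs_le_of_dominated hsupp hD f hf m₀ (hdom m₀) fun _ => Finset.univ
    simp only [Finset.mem_univ, implies_true, Finset.filter_true] at h1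
    calc ∑ s, |w s| ≤ _ := h1
      _ ≤ (h ^ (k - 1))⁻¹ * A * ∏ _m : {m // m ≠ m₀}, (C₂ * (T * h)) := by
          refine mul_le_mul_of_nonneg_left ?_ hD
          exact Finset.prod_le_prod (fun m _ => Finset.sum_nonneg fun t _ => hf m t)
            fun m _ => hfs m
      _ = _ := by
          rw [Finset.prod_const, Finset.card_univ, hcard, mul_pow, mul_pow]
          field_simp
  have hsup : ∀ s, |w s| ≤ (h ^ (k - 1))⁻¹ * A * C₁ ^ (k - 1) := by
    intro s
    refine (hdom m₀ s).trans (mul_le_mul_of_nonneg_left ?_ hD)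
    calc _ ≤ ∏ _m : {m // m ≠ m₀}, C₁ :=
          Finset.prod_le_prod (fun m _ => hf m _) fun m _ => hfC m _
      _ = _ := by rw [Finset.prod_const, Finset.card_univ, hcard]
  have hTk : (T : ℝ) ^ k = (T : ℝ) ^ (k - 1) * T := by
    rw [← pow_succ]; congr 1; omega
  have hP2 : 0 ≤ A * C₁ ^ (k - 1) * (A * C₂ ^ (k - 1)) / c := by positivity
  have hP3 : 0 ≤ (A * C₁ * C₂ ^ (k - 2)) ^ 2 / c := by positivity
  have hP1 : 0 ≤ A * C₂ ^ (k - 1) := by positivity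
  have hP4 : 0 ≤ C₄ ^ 2 := sq_nonneg _
  refine ⟨hsupp, ?_, ?_, ?_⟩
  · rw [hTk, mul_div_assoc, mul_div_cancel_right₀ _ hT0.ne']
    refine hl1.trans ?_
    gcongr
    linarith
  · calc ∑ s, w s ^ 2 ≤ ∑ s, (h ^ (k - 1))⁻¹ * A * C₁ ^ (k - 1) * |w s| := by
          refine Finset.sum_le_sum fun s _ => ?_
          rw [← sq_abs, sq]
          exact mul_le_mul_of_nonneg_right (hsup s) (abs_nonneg _)
      _ ≤ (h ^ (k - 1))⁻¹ * A * C₁ ^ (k - 1) * (A * C₂ ^ (k - 1) * (T : ℝ) ^ (k - 1)) := by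
          rw [← Finset.mul_sum]
          gcongr
      _ = A * C₁ ^ (k - 1) * (A * C₂ ^ (k - 1)) * (T : ℝ) ^ k / (T * h ^ (k - 1)) := by
          rw [hTk]; field_simp
      _ ≤ A * C₁ ^ (k - 1) * (A * C₂ ^ (k - 1)) * (T : ℝ) ^ k / c := by gcongr
      _ = A * C₁ ^ (k - 1) * (A * C₂ ^ (k - 1)) / c * (T : ℝ) ^ k := by ring
      _ ≤ _ := by gcongr; linarith
  · intro B hB2 hBk
    -- Codimension two: the bound `C₄` for the weights times the number of points. Codimension one:
    -- the complementary frequency is zero, which leaves one factor `f` unsummed.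
    by_cases hB : B.card + 2 ≤ k
    · have hk4 : k = 4 := by omega
      have hBc : B.card = 2 := by omega
      have h1 : ∑ s with T ∣ ∑ m ∈ B, (s m : ℕ), |w s| ≤ (T : ℝ) ^ 2 * C₄ := by
        have h2 : ∑ s with T ∣ ∑ m ∈ B, (s m : ℕ), |w s| =
            ∑ s with T ∣ ∑ m ∈ B, (s m : ℕ) ∧ T ∣ ∑ m, (s m : ℕ), |w s| := by
          rw [← Finset.filter_filter]
          refine (Finset.sum_filter_of_ne fun s _ hs => hsupp s fun h => hs ?_).symm
          rw [h, abs_zero]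
        rw [h2]
        refine (Finset.sum_le_card_nsmul _ _ C₄ fun s hs =>
          hsub B hB2 hB s (Finset.mem_filter.1 hs).2.1).trans ?_
        rw [nsmul_eq_mul]
        have hC₄ : 0 ≤ C₄ ∨ ¬ 0 ≤ C₄ := em _
        rcases hC₄ with h | h
        · refine mul_le_mul_of_nonneg_right ?_ h
          exact_mod_cast card_filter_two_blocks_le hk4 B hBc
        · exfalso
          have : NeZero T := ⟨by omega⟩
          -- The tuple `0` lies on every submanifold, so that `C₄` cannot be negative.
          exact h ((abs_nonneg _).trans (hsub B hB2 hB 0 (by simp)))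
      have h3 : T * ((T : ℝ) ^ k)⁻¹ * ∑ s with T ∣ ∑ m ∈ B, (s m : ℕ), |w s| ≤ C₄ / T := by
        calc _ ≤ T * ((T : ℝ) ^ k)⁻¹ * ((T : ℝ) ^ 2 * C₄) := by gcongr
          _ = C₄ / T := by rw [hk4]; field_simp
      have h0 : 0 ≤ T * ((T : ℝ) ^ k)⁻¹ * ∑ s with T ∣ ∑ m ∈ B, (s m : ℕ), |w s| :=
        mul_nonneg (by positivity) (Finset.sum_nonneg fun _ _ => abs_nonneg _)
      calc _ ≤ (T : ℝ) ^ (k - B.card) * (C₄ / T) ^ 2 := by gcongr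
        _ = C₄ ^ 2 := by
            rw [(by omega : k - B.card = 2)]; field_simp
        _ ≤ _ := by linarith
    · have hBc : B.card = k - 1 := by omega
      obtain ⟨m₁, hm₁⟩ : ∃ m₁, Bᶜ = {m₁} := by
        rw [← Finset.card_eq_one, Finset.card_compl, Fintype.card_fin]; omega
      obtain ⟨m₂, hm₂⟩ : ∃ m₂ : Fin k, m₂ ≠ m₁ := by
        have : Nontrivial (Fin k) := Fin.nontrivial_iff_two_le.2 (by omega)
        exact exists_ne m₁
      let z : Fin T := ⟨0, by omega⟩
      have h1 : ∑ s with T ∣ ∑ m ∈ B, (s m : ℕ), |w s| ≤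
          ∑ s with ∀ m, m ≠ m₂ → s m ∈ (if m = m₁ then {z} else Finset.univ : Finset (Fin T)),
            |w s| := by
        rw [Finset.sum_filter, Finset.sum_filter]
        refine Finset.sum_le_sum fun s _ => ?_
        by_cases hws : w s = 0
        · simp [hws]
        by_cases hdB : T ∣ ∑ m ∈ B, (s m : ℕ)
        · have h2 := hsupp s hws
          rw [← Finset.sum_add_sum_compl B, hm₁, Finset.sum_singleton] at h2
          have h3 : s m₁ = z := Fin.ext
            (Nat.eq_zero_of_dvd_of_lt ((Nat.dvd_add_right hdB).1 h2) (s m₁).2)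
          rw [if_pos hdB, if_pos]
          intro m _
          split_ifs with hm
          · rw [hm, h3]; exact Finset.mem_singleton_self _
          · exact Finset.mem_univ _
        · rw [if_neg hdB]
          split_ifs <;> positivity
      have h2 := sum_abs_le_of_dominated hsupp hD f hf m₂ (hdom m₂)
        fun m => if m = m₁ then {z} else Finset.univ
      have h3 : ∏ m : {m // m ≠ m₂}, ∑ t ∈ (if (m : Fin k) = m₁ then {z} else Finset.univ :
          Finset (Fin T)), f m t ≤ C₁ * (C₂ * (T * h)) ^ (k - 2) := by
        rw [← Finset.mul_prod_erase Finset.univ _ (Finset.mem_univ (⟨m₁, hm₂.symm⟩ : {m // m ≠ m₂}))]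
        refine mul_le_mul ?_ ?_ (Finset.prod_nonneg fun m _ => Finset.sum_nonneg fun t _ =>
          hf m t) hC₁
        · rw [if_pos rfl, Finset.sum_singleton]
          exact hfC _ _
        · calc _ ≤ ∏ _m ∈ Finset.univ.erase (⟨m₁, hm₂.symm⟩ : {m // m ≠ m₂}), (C₂ * (T * h)) := by
                refine Finset.prod_le_prod (fun m _ => Finset.sum_nonneg fun t _ => hf m t)
                  fun m hm => ?_
                rw [if_neg fun h => (Finset.mem_erase.1 hm).1 (Subtype.ext h)]
                exact hfs m
            _ = _ := by
                rw [Finset.prod_const, Finset.card_erase_of_mem (Finset.mem_univ _),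
                  Finset.card_univ, hcard]
                rfl
      have h4 : ∑ s with T ∣ ∑ m ∈ B, (s m : ℕ), |w s| ≤
          (h ^ (k - 1))⁻¹ * A * (C₁ * (C₂ * (T * h)) ^ (k - 2)) :=
        h1.trans (h2.trans (mul_le_mul_of_nonneg_left h3 hD))
      have hhk : h ^ (k - 1) = h ^ (k - 2) * h := by
        rw [← pow_succ]; congr 1; omega
      have hTk2 : (T : ℝ) ^ k = (T : ℝ) ^ (k - 2) * T ^ 2 := by
        rw [← pow_add]; congr 1; omega
      have h5 : T * ((T : ℝ) ^ k)⁻¹ * ∑ s with T ∣ ∑ m ∈ B, (s m : ℕ), |w s| ≤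
          A * C₁ * C₂ ^ (k - 2) / (T * h) := by
        calc _ ≤ T * ((T : ℝ) ^ k)⁻¹ * ((h ^ (k - 1))⁻¹ * A * (C₁ * (C₂ * (T * h)) ^ (k - 2))) := by
              gcongr
          _ = _ := by
              rw [hhk, hTk2, mul_pow, mul_pow]
              field_simp
      have h0 : 0 ≤ T * ((T : ℝ) ^ k)⁻¹ * ∑ s with T ∣ ∑ m ∈ B, (s m : ℕ), |w s| :=
        mul_nonneg (by positivity) (Finset.sum_nonneg fun _ _ => abs_nonneg _)
      have hkB : k - B.card = 1 := by omega
      calc _ ≤ (T : ℝ) ^ (k - B.card) * (A * C₁ * C₂ ^ (k - 2) / (T * h)) ^ 2 := by gcongr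
        _ = (A * C₁ * C₂ ^ (k - 2)) ^ 2 / (T * h ^ 2) := by
            rw [hkB]; field_simp
        _ ≤ (A * C₁ * C₂ ^ (k - 2)) ^ 2 / c := by gcongr
        _ ≤ _ := by linarith

end WeightBounds

/-! ### The weights of the spectrum estimators -/

section SpectralWeights

variable {k : ℕ}

/-- The weights of the spectrum estimator at `lam` that smooths over the tuples in `A`. -/
def spectralWeight {T : ℕ} (A : Finset (Fin k → Fin T)) (W : (Fin k → ℝ) → ℝ) (h : ℝ)
    (lam : Fin k → ℝ) (s : Fin k → Fin T) : ℝ :=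
  if s ∈ A then periodizedWeight W h (fun m => lam m - fourierFreq (s m)) else 0

lemma abs_spectralWeight_le {T : ℕ} (A : Finset (Fin k → Fin T)) (W : (Fin k → ℝ) → ℝ) (h : ℝ)
    (lam : Fin k → ℝ) (s : Fin k → Fin T) :
    |spectralWeight A W h lam s| ≤ |periodizedWeight W h (fun m => lam m - fourierFreq (s m))| := by
  unfold spectralWeight
  split_ifs <;> simp

/-- The spectrum estimators' weights satisfy `WeightBound`, uniformly in the sample size and in any
family of frequencies and index sets for which they are bounded on the submanifolds of codimension
two. -/
lemma exists_weightBound_spectralWeight (hk : k = 3 ∨ k = 4) {W : (Fin k → ℝ) → ℝ}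
    (hW : IsWeight k W) {H : ℕ → ℝ} (hHpos : ∀ T, 1 ≤ T → 0 < H T) (hH : Tendsto H atTop (𝓝 0))
    (hTH : Tendsto (fun T : ℕ => (T : ℝ) * H T ^ (k - 1)) atTop atTop) (C₄ : ℝ) :
    ∃ C, 0 ≤ C ∧ ∀ T, 1 ≤ T → ∀ (A : Finset (Fin k → Fin T)) (lam : Fin k → ℝ),
      SumZeroMod Finset.univ lam →
      (∀ B : Finset (Fin k), 2 ≤ B.card → B.card + 2 ≤ k → ∀ s, T ∣ ∑ m ∈ B, (s m : ℕ) →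
        |spectralWeight A W (H T) lam s| ≤ C₄) →
      WeightBound (spectralWeight A W (H T) lam) C := by
  obtain ⟨Hm, c, hHm, hc, hbw⟩ := exists_bandwidth_bounds (by omega) hHpos hH hTH
  obtain ⟨A₀, η, hη, hdecay⟩ := hW.decay
  have hk1 : (0 : ℝ) < (k : ℝ) - 1 := by
    have : (3 : ℝ) ≤ k := by exact_mod_cast (by omega : 3 ≤ k)
    linarith
  have hA₀ : 0 ≤ A₀ := by
    have := (abs_nonneg _).trans (hdecay 0 (by simp))
    simpa using this
  obtain ⟨C, hC, hC1, hC2⟩ := exists_decaySum_le (p := 1 + η / ((k : ℝ) - 1))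
    (lt_add_of_pos_right 1 (by positivity))
  set p := 1 + η / ((k : ℝ) - 1) with hp
  set C₁ := C * (1 + Hm) with hC₁
  -- `1 + T h ≤ (1 / c + 1) T h` because `T h ≥ c`.
  set C₂ := C * (1 / c + 1) with hC₂
  refine ⟨A₀ * C₂ ^ (k - 1) + A₀ * C₁ ^ (k - 1) * (A₀ * C₂ ^ (k - 1)) / c +
      (A₀ * C₁ * C₂ ^ (k - 2)) ^ 2 / c + C₄ ^ 2, by positivity, ?_⟩
  intro T hT A lam hlam hsub
  have hh := hHpos T hT
  obtain ⟨hHT, hb1, hb2, hb3⟩ := hbw T hT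
  have hfin : ∀ x, decaySum p (H T) x ≠ ⊤ := fun x =>
    ne_top_of_le_ne_top ENNReal.ofReal_ne_top (hC1 (H T) x hh)
  let f : Fin k → Fin T → ℝ := fun m s => (decaySum p (H T) (lam m - fourierFreq s)).toReal
  refine weightBound_of_dominated hk hT (A := A₀) (C₁ := C₁) (C₂ := C₂) (c := c) (h := H T)
    (f := f) ?_ hh hA₀ (by positivity) (by positivity) hc hb1 hb2 (fun m s => ENNReal.toReal_nonneg)
    ?_ ?_ ?_ hsub
  · intro s hs
    refine dvd_of_periodizedWeight_ne_zero hT W (H T) hlam s fun h0 => hs ?_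
    unfold spectralWeight
    rw [h0, ite_self]
  · intro m s
    refine (ENNReal.toReal_le_of_le_ofReal (by positivity) (hC1 (H T) _ hh)).trans ?_
    rw [hC₁]
    gcongr
  · intro m
    simp only [f]
    rw [← ENNReal.toReal_sum fun s _ => hfin _]
    refine (ENNReal.toReal_le_of_le_ofReal (by positivity) (hC2 (H T) (lam m) T hh hT)).trans ?_
    rw [hC₂, mul_assoc]
    refine mul_le_mul_of_nonneg_left ?_ hC.le
    rw [add_mul, one_mul, one_div, inv_mul_eq_div]
    gcongr
    rwa [le_div_iff₀ hc, one_mul]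
  · intro m₀ s
    refine (abs_spectralWeight_le A W (H T) lam s).trans ?_
    have h1 := enorm_periodizedWeight_le (by omega : 2 ≤ k) W hh hh hA₀ hη
      (fun m => lam m - fourierFreq (s m)) (fun j hj => ?_) m₀
    · rw [← hp] at h1
      rw [← Real.norm_eq_abs, ← toReal_enorm]
      refine (ENNReal.toReal_mono ?_ h1).trans (le_of_eq ?_)
      · exact ENNReal.mul_ne_top ENNReal.ofReal_ne_top (ENNReal.prod_ne_top fun m _ => hfin _)
      · rw [ENNReal.toReal_mul, ENNReal.toReal_ofReal (by positivity), ENNReal.toReal_prod]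
    · refine (hdecay _ ?_).trans (le_of_eq ?_)
      · rw [← Finset.sum_div, hj, zero_div]
      · congr 3
        have : (fun m => (lam m - fourierFreq (s m) + 2 * Real.pi * (j m : ℝ)) / H T) =
            (H T)⁻¹ • fun m => lam m - fourierFreq (s m) + 2 * Real.pi * (j m : ℝ) := by
          funext m
          rw [Pi.smul_apply, smul_eq_mul, div_eq_inv_mul]
        rw [this, norm_smul, Real.norm_eq_abs, abs_of_pos (by positivity), inv_mul_eq_div]

/-- At a frequency tuple without vanishing subtotal over `B`, the periodized weight is bounded on
the submanifold `∑_{m ∈ B} s_m ≡ 0`, since its argument stays away from the origin. -/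
lemma exists_abs_periodizedWeight_le (hk : 2 ≤ k) {W : (Fin k → ℝ) → ℝ}
    (hW : IsWeight k W) {lam : Fin k → ℝ} (B : Finset (Fin k)) (hB : ¬ SumZeroMod B lam)
    (Hm : ℝ) : ∃ C, ∀ T : ℕ, 1 ≤ T → ∀ h, 0 < h → h ≤ Hm → ∀ s : Fin k → Fin T,
      T ∣ ∑ m ∈ B, (s m : ℕ) →
      |periodizedWeight W h (fun m => lam m - fourierFreq (s m))| ≤ C := by
  obtain ⟨A₀, η, hη, hdecay⟩ := hW.decay
  have hk1 : (0 : ℝ) < (k : ℝ) - 1 := by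
    have : (2 : ℝ) ≤ k := by exact_mod_cast hk
    linarith
  have hA₀ : 0 ≤ A₀ := by
    have := (abs_nonneg _).trans (hdecay 0 (by simp))
    simpa using this
  obtain ⟨C, hC, hC1, -⟩ := exists_decaySum_le (p := 1 + η / ((k : ℝ) - 1))
    (lt_add_of_pos_right 1 (by positivity))
  set q := ((k : ℝ) - 1) + η with hq
  have hq0 : 0 < q := by positivity
  set x := ∑ m ∈ B, lam m with hx
  -- The distance of the subtotal from the multiples of `2π`, in units of `2π`.
  set δ := |x / (2 * Real.pi) - round (x / (2 * Real.pi))| with hδ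
  have hpi := Real.pi_pos
  have hδ0 : 0 < δ := by
    refine abs_pos.2 fun h => hB ⟨round (x / (2 * Real.pi)), ?_⟩
    rw [← hx]
    have : x / (2 * Real.pi) = round (x / (2 * Real.pi)) := by linarith
    rw [← this]
    field_simp
  set δ' := 2 * Real.pi * δ / k with hδ'
  have hk0 : (0 : ℝ) < k := by linarith
  have hδ'0 : 0 < δ' := by positivity
  refine ⟨A₀ * Hm ^ η * (1 + 1 / δ') ^ q * (C * (1 + 1)) ^ (k - 1), fun T hT h hh hhm s hs => ?_⟩
  have hT0 : (0 : ℝ) < T := by exact_mod_cast hT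
  have hHm0 : 0 < Hm := hh.trans_le hhm
  have hcard : ∀ m₀ : Fin k, Fintype.card {m // m ≠ m₀} = k - 1 := fun m₀ => by
    rw [Fintype.card_subtype_compl, Fintype.card_fin, Fintype.card_subtype_eq]
  let m₀ : Fin k := ⟨0, by omega⟩
  -- At distance at least `δ'` from the origin the decay of the weight supplies a factor `h ^ q`,
  -- which absorbs the normalization `h ^ (-(k - 1))` and leaves a decay at scale one.
  set D := A₀ * (h ^ (k - 1) * Hm ^ η) * (1 + 1 / δ') ^ q with hD
  have h1 := enorm_periodizedWeight_le hk W hh one_pos (D := D) (by positivity) hη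
      (fun m => lam m - fourierFreq (s m)) (fun j hj => ?_) m₀
  · rw [← Real.norm_eq_abs, ← toReal_enorm]
    have h2 : ‖periodizedWeight W h (fun m => lam m - fourierFreq (s m))‖ₑ ≤
        ENNReal.ofReal ((h ^ (k - 1))⁻¹ * D * (C * (1 + 1)) ^ (k - 1)) := by
      refine h1.trans ?_
      rw [ENNReal.ofReal_mul (p := (h ^ (k - 1))⁻¹ * D) (by positivity),
        ENNReal.ofReal_pow (by positivity)]
      gcongr
      calc _ ≤ ∏ _m : {m // m ≠ m₀}, ENNReal.ofReal (C * (1 + 1)) :=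
            Finset.prod_le_prod' fun m _ => hC1 1 _ one_pos
        _ = _ := by rw [Finset.prod_const, Finset.card_univ, hcard]
    refine (ENNReal.toReal_le_of_le_ofReal (by positivity) h2).trans (le_of_eq ?_)
    rw [hD]
    field_simp
  · set ρ := ‖fun m => lam m - fourierFreq (s m) + 2 * Real.pi * (j m : ℝ)‖ with hρ
    have hρδ : δ' ≤ ρ := by
      obtain ⟨n, hn⟩ := hs
      have h3 : ∑ m ∈ B, (lam m - fourierFreq (s m) + 2 * Real.pi * (j m : ℝ)) =
          2 * Real.pi * (x / (2 * Real.pi) - ((n : ℤ) - ∑ m ∈ B, j m : ℤ)) := by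
        have hn' : ∑ m ∈ B, ((s m : ℕ) : ℝ) = T * n := by exact_mod_cast hn
        rw [Finset.sum_add_distrib, Finset.sum_sub_distrib, ← hx]
        unfold fourierFreq
        rw [← Finset.sum_div, ← Finset.mul_sum, ← Finset.mul_sum, hn']
        push_cast
        field_simp
        ring
      have h4 : 2 * Real.pi * δ ≤
          |∑ m ∈ B, (lam m - fourierFreq (s m) + 2 * Real.pi * (j m : ℝ))| := by
        rw [h3, abs_mul, abs_of_pos (by positivity : 0 < 2 * Real.pi)]
        gcongr
        exact round_le _ _
      have h5 : |∑ m ∈ B, (lam m - fourierFreq (s m) + 2 * Real.pi * (j m : ℝ))| ≤ k * ρ := by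
        calc _ ≤ ∑ m ∈ B, |lam m - fourierFreq (s m) + 2 * Real.pi * (j m : ℝ)| :=
              Finset.abs_sum_le_sum_abs _ _
          _ ≤ ∑ _m ∈ B, ρ := Finset.sum_le_sum fun m _ => by
              rw [← Real.norm_eq_abs]
              exact norm_le_pi_norm (fun m => lam m - fourierFreq (s m) + 2 * Real.pi * (j m : ℝ)) m
          _ ≤ k * ρ := by
              rw [Finset.sum_const, nsmul_eq_mul]
              gcongr
              simpa using Finset.card_le_univ B
      rw [hδ', div_le_iff₀ hk0]
      linarith
    have hρ0 : 0 < ρ := hδ'0.trans_le hρδ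
    have hnorm : ‖fun m => (lam m - fourierFreq (s m) + 2 * Real.pi * (j m : ℝ)) / h‖ = ρ / h := by
      have : (fun m => (lam m - fourierFreq (s m) + 2 * Real.pi * (j m : ℝ)) / h) =
          h⁻¹ • fun m => lam m - fourierFreq (s m) + 2 * Real.pi * (j m : ℝ) := by
        funext m
        rw [Pi.smul_apply, smul_eq_mul, div_eq_inv_mul]
      rw [this, norm_smul, Real.norm_eq_abs, abs_of_pos (by positivity), inv_mul_eq_div]
    refine (hdecay _ (by rw [← Finset.sum_div, hj, zero_div])).trans ?_
    rw [hnorm, ← hq, div_one]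
    have h6 : (1 + ρ / h) ^ (-q) ≤ h ^ q * ρ ^ (-q) := by
      calc (1 + ρ / h) ^ (-q) ≤ (ρ / h) ^ (-q) :=
            Real.rpow_le_rpow_of_nonpos (by positivity) (by linarith) (by linarith)
        _ = h ^ q * ρ ^ (-q) := by
            rw [Real.div_rpow hρ0.le hh.le, Real.rpow_neg hh.le q, div_inv_eq_mul, mul_comm]
    have h7 : ρ ^ (-q) ≤ (1 + 1 / δ') ^ q * (1 + ρ) ^ (-q) := by
      have h8 : 1 + ρ ≤ (1 + 1 / δ') * ρ := by
        have : 1 ≤ 1 / δ' * ρ := by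
          rw [one_div, inv_mul_eq_div, le_div_iff₀ hδ'0]; linarith
        linarith
      calc ρ ^ (-q) = (1 + 1 / δ') ^ q * ((1 + 1 / δ') * ρ) ^ (-q) := by
            rw [Real.mul_rpow (by positivity) hρ0.le, ← mul_assoc, ← Real.rpow_add (by positivity)]
            simp
        _ ≤ _ := by
            refine mul_le_mul_of_nonneg_left ?_ (by positivity)
            exact Real.rpow_le_rpow_of_nonpos (by positivity) h8 (by linarith)
    have h9 : h ^ q ≤ h ^ (k - 1) * Hm ^ η := by
      rw [hq, Real.rpow_add hh]
      have : h ^ ((k : ℝ) - 1) = h ^ (k - 1) := by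
        rw [← Real.rpow_natCast, Nat.cast_sub (by omega)]
        simp
      rw [this]
      gcongr
    calc A₀ * (1 + ρ / h) ^ (-q) ≤ A₀ * ((h ^ (k - 1) * Hm ^ η) *
          ((1 + 1 / δ') ^ q * (1 + ρ) ^ (-q))) := by
          refine mul_le_mul_of_nonneg_left (h6.trans ?_) hA₀
          exact mul_le_mul h9 h7 (by positivity) (by positivity)
      _ = _ := by rw [hD]; ring

/-- When the submanifolds are left out of the smoothing, the weights vanish there, and the bound is
uniform in the frequency. -/
theorem exists_weightBound_offSubmanifolds (hk : k = 3 ∨ k = 4) {W : (Fin k → ℝ) → ℝ}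
    (hW : IsWeight k W) {H : ℕ → ℝ} (hHpos : ∀ T, 1 ≤ T → 0 < H T) (hH : Tendsto H atTop (𝓝 0))
    (hTH : Tendsto (fun T : ℕ => (T : ℝ) * H T ^ (k - 1)) atTop atTop) :
    ∃ C, 0 ≤ C ∧ ∀ T, 1 ≤ T → ∀ lam : Fin k → ℝ, SumZeroMod Finset.univ lam →
      WeightBound (spectralWeight (offSubmanifolds k T) W (H T) lam) C := by
  obtain ⟨C, hC, h⟩ := exists_weightBound_spectralWeight hk hW hHpos hH hTH 0
  refine ⟨C, hC, fun T hT lam hlam => h T hT _ lam hlam fun B hB2 hBk s hs => le_of_eq ?_⟩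
  unfold spectralWeight
  rw [if_neg, abs_zero]
  intro hmem
  refine (Finset.mem_filter.1 hmem).2.2 B (Finset.card_pos.1 (by omega)) (fun h => ?_) hs
  rw [h, Finset.card_univ, Fintype.card_fin] at hBk
  omega

/-- When all tuples are smoothed over, the weights are bounded on the submanifolds of codimension
two provided that no subtotal of the frequencies vanishes there. -/
theorem exists_weightBound_univ (hk : k = 3 ∨ k = 4) {W : (Fin k → ℝ) → ℝ}
    (hW : IsWeight k W) {H : ℕ → ℝ} (hHpos : ∀ T, 1 ≤ T → 0 < H T) (hH : Tendsto H atTop (𝓝 0))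
    (hTH : Tendsto (fun T : ℕ => (T : ℝ) * H T ^ (k - 1)) atTop atTop) (lam : Fin k → ℝ)
    (hlam : SumZeroMod Finset.univ lam)
    (hsub : ∀ S : Finset (Fin k), 2 ≤ S.card → S.card + 2 ≤ k → ¬ SumZeroMod S lam) :
    ∃ C, 0 ≤ C ∧ ∀ T, 1 ≤ T →
      WeightBound (spectralWeight (Finset.univ : Finset (Fin k → Fin T)) W (H T) lam) C := by
  obtain ⟨Hm, c, hHm, hc, hbw⟩ := exists_bandwidth_bounds (by omega) hHpos hH hTH
  have hB : ∀ B : Finset (Fin k), ∃ C, 2 ≤ B.card → B.card + 2 ≤ k → ∀ T : ℕ, 1 ≤ T →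
      ∀ s : Fin k → Fin T, T ∣ ∑ m ∈ B, (s m : ℕ) →
        |spectralWeight (Finset.univ : Finset (Fin k → Fin T)) W (H T) lam s| ≤ C := by
    intro B
    by_cases h : 2 ≤ B.card ∧ B.card + 2 ≤ k
    · obtain ⟨C, hC⟩ := exists_abs_periodizedWeight_le (by omega) hW B (hsub B h.1 h.2) Hm
      exact ⟨C, fun _ _ T hT s hs => (abs_spectralWeight_le _ _ _ _ _).trans
        (hC T hT (H T) (hHpos T hT) (hbw T hT).1 s hs)⟩
    · exact ⟨0, fun h1 h2 => absurd ⟨h1, h2⟩ h⟩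
  choose C₄ hC₄ using hB
  obtain ⟨C, hC, h⟩ := exists_weightBound_spectralWeight hk hW hHpos hH hTH (∑ B, |C₄ B|)
  refine ⟨C, hC, fun T hT => h T hT _ lam hlam fun B hB2 hBk s hs => ?_⟩
  calc _ ≤ C₄ B := hC₄ B hB2 hBk T hT s hs
    _ ≤ |C₄ B| := le_abs_self _
    _ ≤ _ := Finset.single_le_sum (f := fun B => |C₄ B|) (fun _ _ => abs_nonneg _)
      (Finset.mem_univ B)

end SpectralWeights

/-! ### Inverse filters of matrix polynomials by contour integrals -/

section Laurent

/-- The `n`-th Laurent coefficient at the origin of a function on the circle of radius `R`. -/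
def laurentCoeff (f : ℂ → ℂ) (R : ℝ) (n : ℤ) : ℂ :=
  (2 * Real.pi * Complex.I)⁻¹ • ∮ z in C(0, R), z ^ (-n - 1) • f z

lemma ne_zero_of_mem_sphere_zero {R : ℝ} (hR : 0 < R) {z : ℂ} (hz : z ∈ Metric.sphere (0 : ℂ) R) :
    z ≠ 0 := by
  rintro rfl
  simp at hz
  exact hR.ne hz

lemma continuousOn_zpow_sphere {R : ℝ} (hR : 0 < R) (n : ℤ) :
    ContinuousOn (fun z : ℂ => z ^ n) (Metric.sphere 0 R) := fun z hz =>
  (continuousAt_zpow₀ z n (Or.inl (ne_zero_of_mem_sphere_zero hR hz))).continuousWithinAt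

lemma laurentCoeff_congr {f g : ℂ → ℂ} {R : ℝ} (hR : 0 < R)
    (h : ∀ z ∈ Metric.sphere (0 : ℂ) R, f z = g z) (n : ℤ) :
    laurentCoeff f R n = laurentCoeff g R n := by
  unfold laurentCoeff
  congr 1
  exact circleIntegral.integral_congr hR.le fun z hz => by simp only [h z hz]

lemma laurentCoeff_zpow_mul (f : ℂ → ℂ) {R : ℝ} (hR : 0 < R) (j : ℕ) (n : ℤ) :
    laurentCoeff (fun z => z ^ j * f z) R n = laurentCoeff f R (n - j) := by
  unfold laurentCoeff
  congr 1
  refine circleIntegral.integral_congr hR.le fun z hz => ?_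
  simp only [smul_eq_mul]
  rw [← mul_assoc, ← zpow_natCast z j, ← zpow_add₀ (ne_zero_of_mem_sphere_zero hR hz)]
  congr 2
  ring

lemma laurentCoeff_sum {α : Type*} (s : Finset α) (f : α → ℂ → ℂ) {R : ℝ} (hR : 0 < R)
    (hf : ∀ i ∈ s, ContinuousOn (f i) (Metric.sphere 0 R)) (n : ℤ) :
    laurentCoeff (fun z => ∑ i ∈ s, f i z) R n = ∑ i ∈ s, laurentCoeff (f i) R n := by
  unfold laurentCoeff
  rw [← Finset.smul_sum, ← circleIntegral.integral_fun_sum]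
  · simp only [Finset.smul_sum]
  · intro i hi
    exact ((continuousOn_zpow_sphere hR _).smul (hf i hi)).circleIntegrable hR.le

lemma laurentCoeff_mul_const (f : ℂ → ℂ) (R : ℝ) (c : ℂ) (n : ℤ) :
    laurentCoeff (fun z => f z * c) R n = laurentCoeff f R n * c := by
  unfold laurentCoeff
  have : ∀ z : ℂ, z ^ (-n - 1) • (f z * c) = c * (z ^ (-n - 1) • f z) := fun z => by
    simp only [smul_eq_mul]; ring
  simp_rw [this]
  rw [circleIntegral.integral_const_mul]
  simp only [smul_eq_mul]
  ring

lemma laurentCoeff_sub {f g : ℂ → ℂ} {R : ℝ} (hR : 0 < R)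
    (hf : ContinuousOn f (Metric.sphere 0 R)) (hg : ContinuousOn g (Metric.sphere 0 R)) (n : ℤ) :
    laurentCoeff (fun z => f z - g z) R n = laurentCoeff f R n - laurentCoeff g R n := by
  unfold laurentCoeff
  rw [← smul_sub, ← circleIntegral.integral_sub]
  · simp only [smul_sub]
  · exact ((continuousOn_zpow_sphere hR _).smul hf).circleIntegrable hR.le
  · exact ((continuousOn_zpow_sphere hR _).smul hg).circleIntegrable hR.le

lemma laurentCoeff_one {R : ℝ} (hR : 0 < R) (n : ℤ) :
    laurentCoeff (fun _ => 1) R n = if n = 0 then 1 else 0 := by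
  unfold laurentCoeff
  split_ifs with h
  · subst h
    have := circleIntegral.integral_sub_center_inv (0 : ℂ) hR.ne'
    simp only [sub_zero] at this
    simp only [neg_zero, zero_sub, zpow_neg_one, smul_eq_mul, mul_one, this]
    exact inv_mul_cancel₀ (by simp [Real.pi_ne_zero])
  · have := circleIntegral.integral_sub_zpow_of_ne (n := -n - 1) (by omega) (0 : ℂ) 0 R
    simp only [sub_zero] at this
    simp only [smul_eq_mul, mul_one, this, mul_zero]

lemma norm_laurentCoeff_le {f : ℂ → ℂ} {R C : ℝ} (hR : 0 < R)
    (hf : ∀ z ∈ Metric.sphere (0 : ℂ) R, ‖f z‖ ≤ C) (n : ℤ) :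
    ‖laurentCoeff f R n‖ ≤ C * R ^ (-n) := by
  unfold laurentCoeff
  have h := circleIntegral.norm_two_pi_i_inv_smul_integral_le_of_norm_le_const hR.le
    (f := fun z : ℂ => z ^ (-n - 1) • f z) (c := 0) (C := R ^ (-n - 1) * C) fun z hz => by
      rw [norm_smul, norm_zpow]
      have : ‖z‖ = R := by simpa using hz
      rw [this]
      exact mul_le_mul_of_nonneg_left (hf z hz) (by positivity)
  refine h.trans (le_of_eq ?_)
  rw [zpow_sub_one₀ hR.ne']
  field_simp

/-- The contour of a Laurent coefficient can be moved within an annulus of holomorphy. -/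
lemma laurentCoeff_eq_of_annulus {f : ℂ → ℂ} {r R : ℝ} (hr : 0 < r) (hrR : r ≤ R)
    (hf : ∀ z : ℂ, r ≤ ‖z‖ → ‖z‖ ≤ R → DifferentiableAt ℂ f z) (n : ℤ) :
    laurentCoeff f R n = laurentCoeff f r n := by
  have hd : ∀ z : ℂ, r ≤ ‖z‖ → ‖z‖ ≤ R → DifferentiableAt ℂ (fun z => z ^ (-n - 1) • f z) z := by
    intro z h1 h2
    have hz : z ≠ 0 := by
      rintro rfl
      rw [norm_zero] at h1
      linarith
    exact (differentiableAt_zpow.2 (Or.inl hz)).smul (hf z h1 h2)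
  unfold laurentCoeff
  congr 1
  refine Complex.circleIntegral_eq_of_differentiable_on_annulus_off_countable hr hrR
    Set.countable_empty (fun z hz => ?_) fun z hz => ?_
  · simp only [Set.mem_sdiff, Metric.mem_closedBall, dist_zero_right, Metric.mem_ball, not_lt] at hz
    exact (hd z hz.2 hz.1).continuousAt.continuousWithinAt
  · simp only [Set.mem_sdiff, Metric.mem_closedBall, dist_zero_right, Metric.mem_ball, not_le,
      Set.mem_empty_iff_false, not_false_eq_true, and_true] at hz
    exact hd z hz.2.le hz.1.le

lemma laurentCoeff_eq_zero_of_neg {f : ℂ → ℂ} {R : ℝ} (hR : 0 < R)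
    (hf : ∀ z : ℂ, ‖z‖ ≤ R → DifferentiableAt ℂ f z) {n : ℤ} (hn : n < 0) :
    laurentCoeff f R n = 0 := by
  unfold laurentCoeff
  obtain ⟨m, hm⟩ := Int.eq_ofNat_of_zero_le (by omega : 0 ≤ -n - 1)
  have hd : ∀ z : ℂ, ‖z‖ ≤ R → DifferentiableAt ℂ (fun z => z ^ (-n - 1) • f z) z := by
    intro z hz
    simp only [hm, zpow_natCast]
    exact (differentiableAt_pow m).smul (hf z hz)
  rw [Complex.circleIntegral_eq_zero_of_differentiable_on_off_countable hR.le Set.countable_empty,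
    smul_zero]
  · intro z hz
    exact (hd z (by simpa using hz)).continuousAt.continuousWithinAt
  · intro z hz
    have : ‖z‖ < R := by simpa using hz
    exact hd z this.le

end Laurent

section MatrixPolynomials

variable {d p q : ℕ}

/-- The matrix polynomial `∑_{j ≤ N} z^j c_j`. -/
def matPoly (N : ℕ) (c : ℕ → Matrix (Fin d) (Fin d) ℝ) (z : ℂ) : Matrix (Fin d) (Fin d) ℂ :=
  ∑ j ∈ Finset.range (N + 1), z ^ j • (c j).map Complex.ofReal

/-- The power series coefficients `I, Θ_1, …, Θ_q, 0, …` of `Θ(z)`. -/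
def maCoeff (θ : Coeff d p q) : ℕ → Matrix (Fin d) (Fin d) ℝ
  | 0 => 1
  | n + 1 => if h : n < q then θ.2 ⟨n, h⟩ else 0

lemma matPoly_apply (N : ℕ) (c : ℕ → Matrix (Fin d) (Fin d) ℝ) (z : ℂ) (a b : Fin d) :
    matPoly N c z a b = ∑ j ∈ Finset.range (N + 1), z ^ j * (c j a b : ℂ) := by
  simp [matPoly, Matrix.sum_apply]

lemma arPoly_eq_matPoly (θ : Coeff d p q) (z : ℂ) : arPoly θ z = matPoly p (arCoeff θ) z := by
  have h1 : (1 : Matrix (Fin d) (Fin d) ℝ).map Complex.ofReal = 1 :=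
    Matrix.map_one _ (by simp) (by simp)
  unfold arPoly matPoly
  rw [Finset.sum_range_succ', Finset.sum_range, add_comm, sub_eq_add_neg, ← Finset.sum_neg_distrib]
  congr 1
  · simp [arCoeff, h1]
  · refine Finset.sum_congr rfl fun j _ => ?_
    ext a b
    simp [arCoeff]

lemma maPoly_eq_matPoly (θ : Coeff d p q) (z : ℂ) : maPoly θ z = matPoly q (maCoeff θ) z := by
  have h1 : (1 : Matrix (Fin d) (Fin d) ℝ).map Complex.ofReal = 1 :=
    Matrix.map_one _ (by simp) (by simp)
  unfold maPoly matPoly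
  rw [Finset.sum_range_succ', Finset.sum_range, add_comm]
  congr 1
  · refine Finset.sum_congr rfl fun j _ => ?_
    ext a b
    simp [maCoeff]
  · simp [maCoeff, h1]

lemma differentiable_matPoly_apply (N : ℕ) (c : ℕ → Matrix (Fin d) (Fin d) ℝ) (a b : Fin d) :
    Differentiable ℂ fun z => matPoly N c z a b := by
  simp_rw [matPoly_apply]
  fun_prop

lemma differentiableAt_det {n : Type*} [Fintype n] [DecidableEq n] {A : ℂ → Matrix n n ℂ} {z : ℂ}
    (hA : ∀ i j, DifferentiableAt ℂ (fun z => A z i j) z) :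
    DifferentiableAt ℂ (fun z => (A z).det) z := by
  simp_rw [Matrix.det_apply]
  refine DifferentiableAt.fun_sum fun σ _ => ?_
  exact (DifferentiableAt.fun_finsetProd fun i _ => hA (σ i) i).const_smul _

lemma differentiableAt_inv_apply {n : Type*} [Fintype n] [DecidableEq n] {A : ℂ → Matrix n n ℂ}
    {z : ℂ} (hA : ∀ i j, DifferentiableAt ℂ (fun z => A z i j) z) (hz : (A z).det ≠ 0) (a b : n) :
    DifferentiableAt ℂ (fun z => (A z)⁻¹ a b) z := by
  simp_rw [Matrix.inv_def, Matrix.smul_apply, smul_eq_mul, Ring.inverse_eq_inv',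
    Matrix.adjugate_apply]
  refine ((differentiableAt_det hA).inv hz).mul (differentiableAt_det fun i j => ?_)
  by_cases h : i = b
  · subst h
    simp only [Matrix.updateRow_self]
    exact differentiableAt_const _
  · simp only [Matrix.updateRow_ne h]
    exact hA i j

lemma continuous_matPoly (N : ℕ) (c : ℕ → Matrix (Fin d) (Fin d) ℝ) :
    Continuous (matPoly N c) := by
  refine continuous_matrix fun a b => ?_
  exact (differentiable_matPoly_apply N c a b).continuous

/-- A matrix polynomial without zeros on the unit circle has a two-sided inverse filter with
geometrically decaying coefficients. -/
theorem exists_two_sided_inverse (N : ℕ) (c : ℕ → Matrix (Fin d) (Fin d) ℝ)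
    (hdet : ∀ z : ℂ, ‖z‖ = 1 → (matPoly N c z).det ≠ 0) :
    ∃ (A : ℤ → Matrix (Fin d) (Fin d) ℝ) (C ρ : ℝ), 0 ≤ C ∧ 0 < ρ ∧ ρ < 1 ∧
      (∀ n a b, |A n a b| ≤ C * ρ ^ n.natAbs) ∧
      ∀ n : ℤ, ∑ j ∈ Finset.range (N + 1), A (n - j) * c j = if n = 0 then 1 else 0 := by
  have hopen : IsOpen {z : ℂ | (matPoly N c z).det ≠ 0} :=
    isOpen_ne.preimage (continuous_matPoly N c).matrix_det
  -- The determinant has no zeros on an annulus around the unit circle.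
  obtain ⟨δ₀, hδ₀, hsub⟩ := (isCompact_sphere (0 : ℂ) 1).exists_cthickening_subset_open hopen
    (fun z hz => hdet z (by simpa using hz))
  set δ := min δ₀ (1 / 2) with hδ
  have hδ0 : 0 < δ := lt_min hδ₀ (by norm_num)
  have hδ1 : δ ≤ 1 / 2 := min_le_right _ _
  have hann : ∀ z : ℂ, 1 - δ ≤ ‖z‖ → ‖z‖ ≤ 1 + δ → (matPoly N c z).det ≠ 0 := by
    intro z h1 h2
    have hz0 : ‖z‖ ≠ 0 := by linarith
    refine hsub (Metric.mem_cthickening_of_dist_le z ((‖z‖⁻¹ : ℂ) * z) δ₀ _ ?_ ?_)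
    · simp [hz0]
    · have h3 : z - (‖z‖⁻¹ : ℂ) * z = ((1 - ‖z‖⁻¹ : ℝ) : ℂ) * z := by push_cast; ring
      rw [dist_eq_norm, h3, norm_mul, Complex.norm_real, Real.norm_eq_abs]
      have h4 : |1 - ‖z‖⁻¹| * ‖z‖ = |‖z‖ - 1| := by
        rw [← abs_of_nonneg (norm_nonneg z), ← abs_mul, abs_of_nonneg (norm_nonneg z)]
        congr 1
        field_simp
      rw [h4]
      exact (abs_le.2 ⟨by linarith, by linarith⟩).trans (min_le_left _ _)
  let f : Fin d → Fin d → ℂ → ℂ := fun a b z => (matPoly N c z)⁻¹ a b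
  have hfd : ∀ a b, ∀ z : ℂ, 1 - δ ≤ ‖z‖ → ‖z‖ ≤ 1 + δ → DifferentiableAt ℂ (f a b) z :=
    fun a b z h1 h2 => differentiableAt_inv_apply
      (fun i j => (differentiable_matPoly_apply N c i j) z) (hann z h1 h2) a b
  have hcompact : IsCompact {z : ℂ | 1 - δ ≤ ‖z‖ ∧ ‖z‖ ≤ 1 + δ} := by
    refine (isCompact_closedBall (0 : ℂ) (1 + δ)).of_isClosed_subset ?_ fun z hz => by simpa using hz.2
    exact (isClosed_le continuous_const continuous_norm).inter
      (isClosed_le continuous_norm continuous_const)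
  have hbd : ∀ a b, ∃ C, ∀ z : ℂ, 1 - δ ≤ ‖z‖ → ‖z‖ ≤ 1 + δ → ‖f a b z‖ ≤ C := by
    intro a b
    obtain ⟨C, hC⟩ := hcompact.exists_bound_of_continuousOn (f := f a b)
      fun z hz => (hfd a b z hz.1 hz.2).continuousAt.continuousWithinAt
    exact ⟨C, fun z h1 h2 => hC z ⟨h1, h2⟩⟩
  choose C hC using hbd
  set C' := ∑ a, ∑ b, |C a b| with hC'
  have hCC : ∀ a b, C a b ≤ C' := fun a b => (le_abs_self _).trans
    ((Finset.single_le_sum (f := fun b => |C a b|) (fun _ _ => abs_nonneg _)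
      (Finset.mem_univ b)).trans
    (Finset.single_le_sum (f := fun a => ∑ b, |C a b|)
      (fun _ _ => Finset.sum_nonneg fun _ _ => abs_nonneg _) (Finset.mem_univ a)))
  refine ⟨fun n => Matrix.of fun a b => (laurentCoeff (f a b) 1 n).re, C', (1 + δ)⁻¹, ?_, ?_, ?_,
    ?_, ?_⟩
  · exact Finset.sum_nonneg fun _ _ => Finset.sum_nonneg fun _ _ => abs_nonneg _
  · positivity
  · exact inv_lt_one_of_one_lt₀ (by linarith)
  · intro n a b
    show |(laurentCoeff (f a b) 1 n).re| ≤ _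
    refine (Complex.abs_re_le_norm _).trans ?_
    -- The circle is moved outwards for `n ≥ 0` and inwards for `n < 0`; the inner radius satisfies
    -- `1 - δ ≤ (1 + δ)⁻¹`, so that one rate serves both sides.
    rcases le_or_gt 0 n with hn | hn
    · rw [← laurentCoeff_eq_of_annulus one_pos (by linarith : (1 : ℝ) ≤ 1 + δ)
        (fun z h1 h2 => hfd a b z (by linarith) h2)]
      refine (norm_laurentCoeff_le (C := C') (by positivity) (fun z hz => ?_) n).trans (le_of_eq ?_)
      · have : ‖z‖ = 1 + δ := by simpa using hz
        exact (hC a b z (by linarith) (by linarith)).trans (hCC a b)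
      · obtain ⟨m, rfl⟩ := Int.eq_ofNat_of_zero_le hn
        rw [zpow_neg, zpow_natCast, Int.natAbs_natCast, inv_pow]
    · rw [laurentCoeff_eq_of_annulus (by linarith : 0 < 1 - δ) (by linarith : 1 - δ ≤ 1)
        (fun z h1 h2 => hfd a b z h1 (by linarith))]
      refine (norm_laurentCoeff_le (C := C') (by linarith) (fun z hz => ?_) n).trans ?_
      · have : ‖z‖ = |1 - δ| := by
          rw [abs_of_pos (by linarith)]
          simpa using hz
        rw [abs_of_pos (by linarith)] at this
        exact (hC a b z (by linarith) (by linarith)).trans (hCC a b)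
      · obtain ⟨m, hm⟩ := Int.eq_ofNat_of_zero_le (by omega : 0 ≤ -n)
        have hnm : n.natAbs = m := by omega
        rw [hm, zpow_natCast, hnm]
        refine mul_le_mul_of_nonneg_left ?_
          (Finset.sum_nonneg fun _ _ => Finset.sum_nonneg fun _ _ => abs_nonneg _)
        refine pow_le_pow_left₀ (by linarith) ?_ m
        rw [le_inv_comm₀ (by linarith) (by positivity), ← one_div, le_div_iff₀ (by linarith)]
        nlinarith
  · intro n
    ext a b
    have hcont : ∀ a b, ContinuousOn (f a b) (Metric.sphere 0 1) := fun a b z hz => by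
      have : ‖z‖ = 1 := by simpa using hz
      exact (hfd a b z (by linarith) (by linarith)).continuousAt.continuousWithinAt
    -- Comparing coefficients in `P(z)⁻¹ P(z) = 1` on the unit circle. The filter `A` consists of
    -- real parts, which is harmless because the coefficients `c` are real.
    have hid : ∀ z ∈ Metric.sphere (0 : ℂ) 1,
        ∑ j ∈ Finset.range (N + 1), ∑ e, z ^ j * f a e z * (c j e b : ℂ) =
          (if a = b then 1 else 0 : ℂ) := by
      intro z hz
      have hz1 : ‖z‖ = 1 := by simpa using hz
      have h1 : (matPoly N c z)⁻¹ * matPoly N c z = 1 :=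
        Matrix.nonsing_inv_mul _ (Ne.isUnit (hdet z hz1))
      have h2 := congrFun (congrFun h1 a) b
      rw [Matrix.mul_apply, Matrix.one_apply] at h2
      rw [← h2, Finset.sum_comm]
      refine Finset.sum_congr rfl fun e _ => ?_
      rw [matPoly_apply, Finset.mul_sum]
      exact Finset.sum_congr rfl fun j _ => by simp only [f]; ring
    have h3 : ∑ j ∈ Finset.range (N + 1), ∑ e, laurentCoeff (f a e) 1 (n - j) * (c j e b : ℂ) =
        (if n = 0 then 1 else 0) * (if a = b then 1 else 0 : ℂ) := by
      rw [← laurentCoeff_one one_pos n, ← laurentCoeff_mul_const]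
      rw [laurentCoeff_congr one_pos (f := fun z : ℂ => 1 * (if a = b then 1 else 0 : ℂ))
        (g := fun z => ∑ j ∈ Finset.range (N + 1), ∑ e, z ^ j * f a e z * (c j e b : ℂ))
        (fun z hz => by rw [hid z hz, one_mul])]
      have hterm : ∀ j e, ContinuousOn (fun z : ℂ => z ^ j * f a e z * (c j e b : ℂ))
          (Metric.sphere 0 1) := fun j e =>
        ((continuousOn_id.pow j).mul (hcont a e)).mul continuousOn_const
      rw [laurentCoeff_sum _ (fun (j : ℕ) (z : ℂ) => ∑ e, z ^ j * f a e z * (c j e b : ℂ)) one_pos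
        fun j _ => continuousOn_finsetSum _ fun e _ => hterm j e]
      refine Finset.sum_congr rfl fun j _ => ?_
      rw [laurentCoeff_sum _ (fun e (z : ℂ) => z ^ j * f a e z * (c j e b : ℂ)) one_pos
        fun e _ => hterm j e]
      refine Finset.sum_congr rfl fun e _ => ?_
      rw [laurentCoeff_mul_const, laurentCoeff_zpow_mul _ one_pos]
    have h4 := congrArg Complex.re h3
    simp only [Complex.re_sum, Complex.re_mul_ofReal] at h4
    rw [Matrix.sum_apply]
    simp only [Matrix.mul_apply, Matrix.of_apply]
    rw [h4]
    by_cases hn : n = 0 <;> by_cases hab : a = b <;> simp [hn, hab, Matrix.one_apply]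

end MatrixPolynomials

/-! ### Uniform bounds for the causal inverse filter -/

section CausalInverse

variable {d p q : ℕ}

lemma continuous_arPoly_apply (a b : Fin d) :
    Continuous fun x : Coeff d p q × ℂ => arPoly x.1 x.2 a b := by
  have : ∀ x : Coeff d p q × ℂ, arPoly x.1 x.2 a b =
      (1 : Matrix (Fin d) (Fin d) ℂ) a b -
        ∑ j : Fin p, x.2 ^ ((j : ℕ) + 1) * ((x.1.1 j a b : ℝ) : ℂ) := fun x => by
    simp [arPoly, Matrix.sum_apply]
  simp_rw [this]
  have h : ∀ j : Fin p, Continuous fun x : Coeff d p q × ℂ => x.1.1 j a b := fun j =>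
    ((continuous_apply j).comp (continuous_fst.comp continuous_fst)).matrix_elem a b
  exact continuous_const.sub (continuous_finsetSum _ fun j _ =>
    (continuous_snd.pow _).mul (Complex.continuous_ofReal.comp (h j)))

lemma continuous_maPoly_apply (a b : Fin d) :
    Continuous fun x : Coeff d p q × ℂ => maPoly x.1 x.2 a b := by
  have : ∀ x : Coeff d p q × ℂ, maPoly x.1 x.2 a b =
      (1 : Matrix (Fin d) (Fin d) ℂ) a b +
        ∑ j : Fin q, x.2 ^ ((j : ℕ) + 1) * ((x.1.2 j a b : ℝ) : ℂ) := fun x => by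
    simp [maPoly, Matrix.sum_apply]
  simp_rw [this]
  have h : ∀ j : Fin q, Continuous fun x : Coeff d p q × ℂ => x.1.2 j a b := fun j =>
    ((continuous_apply j).comp (continuous_snd.comp continuous_fst)).matrix_elem a b
  exact continuous_const.add (continuous_finsetSum _ fun j _ =>
    (continuous_snd.pow _).mul (Complex.continuous_ofReal.comp (h j)))

/-- By compactness the zeros of `det Θ(z)` stay off a disc of radius larger than one, uniformly
over the parameter set. -/
lemma exists_radius_det_maPoly_ne_zero {K : Set (Coeff d p q)} (hK : IsCompact K)
    (hroots : ∀ θ ∈ K, RootsOutside θ) :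
    ∃ R : ℝ, 1 < R ∧ ∀ θ ∈ K, ∀ z : ℂ, ‖z‖ ≤ R → (maPoly θ z).det ≠ 0 := by
  have hopen : IsOpen {x : Coeff d p q × ℂ | (maPoly x.1 x.2).det ≠ 0} :=
    isOpen_ne.preimage (continuous_matrix fun a b => continuous_maPoly_apply a b).matrix_det
  obtain ⟨U, V, -, hV, hKU, hBV, hUV⟩ := generalized_tube_lemma hK
    (isCompact_closedBall (0 : ℂ) 1) hopen (by
      intro x hx
      have hz : ‖x.2‖ ≤ 1 := mem_closedBall_zero_iff.1 hx.2
      exact right_ne_zero_of_mul (hroots x.1 hx.1 x.2 hz))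
  obtain ⟨δ, hδ, hsub⟩ := (isCompact_closedBall (0 : ℂ) 1).exists_cthickening_subset_open hV hBV
  refine ⟨1 + δ, by linarith, fun θ hθ z hz => ?_⟩
  have hzV : z ∈ V := by
    refine hsub ?_
    rw [cthickening_closedBall hδ.le zero_le_one, mem_closedBall_zero_iff]
    exact hz.trans (by linarith)
  have hx : (θ, z) ∈ {x : Coeff d p q × ℂ | (maPoly x.1 x.2).det ≠ 0} :=
    hUV (Set.mk_mem_prod (hKU hθ) hzV)
  exact hx

/-- The matrix polynomials are Lipschitz in the parameters on a disc. -/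
lemma norm_sub_le_sqrt_distSq (θ θ' : Coeff d p q) {R : ℝ} (hR : 1 ≤ R) {z : ℂ} (hz : ‖z‖ ≤ R)
    (a b : Fin d) :
    ‖arPoly θ z a b - arPoly θ' z a b‖ ≤ (p + q) * R ^ (p + q) * √(distSq θ θ') ∧
      ‖maPoly θ z a b - maPoly θ' z a b‖ ≤ (p + q) * R ^ (p + q) * √(distSq θ θ') := by
  have hd1 : 0 ≤ ∑ j, ∑ a, ∑ b, (θ.1 j a b - θ'.1 j a b) ^ 2 := by positivity
  have hd2 : 0 ≤ ∑ j, ∑ a, ∑ b, (θ.2 j a b - θ'.2 j a b) ^ 2 := by positivity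
  have key : ∀ (n : ℕ), n ≤ p + q → ∀ f : Fin n → Matrix (Fin d) (Fin d) ℝ,
      ∑ j, ∑ a, ∑ b, (f j a b) ^ 2 ≤ distSq θ θ' →
      ‖∑ j : Fin n, z ^ ((j : ℕ) + 1) * ((f j a b : ℝ) : ℂ)‖ ≤
        (p + q) * R ^ (p + q) * √(distSq θ θ') := by
    intro n hn f hf
    have h1 : ∀ j, |f j a b| ≤ √(distSq θ θ') := by
      intro j
      refine Real.abs_le_sqrt (le_trans ?_ hf)
      refine le_trans ?_ (Finset.single_le_sum (f := fun j => ∑ a, ∑ b, (f j a b) ^ 2)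
        (fun _ _ => by positivity) (Finset.mem_univ j))
      refine le_trans ?_ (Finset.single_le_sum (f := fun a => ∑ b, (f j a b) ^ 2)
        (fun _ _ => by positivity) (Finset.mem_univ a))
      exact Finset.single_le_sum (f := fun b => (f j a b) ^ 2)
        (fun _ _ => by positivity) (Finset.mem_univ b)
    calc _ ≤ ∑ _j : Fin n, R ^ (p + q) * √(distSq θ θ') := by
          refine norm_sum_le_of_le _ fun j _ => ?_
          rw [norm_mul, norm_pow, Complex.norm_real, Real.norm_eq_abs]
          refine mul_le_mul ?_ (h1 j) (abs_nonneg _) (by positivity)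
          exact (pow_le_pow_left₀ (norm_nonneg _) hz _).trans
            (pow_le_pow_right₀ hR (by omega))
      _ ≤ _ := by
          rw [Finset.sum_const, Finset.card_univ, Fintype.card_fin, nsmul_eq_mul, ← mul_assoc]
          gcongr
          exact_mod_cast hn
  constructor
  · have : arPoly θ z a b - arPoly θ' z a b =
        -∑ j : Fin p, z ^ ((j : ℕ) + 1) * (((θ.1 j - θ'.1 j) a b : ℝ) : ℂ) := by
      simp only [arPoly, Matrix.sub_apply, Matrix.sum_apply, Matrix.smul_apply, Matrix.map_apply,
        smul_eq_mul, Complex.ofReal_sub, mul_sub, Finset.sum_sub_distrib]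
      ring
    rw [this, norm_neg]
    refine key p (by omega) (fun j => θ.1 j - θ'.1 j) ?_
    simp only [Matrix.sub_apply]
    unfold distSq
    linarith
  · have : maPoly θ z a b - maPoly θ' z a b =
        ∑ j : Fin q, z ^ ((j : ℕ) + 1) * (((θ.2 j - θ'.2 j) a b : ℝ) : ℂ) := by
      simp only [maPoly, Matrix.sub_apply, Matrix.add_apply, Matrix.sum_apply, Matrix.smul_apply,
        Matrix.map_apply, smul_eq_mul, Complex.ofReal_sub, mul_sub, Finset.sum_sub_distrib]
      ring
    rw [this]
    refine key q (by omega) (fun j => θ.2 j - θ'.2 j) ?_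
    simp only [Matrix.sub_apply]
    unfold distSq
    linarith

/-- The transfer function `Θ(z)⁻¹ Φ(z)` of the inverse filter. -/
def invTransfer (θ : Coeff d p q) (z : ℂ) : Matrix (Fin d) (Fin d) ℂ :=
  (maPoly θ z)⁻¹ * arPoly θ z

lemma differentiableAt_invTransfer_apply (θ : Coeff d p q) {z : ℂ} (hz : (maPoly θ z).det ≠ 0)
    (a b : Fin d) : DifferentiableAt ℂ (fun z => invTransfer θ z a b) z := by
  simp_rw [invTransfer, Matrix.mul_apply]
  refine DifferentiableAt.fun_sum fun e _ => (differentiableAt_inv_apply (fun i j => ?_) hz a e).mul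
    ?_
  · simp_rw [maPoly_eq_matPoly]
    exact differentiable_matPoly_apply _ _ _ _ z
  · simp_rw [arPoly_eq_matPoly]
    exact differentiable_matPoly_apply _ _ _ _ z

/-- `Θ(z)⁻¹ Φ(z) = ∑ π_n z^n`: the recursively defined coefficients are the Taylor coefficients of
the transfer function. -/
lemma invCoeff_eq_laurentCoeff (θ : Coeff d p q) {R : ℝ} (hR : 0 < R)
    (hdet : ∀ z : ℂ, ‖z‖ ≤ R → (maPoly θ z).det ≠ 0) (n : ℕ) (a b : Fin d) :
    (invCoeff θ n a b : ℂ) = laurentCoeff (fun z => invTransfer θ z a b) R n := by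
  have hdiff : ∀ a b, ∀ z : ℂ, ‖z‖ ≤ R → DifferentiableAt ℂ (fun z => invTransfer θ z a b) z :=
    fun a b z hz => differentiableAt_invTransfer_apply θ (hdet z hz) a b
  have hcont : ∀ a b, ContinuousOn (fun z => invTransfer θ z a b) (Metric.sphere 0 R) :=
    fun a b z hz => (hdiff a b z (by simpa using (Metric.sphere_subset_closedBall
      hz))).continuousAt.continuousWithinAt
  -- comparing coefficients in `Θ(z) F(z) = Φ(z)`
  have hrec : ∀ (n : ℕ) (a b : Fin d), ∑ j ∈ Finset.range (q + 1), ∑ e, (maCoeff θ j a e : ℂ) *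
      laurentCoeff (fun z => invTransfer θ z e b) R ((n : ℤ) - j) = (arCoeff θ n a b : ℂ) := by
    intro n a b
    have hid : ∀ z ∈ Metric.sphere (0 : ℂ) R,
        ∑ j ∈ Finset.range (q + 1), ∑ e, z ^ j * invTransfer θ z e b * (maCoeff θ j a e : ℂ) =
          ∑ j ∈ Finset.range (p + 1), z ^ j * 1 * (arCoeff θ j a b : ℂ) := by
      intro z hz
      have hz1 : ‖z‖ ≤ R := by simpa using (Metric.sphere_subset_closedBall hz)
      have h1 : maPoly θ z * invTransfer θ z = arPoly θ z :=
        Matrix.mul_nonsing_inv_cancel_left _ _ (Ne.isUnit (hdet z hz1))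
      have h2 := congrFun (congrFun h1 a) b
      rw [Matrix.mul_apply, arPoly_eq_matPoly, matPoly_apply] at h2
      simp only [mul_one]
      rw [← h2, Finset.sum_comm]
      refine Finset.sum_congr rfl fun e _ => ?_
      rw [maPoly_eq_matPoly, matPoly_apply, Finset.sum_mul]
      exact Finset.sum_congr rfl fun j _ => by ring
    have hterm : ∀ j e, ContinuousOn
        (fun z : ℂ => z ^ j * invTransfer θ z e b * (maCoeff θ j a e : ℂ)) (Metric.sphere 0 R) :=
      fun j e => ((continuousOn_id.pow j).mul (hcont e b)).mul continuousOn_const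
    have h3 := laurentCoeff_congr hR hid n
    rw [laurentCoeff_sum _ (fun (j : ℕ) (z : ℂ) =>
        ∑ e, z ^ j * invTransfer θ z e b * (maCoeff θ j a e : ℂ)) hR
        fun j _ => continuousOn_finsetSum _ fun e _ => hterm j e,
      laurentCoeff_sum _ (fun (j : ℕ) (z : ℂ) => z ^ j * 1 * (arCoeff θ j a b : ℂ)) hR
        fun j _ => ((continuousOn_id.pow j).mul continuousOn_const).mul continuousOn_const] at h3
    have h4 : ∀ j ∈ Finset.range (q + 1), laurentCoeff
        (fun z => ∑ e, z ^ j * invTransfer θ z e b * (maCoeff θ j a e : ℂ)) R n =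
        ∑ e, (maCoeff θ j a e : ℂ) *
          laurentCoeff (fun z => invTransfer θ z e b) R ((n : ℤ) - j) := by
      intro j _
      rw [laurentCoeff_sum _ (fun e (z : ℂ) => z ^ j * invTransfer θ z e b * (maCoeff θ j a e : ℂ))
        hR fun e _ => hterm j e]
      refine Finset.sum_congr rfl fun e _ => ?_
      rw [laurentCoeff_mul_const, laurentCoeff_zpow_mul _ hR, mul_comm]
    have h5 : ∀ j ∈ Finset.range (p + 1), laurentCoeff
        (fun z => z ^ j * 1 * (arCoeff θ j a b : ℂ)) R n =
        if j = n then (arCoeff θ n a b : ℂ) else 0 := by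
      intro j _
      rw [laurentCoeff_mul_const, laurentCoeff_zpow_mul _ hR, laurentCoeff_one hR]
      by_cases h : j = n
      · subst h; simp
      · have : ¬ ((n : ℤ) - j = 0) := by omega
        simp [h, this]
    rw [Finset.sum_congr rfl h4, Finset.sum_congr rfl h5, Finset.sum_ite_eq'] at h3
    rw [h3]
    -- Beyond the degree `p` both sides vanish.
    split_ifs with hn
    · rfl
    · have hn' : p < n := by simpa using hn
      obtain ⟨m, rfl⟩ : ∃ m, n = m + 1 := ⟨n - 1, by omega⟩
      simp [arCoeff, show ¬ m < p by omega]
  induction n using Nat.strong_induction_on generalizing a b with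
  | _ n ih =>
    have h := hrec n a b
    rw [Finset.sum_range_succ', Finset.sum_range] at h
    have h0 : ∑ e, (maCoeff θ 0 a e : ℂ) *
        laurentCoeff (fun z => invTransfer θ z e b) R ((n : ℤ) - (0 : ℕ)) =
        laurentCoeff (fun z => invTransfer θ z a b) R n := by
      rw [Finset.sum_eq_single a (fun e _ he => by simp [maCoeff, Matrix.one_apply_ne he.symm])
        (by simp)]
      simp [maCoeff]
    rw [h0] at h
    have hi : ∀ i : Fin q, ∑ e, (maCoeff θ ((i : ℕ) + 1) a e : ℂ) *
        laurentCoeff (fun z => invTransfer θ z e b) R ((n : ℤ) - ((i : ℕ) + 1 : ℕ)) =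
        (((if _h : (i : ℕ) + 1 ≤ n then θ.2 i * invCoeff θ (n - ((i : ℕ) + 1)) else 0 :
          Matrix (Fin d) (Fin d) ℝ) a b : ℝ) : ℂ) := by
      intro i
      split_ifs with hin
      · rw [Matrix.mul_apply, Complex.ofReal_sum]
        refine Finset.sum_congr rfl fun e _ => ?_
        rw [Complex.ofReal_mul, ih _ (by omega) e b, Nat.cast_sub hin]
        simp [maCoeff]
      · rw [Matrix.zero_apply, Complex.ofReal_zero]
        refine Finset.sum_eq_zero fun e _ => ?_
        rw [laurentCoeff_eq_zero_of_neg hR (hdiff e b) (by omega), mul_zero]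
    rw [Finset.sum_congr rfl fun i _ => hi i] at h
    rw [invCoeff, Matrix.sub_apply, Matrix.sum_apply, Complex.ofReal_sub, Complex.ofReal_sum, ← h]
    ring

/-- Uniformly over a compact set of fundamental models, the coefficients of the inverse filter
decay geometrically and are Lipschitz in the model parameters with geometrically decaying
constants. -/
theorem exists_invCoeff_bounds {K : Set (Coeff d p q)} (hK : IsCompact K)
    (hroots : ∀ θ ∈ K, RootsOutside θ) :
    ∃ C ρ : ℝ, 0 ≤ C ∧ 0 < ρ ∧ ρ < 1 ∧ ∀ θ ∈ K, ∀ n a b, |invCoeff θ n a b| ≤ C * ρ ^ n ∧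
      ∀ θ' ∈ K, |invCoeff θ n a b - invCoeff θ' n a b| ≤ C * √(distSq θ θ') * ρ ^ n := by
  obtain ⟨R, hR1, hdet⟩ := exists_radius_det_maPoly_ne_zero hK hroots
  have hR : 0 < R := by linarith
  have hcompact : IsCompact (K ×ˢ Metric.closedBall (0 : ℂ) R) := hK.prod (isCompact_closedBall _ _)
  have hNc : ∀ a b, ContinuousOn (fun x : Coeff d p q × ℂ => (maPoly x.1 x.2)⁻¹ a b)
      (K ×ˢ Metric.closedBall (0 : ℂ) R) := by
    intro a b
    have hc : Continuous fun x : Coeff d p q × ℂ => maPoly x.1 x.2 :=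
      continuous_matrix fun a b => continuous_maPoly_apply a b
    simp_rw [Matrix.inv_def, Matrix.smul_apply, smul_eq_mul, Ring.inverse_eq_inv']
    exact (hc.matrix_det.continuousOn.inv₀ fun x hx => hdet x.1 hx.1 x.2 (by simpa using hx.2)).mul
      (hc.matrix_adjugate.matrix_elem a b).continuousOn
  have hFc : ∀ a b, ContinuousOn (fun x : Coeff d p q × ℂ => invTransfer x.1 x.2 a b)
      (K ×ˢ Metric.closedBall (0 : ℂ) R) := by
    intro a b
    simp_rw [invTransfer, Matrix.mul_apply]
    exact continuousOn_finsetSum _ fun e _ => (hNc a e).mul (continuous_arPoly_apply e b).continuousOn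
  choose CN hCN using fun a b => hcompact.exists_bound_of_continuousOn (hNc a b)
  choose CF hCF using fun a b => hcompact.exists_bound_of_continuousOn (hFc a b)
  have hsum : ∀ (G : Fin d → Fin d → ℝ) a b, G a b ≤ ∑ a, ∑ b, |G a b| := fun G a b =>
    (le_abs_self _).trans ((Finset.single_le_sum (f := fun b => |G a b|)
      (fun _ _ => abs_nonneg _) (Finset.mem_univ b)).trans
      (Finset.single_le_sum (f := fun a => ∑ b, |G a b|)
        (fun _ _ => Finset.sum_nonneg fun _ _ => abs_nonneg _) (Finset.mem_univ a)))
  set N₀ := ∑ a, ∑ b, |CN a b| with hN₀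
  set F₀ := ∑ a, ∑ b, |CF a b| with hF₀
  have hN0 : 0 ≤ N₀ := by positivity
  have hF0 : 0 ≤ F₀ := by positivity
  have hN : ∀ θ ∈ K, ∀ z : ℂ, ‖z‖ ≤ R → ∀ a b, ‖(maPoly θ z)⁻¹ a b‖ ≤ N₀ := fun θ hθ z hz a b =>
    (hCN a b (θ, z) ⟨hθ, by simpa using hz⟩).trans (hsum CN a b)
  have hF : ∀ θ ∈ K, ∀ z : ℂ, ‖z‖ ≤ R → ∀ a b, ‖invTransfer θ z a b‖ ≤ F₀ := fun θ hθ z hz a b =>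
    (hCF a b (θ, z) ⟨hθ, by simpa using hz⟩).trans (hsum CF a b)
  set S := ((p : ℝ) + q) * R ^ (p + q) with hS
  have hS0 : 0 ≤ S := by positivity
  have hL : ∀ θ ∈ K, ∀ θ' ∈ K, ∀ z : ℂ, ‖z‖ ≤ R → ∀ a b,
      ‖invTransfer θ z a b - invTransfer θ' z a b‖ ≤
        d * (N₀ * (S + d * (S * F₀))) * √(distSq θ θ') := by
    intro θ hθ θ' hθ' z hz a b
    -- The resolvent identity `Θ⁻¹Φ - Θ'⁻¹Φ' = Θ⁻¹ ((Φ - Φ') - (Θ - Θ') Θ'⁻¹Φ')`.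
    have h1 : invTransfer θ z - invTransfer θ' z =
        (maPoly θ z)⁻¹ * ((arPoly θ z - arPoly θ' z) -
          (maPoly θ z - maPoly θ' z) * invTransfer θ' z) := by
      have e1 : (maPoly θ z)⁻¹ * (maPoly θ z * invTransfer θ' z) = invTransfer θ' z :=
        Matrix.nonsing_inv_mul_cancel_left _ _ (Ne.isUnit (hdet θ hθ z hz))
      have e2 : maPoly θ' z * invTransfer θ' z = arPoly θ' z :=
        Matrix.mul_nonsing_inv_cancel_left _ _ (Ne.isUnit (hdet θ' hθ' z hz))
      rw [Matrix.sub_mul, e2, Matrix.mul_sub, Matrix.mul_sub, Matrix.mul_sub, e1]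
      unfold invTransfer
      abel
    rw [← Matrix.sub_apply, h1, Matrix.mul_apply]
    set D := √(distSq θ θ') with hD
    have hD0 : 0 ≤ D := Real.sqrt_nonneg _
    have hb : ∀ e, ‖((arPoly θ z - arPoly θ' z) -
        (maPoly θ z - maPoly θ' z) * invTransfer θ' z) e b‖ ≤ (S + d * (S * F₀)) * D := by
      intro e
      rw [Matrix.sub_apply, Matrix.mul_apply, Matrix.sub_apply]
      refine (norm_sub_le _ _).trans ?_
      have h2 : ‖∑ g, (maPoly θ z - maPoly θ' z) e g * invTransfer θ' z g b‖ ≤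
          ∑ _g : Fin d, S * D * F₀ := by
        refine norm_sum_le_of_le _ fun g _ => ?_
        rw [norm_mul, Matrix.sub_apply]
        exact mul_le_mul (norm_sub_le_sqrt_distSq θ θ' hR1.le hz e g).2 (hF θ' hθ' z hz g b)
          (norm_nonneg _) (by positivity)
      rw [Finset.sum_const, Finset.card_univ, Fintype.card_fin, nsmul_eq_mul] at h2
      refine (add_le_add (norm_sub_le_sqrt_distSq θ θ' hR1.le hz e b).1 h2).trans (le_of_eq ?_)
      ring
    calc _ ≤ ∑ _e : Fin d, N₀ * ((S + d * (S * F₀)) * D) := by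
          refine norm_sum_le_of_le _ fun e _ => ?_
          rw [norm_mul]
          exact mul_le_mul (hN θ hθ z hz a e) (hb e) (norm_nonneg _) hN0
      _ = _ := by
          rw [Finset.sum_const, Finset.card_univ, Fintype.card_fin, nsmul_eq_mul]
          ring
  have hpow : ∀ n : ℕ, R ^ (-(n : ℤ)) = R⁻¹ ^ n := fun n => by rw [zpow_neg, zpow_natCast, inv_pow]
  have hcont : ∀ θ ∈ K, ∀ a b, ContinuousOn (fun z => invTransfer θ z a b) (Metric.sphere 0 R) :=
    fun θ hθ a b z hz => (differentiableAt_invTransfer_apply θ (hdet θ hθ z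
      (by simpa using (Metric.sphere_subset_closedBall hz))) a b).continuousAt.continuousWithinAt
  refine ⟨max F₀ (d * (N₀ * (S + d * (S * F₀)))), R⁻¹, le_max_of_le_left hF0, by positivity,
    inv_lt_one_of_one_lt₀ hR1, fun θ hθ n a b => ⟨?_, fun θ' hθ' => ?_⟩⟩
  · rw [← Real.norm_eq_abs, ← Complex.norm_real, invCoeff_eq_laurentCoeff θ hR (hdet θ hθ)]
    refine (norm_laurentCoeff_le hR (fun z hz => hF θ hθ z ?_ a b) n).trans ?_
    · simpa using (Metric.sphere_subset_closedBall hz)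
    · rw [hpow]
      gcongr
      exact le_max_left _ _
  · rw [← Real.norm_eq_abs, ← Complex.norm_real, Complex.ofReal_sub,
      invCoeff_eq_laurentCoeff θ hR (hdet θ hθ), invCoeff_eq_laurentCoeff θ' hR (hdet θ' hθ'),
      ← laurentCoeff_sub hR (hcont θ hθ a b) (hcont θ' hθ' a b)]
    refine (norm_laurentCoeff_le hR (fun z hz => hL θ hθ θ' hθ' z ?_ a b) n).trans ?_
    · simpa using (Metric.sphere_subset_closedBall hz)
    · rw [hpow]
      gcongr
      exact le_max_right _ _

end CausalInverse

/-! ### The two-sided moving average representation -/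

section TwoSided

variable {Ω : Type*} [MeasurableSpace Ω] {P : Measure Ω} {d p q : ℕ}

lemma lintegral_enorm_le_of_integral_sq [IsProbabilityMeasure P] {f : Ω → ℝ} (hf : MemLp f 2 P) :
    ∫⁻ ω, ‖f ω‖ₑ ∂P ≤ ENNReal.ofReal (1 + ∫ ω, f ω ^ 2 ∂P) := by
  have h1 : Integrable (fun ω => 1 + f ω ^ 2) P := (integrable_const 1).add hf.integrable_sq
  have h2 : (1 : ℝ) + ∫ ω, f ω ^ 2 ∂P = ∫ ω, (1 + f ω ^ 2) ∂P := by
    rw [integral_add (integrable_const 1) hf.integrable_sq]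
    simp
  rw [h2, ofReal_integral_eq_lintegral_ofReal h1 (Eventually.of_forall fun ω => by positivity)]
  refine lintegral_mono fun ω => ?_
  rw [← ofReal_norm, Real.norm_eq_abs]
  refine ENNReal.ofReal_le_ofReal ?_
  nlinarith [sq_nonneg (|f ω| - 1), sq_abs (f ω), abs_nonneg (f ω)]

lemma lintegral_enorm_pi_le [IsProbabilityMeasure P] {f : Ω → Fin d → ℝ} {σ : ℝ}
    (hf : ∀ a, MemLp (fun ω => f ω a) 2 P) (hσ : ∀ a, ∫ ω, f ω a ^ 2 ∂P ≤ σ) :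
    ∫⁻ ω, ‖f ω‖ₑ ∂P ≤ d * ENNReal.ofReal (1 + σ) := by
  calc ∫⁻ ω, ‖f ω‖ₑ ∂P ≤ ∫⁻ ω, ∑ a, ‖f ω a‖ₑ ∂P := by
        refine lintegral_mono fun ω => ?_
        simp only [← ofReal_norm]
        rw [← ENNReal.ofReal_sum_of_nonneg fun _ _ => norm_nonneg _]
        refine ENNReal.ofReal_le_ofReal ((pi_norm_le_iff_of_nonneg
          (Finset.sum_nonneg fun _ _ => norm_nonneg _)).2 fun a => ?_)
        exact Finset.single_le_sum (f := fun a => ‖f ω a‖) (fun _ _ => norm_nonneg _)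
          (Finset.mem_univ a)
    _ = ∑ a, ∫⁻ ω, ‖f ω a‖ₑ ∂P := lintegral_finsetSum' _ fun a _ => (hf a).1.enorm
    _ ≤ ∑ _a : Fin d, ENNReal.ofReal (1 + σ) := Finset.sum_le_sum fun a _ =>
        (lintegral_enorm_le_of_integral_sq (hf a)).trans
          (ENNReal.ofReal_le_ofReal (by linarith [hσ a]))
    _ = _ := by simp

lemma summable_pow_natAbs {ρ : ℝ} (h0 : 0 ≤ ρ) (h1 : ρ < 1) :
    Summable fun n : ℤ => ρ ^ n.natAbs := by
  refine Summable.of_nat_of_neg ?_ ?_ <;> simpa using summable_geometric_of_lt_one h0 h1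

/-- Summable weights and bounded first absolute moments make the weighted sum of a process over
lags converge absolutely, almost surely for all times together. -/
lemma ae_forall_summable_mul_norm {ι : Type*} [Countable ι] {x : ℤ → Ω → Fin d → ℝ} {Q : ENNReal}
    (hQ : Q ≠ ⊤) (hx : ∀ t, AEMeasurable (x t) P) (hxQ : ∀ t, ∫⁻ ω, ‖x t ω‖ₑ ∂P ≤ Q)
    {c : ι → ℝ} (hc0 : ∀ i, 0 ≤ c i) (hc : Summable c) (lag : ι → ℤ) :
    ∀ᵐ ω ∂P, ∀ t : ℤ, Summable fun i => c i * ‖x (t - lag i) ω‖ := by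
  rw [ae_all_iff]
  intro t
  have hm : ∀ i, AEMeasurable (fun ω => ENNReal.ofReal (c i) * ‖x (t - lag i) ω‖ₑ) P := fun i =>
    (hx _).enorm.const_mul _
  have hfin : ∫⁻ ω, ∑' i, ENNReal.ofReal (c i) * ‖x (t - lag i) ω‖ₑ ∂P ≠ ⊤ := by
    rw [lintegral_tsum hm]
    refine ne_top_of_le_ne_top (b := ∑' i, ENNReal.ofReal (c i) * Q) ?_
      (ENNReal.tsum_le_tsum fun i => ?_)
    · rw [ENNReal.tsum_mul_right]
      exact ENNReal.mul_ne_top hc.tsum_ofReal_ne_top hQ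
    · rw [lintegral_const_mul'' _ (hx _).enorm]
      gcongr
      exact hxQ _
  filter_upwards [ae_lt_top' (AEMeasurable.tsum hm) hfin] with ω hω
  have h1 := ENNReal.summable_toReal hω.ne
  refine h1.congr fun i => ?_
  rw [ENNReal.toReal_mul, ENNReal.toReal_ofReal (hc0 i), toReal_enorm]

lemma norm_mulVec_le_of_entry_le (A : Matrix (Fin d) (Fin d) ℝ) {C : ℝ} (hC : 0 ≤ C)
    (hA : ∀ a b, |A a b| ≤ C) (x : Fin d → ℝ) : ‖A.mulVec x‖ ≤ d * C * ‖x‖ := by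
  refine (pi_norm_le_iff_of_nonneg (by positivity)).2 fun a => ?_
  calc ‖∑ b, A a b * x b‖ ≤ ∑ _b : Fin d, C * ‖x‖ := norm_sum_le_of_le _ fun b _ => by
        rw [norm_mul]
        exact mul_le_mul (hA a b) (norm_le_pi_norm x b) (norm_nonneg _) hC
    _ = _ := by simp [mul_assoc]

/-- A two-sided filter applied to a finite moving average is the filter with the convolved
coefficients. -/
lemma hasSum_mulVec_conv {A : ℤ → Matrix (Fin d) (Fin d) ℝ} {C ρ : ℝ} (hC : 0 ≤ C) (hρ : 0 ≤ ρ)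
    (hA : ∀ n a b, |A n a b| ≤ C * ρ ^ n.natAbs) {x : ℤ → Fin d → ℝ}
    (hx : ∀ t, Summable fun n : ℤ => ρ ^ n.natAbs * ‖x (t - n)‖) (N : ℕ)
    (c : ℕ → Matrix (Fin d) (Fin d) ℝ) (t : ℤ) :
    ∃ v, HasSum (fun n => (A n).mulVec (∑ j ∈ Finset.range (N + 1), (c j).mulVec (x (t - n - j)))) v ∧
      HasSum (fun n => (∑ j ∈ Finset.range (N + 1), A (n - j) * c j).mulVec (x (t - n))) v := by
  have h1 : ∀ j : ℕ, Summable fun n : ℤ => (A n).mulVec ((c j).mulVec (x (t - n - j))) := by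
    intro j
    have hb : ∀ a b, |c j a b| ≤ ∑ a, ∑ b, |c j a b| := fun a b =>
      (Finset.single_le_sum (f := fun b => |c j a b|) (fun _ _ => abs_nonneg _)
        (Finset.mem_univ b)).trans
      (Finset.single_le_sum (f := fun a => ∑ b, |c j a b|)
        (fun _ _ => Finset.sum_nonneg fun _ _ => abs_nonneg _) (Finset.mem_univ a))
    refine Summable.of_norm_bounded (g := fun n : ℤ => d * C * (d * ∑ a, ∑ b, |c j a b|) *
      (ρ ^ n.natAbs * ‖x (t - j - n)‖)) ((hx _).mul_left _) fun n => ?_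
    refine (norm_mulVec_le_of_entry_le (A n) (by positivity) (hA n) _).trans ?_
    have h2 := norm_mulVec_le_of_entry_le (c j) (by positivity) hb (x (t - n - j))
    rw [show t - j - n = t - n - j by ring]
    calc _ ≤ d * (C * ρ ^ n.natAbs) * (d * (∑ a, ∑ b, |c j a b|) * ‖x (t - n - j)‖) := by gcongr
      _ = _ := by ring
  have h2 : ∀ j : ℕ, HasSum (fun n : ℤ => (A (n - j) * c j).mulVec (x (t - n)))
      (∑' n, (A n).mulVec ((c j).mulVec (x (t - n - j)))) := by
    intro j
    have h3 := (Equiv.subRight (j : ℤ)).hasSum_iff.2 (h1 j).hasSum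
    refine h3.congr_fun fun n => ?_
    simp only [Function.comp_apply, Equiv.subRight_apply, Matrix.mulVec_mulVec]
    congr 2
    ring
  refine ⟨∑ j ∈ Finset.range (N + 1), ∑' n, (A n).mulVec ((c j).mulVec (x (t - n - j))), ?_, ?_⟩
  · refine (hasSum_sum fun j _ => (h1 j).hasSum).congr_fun fun n => ?_
    rw [Matrix.mulVec_sum]
  · refine (hasSum_sum fun j _ => h2 j).congr_fun fun n => ?_
    rw [Matrix.sum_mulVec]

lemma arFilter_eq_sum (θ : Coeff d p q) (x : ℤ → Fin d → ℝ) (t : ℤ) :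
    arFilter θ x t = ∑ j ∈ Finset.range (p + 1), (arCoeff θ j).mulVec (x (t - j)) := by
  rw [Finset.sum_range_succ', Finset.sum_range, arFilter, sub_eq_add_neg, add_comm,
    ← Finset.sum_neg_distrib]
  congr 1
  · refine Finset.sum_congr rfl fun j _ => ?_
    simp [arCoeff, Matrix.neg_mulVec]
  · simp [arCoeff]

lemma maFilter_eq_sum (θ : Coeff d p q) (x : ℤ → Fin d → ℝ) (t : ℤ) :
    maFilter θ x t = ∑ j ∈ Finset.range (q + 1), (maCoeff θ j).mulVec (x (t - j)) := by
  rw [Finset.sum_range_succ', Finset.sum_range, maFilter, add_comm]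
  congr 1
  · refine Finset.sum_congr rfl fun j _ => ?_
    simp [maCoeff]
  · simp [maCoeff]

variable {ε y : ℤ → Ω → Fin d → ℝ}

lemma IsStationary.exists_lintegral_enorm_le [IsProbabilityMeasure P] (hy : IsStationary P y) :
    ∃ Q : ENNReal, Q ≠ ⊤ ∧ ∀ t, ∫⁻ ω, ‖y t ω‖ₑ ∂P ≤ Q := by
  refine ⟨d * ENNReal.ofReal (1 + ∑ a, ∫ ω, y 0 ω a ^ 2 ∂P),
    ENNReal.mul_ne_top (ENNReal.natCast_ne_top _) ENNReal.ofReal_ne_top, fun t => ?_⟩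
  refine lintegral_enorm_pi_le (fun a => ?_) fun a => ?_
  · exact (hy.memLp t).of_le ((measurable_pi_apply a).comp_aemeasurable
      (hy.memLp t).1.aemeasurable).aestronglyMeasurable
      (Eventually.of_forall fun ω => norm_le_pi_norm (y t ω) a)
  · have h := hy.cov t 0 0 a a
    simp only [add_zero, ← pow_two] at h
    rw [h]
    exact Finset.single_le_sum (f := fun a => ∫ ω, y 0 ω a ^ 2 ∂P)
      (fun _ _ => integral_nonneg fun _ => sq_nonneg _) (Finset.mem_univ a)

lemma IsStructuralShock.lintegral_enorm_le [IsProbabilityMeasure P] (hε : IsStructuralShock P ε)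
    (t : ℤ) : ∫⁻ ω, ‖ε t ω‖ₑ ∂P ≤ d * ENNReal.ofReal (1 + 1) := by
  refine lintegral_enorm_pi_le (fun a => (hε.memLp_comp t a).mono_exponent (by norm_num))
    fun a => ?_
  have h := hε.cov t a a
  simp only [← pow_two, if_true] at h
  exact h.le

/-- The stationary solution is the two-sided moving average `y_t = ∑_{l ∈ ℤ} Ψ_l ε_{t-l}` with
geometrically decaying coefficients, `∑ Ψ_l z^l = Φ(z)⁻¹ Θ(z) B` on the unit circle. -/
theorem IsSVARMA.exists_movingAverage [IsProbabilityMeasure P] {θ₀ : Coeff d p q}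
    {B : Matrix (Fin d) (Fin d) ℝ} (hε : IsStructuralShock P ε) (hy : IsSVARMA P θ₀ B ε y) :
    ∃ (Ψ : ℤ → Matrix (Fin d) (Fin d) ℝ) (C ρ : ℝ), 0 ≤ C ∧ 0 < ρ ∧ ρ < 1 ∧
      (∀ l a b, |Ψ l a b| ≤ C * ρ ^ l.natAbs) ∧
      ∀ᵐ ω ∂P, ∀ t, HasSum (fun l => (Ψ l).mulVec (ε (t - l) ω)) (y t ω) := by
  obtain ⟨A, C, ρ, hC, hρ0, hρ1, hA, hinv⟩ := exists_two_sided_inverse p (arCoeff θ₀) fun z hz => by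
    rw [← arPoly_eq_matPoly]
    exact left_ne_zero_of_mul (hy.noUnitRoot z hz)
  set m : ℕ → Matrix (Fin d) (Fin d) ℝ := fun j => maCoeff θ₀ j * B with hm
  obtain ⟨Q, hQ, hyQ⟩ := hy.stationary.exists_lintegral_enorm_le
  have hsum := summable_pow_natAbs hρ0.le hρ1
  have hys := ae_forall_summable_mul_norm hQ (fun t => (hy.stationary.memLp t).1.aemeasurable) hyQ
    (fun n : ℤ => by positivity) hsum id
  have hεs := ae_forall_summable_mul_norm
    (ENNReal.mul_ne_top (ENNReal.natCast_ne_top _) ENNReal.ofReal_ne_top)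
    (fun t => (hε.measurable t).aemeasurable) hε.lintegral_enorm_le
    (fun n : ℤ => by positivity) hsum id
  have hmb : ∀ j a b, |m j a b| ≤ ∑ j ∈ Finset.range (q + 1), ∑ a, ∑ b, |m j a b| := by
    intro j a b
    by_cases hj : j ∈ Finset.range (q + 1)
    · refine le_trans ?_ (Finset.single_le_sum (f := fun j => ∑ a, ∑ b, |m j a b|)
        (fun _ _ => by positivity) hj)
      exact (Finset.single_le_sum (f := fun b => |m j a b|) (fun _ _ => abs_nonneg _)
        (Finset.mem_univ b)).trans
        (Finset.single_le_sum (f := fun a => ∑ b, |m j a b|)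
          (fun _ _ => Finset.sum_nonneg fun _ _ => abs_nonneg _) (Finset.mem_univ a))
    · have : maCoeff θ₀ j = 0 := by
        obtain ⟨i, rfl⟩ : ∃ i, j = i + 1 := ⟨j - 1, by simp at hj; omega⟩
        simp at hj
        simp [maCoeff, show ¬ i < q by omega]
      simp only [hm, this, Matrix.zero_mul, Matrix.zero_apply, abs_zero]
      positivity
  set S := ∑ j ∈ Finset.range (q + 1), ∑ a, ∑ b, |m j a b| with hS
  have hS0 : 0 ≤ S := by positivity
  refine ⟨fun n => ∑ j ∈ Finset.range (q + 1), A (n - j) * m j,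
    ∑ _j ∈ Finset.range (q + 1), d * (C * ρ⁻¹ ^ q * S), ρ, by positivity, hρ0, hρ1, ?_, ?_⟩
  · intro l a b
    show |(∑ j ∈ Finset.range (q + 1), A (l - j) * m j) a b| ≤ _
    rw [Matrix.sum_apply, Finset.sum_mul]
    refine (Finset.abs_sum_le_sum_abs _ _).trans (Finset.sum_le_sum fun j hj => ?_)
    rw [Matrix.mul_apply]
    calc |∑ e, A (l - j) a e * m j e b| ≤ ∑ _e : Fin d, C * ρ⁻¹ ^ q * ρ ^ l.natAbs * S := by
          refine (Finset.abs_sum_le_sum_abs _ _).trans (Finset.sum_le_sum fun e _ => ?_)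
          rw [abs_mul]
          refine mul_le_mul ((hA _ _ _).trans ?_) (hmb j e b) (abs_nonneg _) (by positivity)
          rw [mul_assoc]
          refine mul_le_mul_of_nonneg_left ?_ hC
          rw [inv_pow, ← div_eq_inv_mul, le_div_iff₀ (by positivity), ← pow_add]
          refine pow_le_pow_of_le_one hρ0.le hρ1.le ?_
          have : j < q + 1 := by simpa using hj
          omega
      _ = _ := by
          rw [Finset.sum_const, Finset.card_univ, Fintype.card_fin, nsmul_eq_mul]
          ring
  · filter_upwards [hys, hεs, ae_all_iff.2 hy.equation] with ω h1 h2 h3 t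
    obtain ⟨v, hv1, hv2⟩ := hasSum_mulVec_conv hC hρ0.le hA (x := fun s => y s ω)
      (fun t => h1 t) p (arCoeff θ₀) t
    obtain ⟨v', hv1', hv2'⟩ := hasSum_mulVec_conv hC hρ0.le hA (x := fun s => ε s ω)
      (fun t => h2 t) q m t
    -- The inverse filter applied to the two sides of the model equation.
    have hvv : v = v' := by
      refine hv1.unique (hv1'.congr_fun fun n => ?_)
      rw [← arFilter_eq_sum θ₀ (fun s => y s ω), h3, maFilter_eq_sum]
      simp only [hm, Matrix.mulVec_mulVec]
    -- On the left-hand side the convolved filter is the identity.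
    have hvy : v = y t ω := by
      refine hv2.unique ?_
      have h4 := hasSum_single (f := fun n : ℤ =>
        (∑ j ∈ Finset.range (p + 1), A (n - j) * arCoeff θ₀ j).mulVec (y (t - n) ω)) 0
        fun n hn => by simp only [hinv, if_neg hn, Matrix.zero_mulVec]
      simp only [hinv, if_true, Matrix.one_mulVec, sub_zero] at h4
      simpa only [hinv] using h4
    rw [← hvy, hvv]
    exact hv2'

end TwoSided

/-! ### Spectrum estimators as multilinear forms -/

section SpectralForms

variable {d k T : ℕ}

/-- A spectrum-type estimator written in the time domain: the multilinear form in the series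
`s_1, …, s_k` with the kernel of the frequency weights `w`. -/
def spectralForm (w : (Fin k → Fin T) → ℝ) (s : Fin k → Fin T → ℝ) : ℂ :=
  ∑ t : Fin k → Fin T, timeKernel w (fun m => ((t m : ℕ) : ℤ)) * ((∏ m, s m (t m) : ℝ) : ℂ)

/-- The factors `2π` of the smoothing and of the periodogram cancel, which leaves `T ^ (-k)`. -/
lemma specEst_eq_spectralForm (hk : 1 ≤ k) (A : Finset (Fin k → Fin T)) (W : (Fin k → ℝ) → ℝ)
    (h : ℝ) (x : Fin T → Fin d → ℝ) (c : Fin k → Fin d) (lam : Fin k → ℝ) :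
    specEst A W h x c lam =
      spectralForm (spectralWeight A W h lam) (fun m t => x t (c m)) := by
  have hdft : ∀ s : Fin k → Fin T, ∏ m, dft x (c m) (fourierFreq (s m)) =
      ∑ t : Fin k → Fin T, (∏ m, phase T ((s m : ℕ) * ((t m : ℕ) : ℤ))) *
        ((∏ m, x (t m) (c m) : ℝ) : ℂ) := by
    intro s
    simp only [dft]
    rw [Finset.prod_univ_sum, Fintype.piFinset_univ]
    refine Finset.sum_congr rfl fun t _ => ?_
    rw [Complex.ofReal_prod, ← Finset.prod_mul_distrib]
    refine Finset.prod_congr rfl fun m _ => ?_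
    rw [mul_comm]
    congr 1
    unfold phase fourierFreq
    congr 1
    push_cast
    ring
  have hc : (2 * Real.pi / T : ℂ) ^ (k - 1) * (1 / ((2 * Real.pi) ^ (k - 1) * T)) =
      ((T : ℂ) ^ k)⁻¹ := by
    obtain ⟨n, rfl⟩ : ∃ n, k = n + 1 := ⟨k - 1, by omega⟩
    have h2 : ((2 : ℂ) * Real.pi) ^ n ≠ 0 := pow_ne_zero _ (by simp [Real.pi_ne_zero])
    rw [Nat.add_sub_cancel, div_pow, one_div, mul_inv, pow_succ, mul_inv, div_eq_mul_inv]
    field_simp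
  unfold specEst spectralForm periodogram timeKernel
  simp_rw [hdft]
  rw [Finset.mul_sum]
  simp_rw [Finset.mul_sum, Finset.sum_mul]
  rw [Finset.sum_comm]
  refine Finset.sum_congr rfl fun t _ => ?_
  simp only [spectralWeight]
  rw [← Finset.sum_filter_add_sum_filter_not Finset.univ (fun s => s ∈ A)
    (fun s => ((T : ℂ) ^ k)⁻¹ * (((if s ∈ A then periodizedWeight W h
      (fun m => lam m - fourierFreq (s m)) else 0 : ℝ) : ℂ) *
      ∏ m, phase T ((s m : ℕ) * ((t m : ℕ) : ℤ))) * ((∏ m, x (t m) (c m) : ℝ) : ℂ))]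
  rw [Finset.sum_eq_zero (s := Finset.univ.filter fun s => ¬ s ∈ A), add_zero]
  · rw [Finset.filter_mem_eq_inter, Finset.univ_inter]
    refine Finset.sum_congr rfl fun s hs => ?_
    rw [if_pos hs, ← hc]
    ring
  · intro s hs
    rw [if_neg (Finset.mem_filter.1 hs).2]
    simp

lemma spectralForm_mul (w : (Fin k → Fin T) → ℝ) (c : Fin k → ℝ) (s : Fin k → Fin T → ℝ) :
    spectralForm w (fun m t => c m * s m t) = ((∏ m, c m : ℝ) : ℂ) * spectralForm w s := by
  unfold spectralForm
  rw [Finset.mul_sum]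
  refine Finset.sum_congr rfl fun t _ => ?_
  rw [Finset.prod_mul_distrib, Complex.ofReal_mul]
  ring

/-- Telescoping of the form over its slots, with each increment split into two parts. -/
lemma spectralForm_sub_eq_sum (w : (Fin k → Fin T) → ℝ) {U V G G' : Fin k → Fin T → ℝ}
    (hG : ∀ m t, U m t - V m t = G m t + G' m t) :
    spectralForm w U - spectralForm w V =
      ∑ m₀, (spectralForm w (fun m => if m = m₀ then G m else if m < m₀ then V m else U m) +
        spectralForm w (fun m => if m = m₀ then G' m else if m < m₀ then V m else U m)) := by
  have hprod : ∀ (m₀ : Fin k) (F : Fin k → Fin T → ℝ) (t : Fin k → Fin T),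
      ∏ m, (if m = m₀ then F m else if m < m₀ then V m else U m) (t m) =
        F m₀ (t m₀) * (∏ m with m < m₀, V m (t m)) * ∏ m with m₀ < m, U m (t m) := by
    intro m₀ F t
    have h1 : F m₀ (t m₀) = ∏ m, if m = m₀ then F m (t m) else 1 := by simp
    rw [h1, Finset.prod_filter, Finset.prod_filter, ← Finset.prod_mul_distrib,
      ← Finset.prod_mul_distrib]
    refine Finset.prod_congr rfl fun m _ => ?_
    rcases lt_trichotomy m m₀ with h | h | h
    · simp [h, h.ne, h.not_gt]
    · simp [h]
    · simp [h, h.ne', h.not_gt]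
  unfold spectralForm
  rw [← Finset.sum_sub_distrib]
  simp_rw [← Finset.sum_add_distrib]
  rw [Finset.sum_comm]
  refine Finset.sum_congr rfl fun t _ => ?_
  simp_rw [← mul_add]
  rw [← mul_sub, ← Finset.mul_sum, ← Complex.ofReal_sub]
  congr 1
  simp_rw [← Complex.ofReal_add]
  rw [← Complex.ofReal_sum]
  congr 1
  have h2 := Finset.prod_sub_ordered Finset.univ (fun m => U m (t m))
    (fun m => U m (t m) - V m (t m))
  simp only [sub_sub_cancel] at h2
  rw [h2, sub_sub_cancel]
  refine Finset.sum_congr rfl fun m₀ _ => ?_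
  rw [hprod, hprod, hG]
  ring

/-- Multilinear expansion of the form when every slot is a convergent series. -/
lemma enorm_spectralForm_le_tsum {ι : Type*} (w : (Fin k → Fin T) → ℝ)
    {X : Fin k → ι → Fin T → ℝ} {x : Fin k → Fin T → ℝ}
    (hX : ∀ m t, HasSum (fun a => X m a t) (x m t)) :
    ‖spectralForm w x‖ₑ ≤ ∑' a : Fin k → ι, ‖spectralForm w fun m => X m (a m)‖ₑ := by
  classical
  have hlim : Tendsto (fun F : Finset ι => spectralForm w fun m t => ∑ a ∈ F, X m a t) atTop
      (𝓝 (spectralForm w x)) := by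
    refine tendsto_finsetSum _ fun t _ => Tendsto.const_mul _ ?_
    refine (Complex.continuous_ofReal.tendsto _).comp ?_
    exact tendsto_finsetProd _ fun m _ => hX m (t m)
  refine le_of_tendsto hlim.enorm (Eventually.of_forall fun F => ?_)
  have h1 : (spectralForm w fun m t => ∑ a ∈ F, X m a t) =
      ∑ a ∈ Fintype.piFinset fun _ : Fin k => F, spectralForm w fun m => X m (a m) := by
    unfold spectralForm
    rw [Finset.sum_comm]
    refine Finset.sum_congr rfl fun t _ => ?_
    rw [← Finset.mul_sum, Finset.prod_univ_sum, Complex.ofReal_sum]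
  rw [h1]
  exact (enorm_sum_le _ _).trans (ENNReal.sum_le_tsum _)

/-- The multilinear expansion with coefficients that are dominated by a product of slot constants
`D` and common bounds `p`. -/
lemma enorm_spectralForm_le_tsum_mul {ι : Type*} (w : (Fin k → Fin T) → ℝ)
    {c : Fin k → ι → ℝ} {S : Fin k → ι → Fin T → ℝ} {x : Fin k → Fin T → ℝ}
    (hX : ∀ m t, HasSum (fun a => c m a * S m a t) (x m t)) {D : Fin k → ℝ} {p : ι → ℝ}
    (hD : ∀ m, 0 ≤ D m) (hc : ∀ m a, |c m a| ≤ D m * p a) :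
    ‖spectralForm w x‖ₑ ≤ ∑' a : Fin k → ι, (∏ m, ENNReal.ofReal (p (a m))) *
      (ENNReal.ofReal (∏ m, D m) * ‖spectralForm w fun m => S m (a m)‖ₑ) := by
  refine (enorm_spectralForm_le_tsum w hX).trans (ENNReal.tsum_le_tsum fun a => ?_)
  rw [spectralForm_mul, enorm_mul, ← mul_assoc]
  gcongr
  rw [ENNReal.ofReal_prod_of_nonneg fun m _ => hD m, ← Finset.prod_mul_distrib, ← ofReal_norm,
    Complex.norm_real, Real.norm_eq_abs, Finset.abs_prod,
    ENNReal.ofReal_prod_of_nonneg fun m _ => abs_nonneg _]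
  refine Finset.prod_le_prod' fun m _ => ?_
  rw [mul_comm, ← ENNReal.ofReal_mul (hD m)]
  exact ENNReal.ofReal_le_ofReal (hc m _)

end SpectralForms

section ShockSlots

variable {Ω : Type*} {d k T : ℕ}
  {ε : ℤ → Ω → Fin d → ℝ}

open Classical in
/-- The lagged shock `ε_{t-j}` with component `e`, at the sample times in `act`. -/
def shockSlot (ε : ℤ → Ω → Fin d → ℝ) (act : ℕ → Prop) (j : ℤ) (e : Fin d) (ω : Ω)
    (t : Fin T) : ℝ :=
  if act t then ε (((t : ℕ) : ℤ) - j) ω e else 0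

/-- With every slot active from some time on, no slot is frozen; the value of `r` is immaterial. -/
lemma spectralForm_shockSlot_eq_shockForm (w : (Fin k → Fin T) → ℝ) (r : Fin k → Fin T)
    {act : Fin k → ℕ → Prop} {lo : Fin k → ℕ} (hact : ∀ m n, act m n ↔ lo m ≤ n) (j : Fin k → ℤ)
    (e : Fin k → Fin d) (ω : Ω) :
    spectralForm w (fun m => shockSlot ε (act m) (j m) (e m) ω) =
      shockForm ε w Finset.univ r (fun m => j m) (fun m => e m) (fun m => lo m) ω := by
  classical
  have hEquiv : Function.Bijective fun (t : Fin k → Fin T) (m : (Finset.univ : Finset (Fin k))) =>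
      t m := by
    refine ⟨fun t t' h => funext fun m => congrFun h ⟨m, Finset.mem_univ m⟩, fun t => ?_⟩
    exact ⟨fun m => t ⟨m, Finset.mem_univ m⟩, rfl⟩
  unfold spectralForm shockForm
  rw [← Fintype.sum_bijective _ hEquiv _ _ fun t => rfl]
  refine Finset.sum_congr rfl fun t _ => ?_
  have h1 : extendTimes Finset.univ r (fun m => t m) = fun m => ((t m : ℕ) : ℤ) := by
    ext m
    simp [extendTimes]
  have h2 : ∏ m : (Finset.univ : Finset (Fin k)), ε (((t m : ℕ) : ℤ) - j m) ω (e m) =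
      ∏ m, ε (((t m : ℕ) : ℤ) - j m) ω (e m) :=
    Finset.prod_coe_sort Finset.univ fun m => ε (((t m : ℕ) : ℤ) - j m) ω (e m)
  simp only [shockSlot, truncKernel, h1, h2, hact]
  rw [Finset.prod_ite_zero]
  by_cases h : ∀ m, lo m ≤ (t m : ℕ)
  · rw [if_pos fun m _ => h m, if_pos fun m : (Finset.univ : Finset (Fin k)) => h m]
  · rw [if_neg fun h' => h fun m => h' m (Finset.mem_univ m),
      if_neg fun h' => h fun m => h' ⟨m, Finset.mem_univ m⟩]
    simp

/-- When one slot is active only before time `i`, its time can be frozen at each of at most `i`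
values. -/
lemma spectralForm_shockSlot_eq_sum (w : (Fin k → Fin T) → ℝ) (m₀ : Fin k) {i : ℕ}
    {act : Fin k → ℕ → Prop} {lo : Fin k → ℕ} (hact₀ : ∀ n, act m₀ n ↔ n < i)
    (hact : ∀ m, m ≠ m₀ → ∀ n, act m n ↔ lo m ≤ n) (j : Fin k → ℤ)
    (e : Fin k → Fin d) (ω : Ω) :
    spectralForm w (fun m => shockSlot ε (act m) (j m) (e m) ω) =
      ∑ r ∈ Finset.univ.filter fun r : Fin T => (r : ℕ) < i, (ε (((r : ℕ) : ℤ) - j m₀) ω (e m₀) : ℂ) *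
        shockForm ε w (Finset.univ.erase m₀) (fun _ => r) (fun m => j m) (fun m => e m)
          (fun m => lo m) ω := by
  classical
  let M := Finset.univ.erase m₀
  have hM : ∀ m, m ∈ M ↔ m ≠ m₀ := fun m => by simp [M]
  -- A tuple of times is the time of slot `m₀` together with the times of the other slots.
  let E : Fin T × (M → Fin T) → Fin k → Fin T := fun x m =>
    if h : m ∈ M then x.2 ⟨m, h⟩ else x.1
  have hE₀ : ∀ x, E x m₀ = x.1 := fun x => dif_neg (by simp [hM])
  have hE₁ : ∀ x (m : M), E x m = x.2 m := fun x m => dif_pos m.2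
  have hE : Function.Bijective E := by
    refine ⟨fun x x' h => ?_, fun t => ⟨(t m₀, fun m => t m), funext fun m => ?_⟩⟩
    · refine Prod.ext ?_ (funext fun m => ?_)
      · rw [← hE₀ x, ← hE₀ x', h]
      · rw [← hE₁ x, ← hE₁ x', h]
    · by_cases h : m ∈ M
      · exact hE₁ (t m₀, fun m => t m) ⟨m, h⟩
      · obtain rfl : m = m₀ := by simpa [hM] using h
        exact hE₀ _
  unfold spectralForm shockForm
  rw [← Fintype.sum_bijective E hE _ _ fun x => rfl, Fintype.sum_prod_type, Finset.sum_filter]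
  refine Finset.sum_congr rfl fun r _ => ?_
  rw [Finset.mul_sum]
  have hterm : ∀ t : M → Fin T,
      ((∏ m, shockSlot ε (act m) (j m) (e m) ω (E (r, t) m) : ℝ) : ℂ) =
        if (r : ℕ) < i then (ε (((r : ℕ) : ℤ) - j m₀) ω (e m₀) : ℂ) *
          (if ∀ m : M, lo m ≤ (t m : ℕ) then
            ((∏ m : M, ε (((t m : ℕ) : ℤ) - j m) ω (e m) : ℝ) : ℂ) else 0) else 0 := by
    intro t
    rw [← Finset.mul_prod_erase _ _ (Finset.mem_univ m₀), hE₀,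
      ← Finset.prod_coe_sort (Finset.univ.erase m₀)
        (fun m => shockSlot ε (act m) (j m) (e m) ω (E (r, t) m))]
    have h3 : ∏ m : M, shockSlot ε (act m) (j m) (e m) ω (E (r, t) m) =
        if ∀ m : M, lo m ≤ (t m : ℕ) then ∏ m : M, ε (((t m : ℕ) : ℤ) - j m) ω (e m) else 0 := by
      have h4 : ∀ m : M, shockSlot ε (act m) (j m) (e m) ω (E (r, t) m) =
          if lo m ≤ (t m : ℕ) then ε (((t m : ℕ) : ℤ) - j m) ω (e m) else 0 := by
        intro m
        rw [hE₁]
        simp only [shockSlot, hact m ((hM m).1 m.2)]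
      rw [Finset.prod_congr rfl fun m _ => h4 m, Finset.prod_ite_zero]
      simp
    rw [h3]
    simp only [shockSlot, hact₀]
    split_ifs <;> simp
  have hext : ∀ t : M → Fin T, (fun m => ((E (r, t) m : ℕ) : ℤ)) =
      extendTimes M (fun _ => r) t := by
    intro t
    ext m
    by_cases h : m ∈ M
    · simp [E, extendTimes, h]
    · simp [E, extendTimes, h]
  simp_rw [hterm, hext]
  by_cases hr : (r : ℕ) < i
  · simp only [if_pos hr]
    refine Finset.sum_congr rfl fun t _ => ?_
    rw [truncKernel]
    split_ifs <;> ring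
  · simp [if_neg hr]

end ShockSlots

section ShockSlotMoments

variable {Ω : Type*} [MeasurableSpace Ω] {P : Measure Ω} {d k T : ℕ}
  {ε : ℤ → Ω → Fin d → ℝ}

lemma IsStructuralShock.measurable_shockSlot (hε : IsStructuralShock P ε) (act : ℕ → Prop) (j : ℤ)
    (e : Fin d) (t : Fin T) : Measurable fun ω => shockSlot ε act j e ω t := by
  unfold shockSlot
  split_ifs
  · exact hε.measurable_comp _ _
  · exact measurable_const

lemma IsStructuralShock.measurable_spectralForm (hε : IsStructuralShock P ε)
    (w : (Fin k → Fin T) → ℝ) (act : Fin k → ℕ → Prop) (j : Fin k → ℤ) (e : Fin k → Fin d) :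
    Measurable fun ω => spectralForm w fun m => shockSlot ε (act m) (j m) (e m) ω := by
  refine Finset.measurable_fun_sum _ fun t _ => Measurable.const_mul ?_ _
  exact Complex.measurable_ofReal.comp
    (Finset.measurable_fun_prod _ fun m _ => hε.measurable_shockSlot _ _ _ _)

/-- The Cauchy–Schwarz inequality. -/
lemma lintegral_mul_le_of_lintegral_sq_le {f g : Ω → ENNReal} (hf : AEMeasurable f P)
    (hg : AEMeasurable g P) {a b : ℝ} (ha : 0 ≤ a) (hb : 0 ≤ b)
    (hfa : ∫⁻ ω, f ω ^ 2 ∂P ≤ ENNReal.ofReal (a ^ 2))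
    (hgb : ∫⁻ ω, g ω ^ 2 ∂P ≤ ENNReal.ofReal (b ^ 2)) :
    ∫⁻ ω, f ω * g ω ∂P ≤ ENNReal.ofReal (a * b) := by
  have hroot : ∀ {u : ENNReal} {c : ℝ}, 0 ≤ c → u ≤ ENNReal.ofReal (c ^ 2) →
      u ^ (1 / 2 : ℝ) ≤ ENNReal.ofReal c := by
    intro u c hc hu
    refine (ENNReal.rpow_le_rpow hu (by norm_num)).trans (le_of_eq ?_)
    rw [ENNReal.ofReal_rpow_of_nonneg (by positivity) (by norm_num), ← Real.sqrt_eq_rpow,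
      Real.sqrt_sq hc]
  have h := ENNReal.lintegral_mul_le_Lp_mul_Lq P
    (Real.HolderConjugate.two_two) hf hg
  simp only [Pi.mul_apply, ENNReal.rpow_two] at h
  rw [ENNReal.ofReal_mul ha]
  exact h.trans (mul_le_mul' (hroot ha hfa) (hroot hb hgb))

/-- The constant in the first-moment bounds for the forms in shocks. -/
def slotConst (P : Measure Ω) (ε : ℤ → Ω → Fin d → ℝ) (k : ℕ) (C : ℝ) : ℝ :=
  √(formConst k (shockMomentBound P ε) * (3 * C + 512 * C ^ 2)) +
    √(formConst (k - 1) (shockMomentBound P ε) * (3 * C + 512 * C ^ 2))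

lemma slotConst_nonneg (k : ℕ) (C : ℝ) : 0 ≤ slotConst P ε k C := by
  unfold slotConst
  positivity

/-- A form in lagged shocks times a variable of order `T^{-1/2}` in mean square. -/
lemma IsStructuralShock.lintegral_mul_spectralForm_le (hε : IsStructuralShock P ε) (hk4 : k ≤ 4)
    (hT : 1 ≤ T) {C : ℝ} (hC : 0 ≤ C) {w : (Fin k → Fin T) → ℝ} (hw : WeightBound w C)
    {act : Fin k → ℕ → Prop} {lo : Fin k → ℕ} (hact : ∀ m n, act m n ↔ lo m ≤ n) (j : Fin k → ℤ)
    (e : Fin k → Fin d) {ℓ : ℕ} (hℓ : 1 ≤ ℓ) (hj : ∀ m, (j m).natAbs ≤ ℓ) (hlo : ∀ m, lo m ≤ ℓ)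
    {D : Ω → ENNReal} (hD : AEMeasurable D P) {b : ℝ} (hb : 0 ≤ b)
    (hDb : ∫⁻ ω, D ω ^ 2 ∂P ≤ ENNReal.ofReal ((b / √T) ^ 2)) :
    ∫⁻ ω, D ω * ‖spectralForm w fun m => shockSlot ε (act m) (j m) (e m) ω‖ₑ ∂P ≤
      ENNReal.ofReal (b * slotConst P ε k C * ℓ ^ 2 / √T) := by
  have hF := formConst_nonneg k (zero_le_one.trans (one_le_shockMomentBound (P := P) (ε := ε)))
  set F := formConst k (shockMomentBound P ε) * (3 * C + 512 * C ^ 2) with hFdef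
  have h1 := lintegral_mul_le_of_lintegral_sq_le hD
    (hε.measurable_spectralForm w act j e).enorm.aemeasurable (by positivity : 0 ≤ b / √T)
    (by positivity : 0 ≤ √F * ℓ) hDb (by
      simp_rw [spectralForm_shockSlot_eq_shockForm w (fun _ => ⟨0, hT⟩) hact j e]
      refine (hε.lintegral_shockForm_sq_le hk4 hT hC hw Finset.univ (by simp) _ _ _ _ hℓ
        (fun m => hj m) (fun m => hlo m)).trans (ENNReal.ofReal_le_ofReal (le_of_eq ?_))
      rw [Finset.card_univ, Fintype.card_fin, Nat.sub_self, pow_zero, div_one, mul_pow,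
        Real.sq_sqrt (by positivity)])
  refine h1.trans (ENNReal.ofReal_le_ofReal ?_)
  have h2 : √F ≤ slotConst P ε k C := le_add_of_nonneg_right (Real.sqrt_nonneg _)
  have h3 : (ℓ : ℝ) ≤ ℓ ^ 2 := by
    have : (1 : ℝ) ≤ ℓ := by exact_mod_cast hℓ
    nlinarith
  calc b / √T * (√F * ℓ) ≤ b / √T * (slotConst P ε k C * ℓ ^ 2) := by
        gcongr
        exact slotConst_nonneg k C
    _ = _ := by ring

/-- A form in lagged shocks with one slot active only at the first few times. -/
lemma IsStructuralShock.lintegral_spectralForm_short_le (hε : IsStructuralShock P ε) (hk4 : k ≤ 4)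
    (hT : 1 ≤ T) {C : ℝ} (hC : 0 ≤ C) {w : (Fin k → Fin T) → ℝ} (hw : WeightBound w C)
    (m₀ : Fin k) {i : ℕ} {act : Fin k → ℕ → Prop} {lo : Fin k → ℕ}
    (hact₀ : ∀ n, act m₀ n ↔ n < i) (hact : ∀ m, m ≠ m₀ → ∀ n, act m n ↔ lo m ≤ n)
    (j : Fin k → ℤ) (e : Fin k → Fin d) {ℓ : ℕ} (hℓ : 1 ≤ ℓ) (hj : ∀ m, (j m).natAbs ≤ ℓ)
    (hlo : ∀ m, lo m ≤ ℓ) (hi : i ≤ ℓ) :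
    ∫⁻ ω, ‖spectralForm w fun m => shockSlot ε (act m) (j m) (e m) ω‖ₑ ∂P ≤
      ENNReal.ofReal (slotConst P ε k C * ℓ ^ 2 / √T) := by
  have := hε.indep.isProbabilityMeasure
  have hk1 : 1 ≤ k := m₀.pos
  have hF := formConst_nonneg (k - 1)
    (zero_le_one.trans (one_le_shockMomentBound (P := P) (ε := ε)))
  set F := formConst (k - 1) (shockMomentBound P ε) * (3 * C + 512 * C ^ 2) with hFdef
  have hcard : (Finset.univ.erase m₀).card = k - 1 := by
    rw [Finset.card_erase_of_mem (Finset.mem_univ _), Finset.card_univ, Fintype.card_fin]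
  have hmeas : ∀ (t : ℤ) (a : Fin d), Measurable fun ω => (ε t ω a : ℂ) := fun t a =>
    Complex.measurable_ofReal.comp (hε.measurable_comp t a)
  -- At a frozen time the form in the other slots is of order `T^{-1/2}` in mean square.
  have hr : ∀ r : Fin T, ∫⁻ ω, ‖(ε (((r : ℕ) : ℤ) - j m₀) ω (e m₀) : ℂ) *
      shockForm ε w (Finset.univ.erase m₀) (fun _ => r) (fun m => j m) (fun m => e m)
        (fun m => lo m) ω‖ₑ ∂P ≤ ENNReal.ofReal (1 * (√F * ℓ / √T)) := by
    intro r
    simp_rw [enorm_mul]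
    refine lintegral_mul_le_of_lintegral_sq_le
      (hmeas _ _).enorm.aemeasurable
      (hε.measurable_shockForm _ _ _ _ _ _).enorm.aemeasurable zero_le_one (by positivity) ?_ ?_
    · have hL : MemLp (fun ω => ε (((r : ℕ) : ℤ) - j m₀) ω (e m₀)) 2 P :=
        (hε.memLp_comp _ _).mono_exponent (by norm_num)
      have h := hε.cov (((r : ℕ) : ℤ) - j m₀) (e m₀) (e m₀)
      simp only [← pow_two, if_true] at h
      rw [one_pow, ← h, ofReal_integral_eq_lintegral_ofReal hL.integrable_sq
        (Eventually.of_forall fun _ => sq_nonneg _)]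
      refine le_of_eq (lintegral_congr fun ω => ?_)
      rw [← ofReal_norm, Complex.norm_real, ← ENNReal.ofReal_pow (norm_nonneg _), Real.norm_eq_abs,
        sq_abs]
    · refine (hε.lintegral_shockForm_sq_le hk4 hT hC hw (Finset.univ.erase m₀) (by omega) _ _ _ _
        hℓ (fun m => hj m) (fun m => hlo m)).trans (ENNReal.ofReal_le_ofReal (le_of_eq ?_))
      rw [hcard, show k - (k - 1) = 1 by omega, pow_one, div_pow, mul_pow,
        Real.sq_sqrt (by positivity), Real.sq_sqrt (by positivity)]
  simp_rw [spectralForm_shockSlot_eq_sum w m₀ hact₀ hact j e]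
  calc _ ≤ ∫⁻ ω, ∑ r ∈ Finset.univ.filter fun r : Fin T => (r : ℕ) < i, ‖(ε (((r : ℕ) : ℤ) - j m₀) ω (e m₀) : ℂ) *
        shockForm ε w (Finset.univ.erase m₀) (fun _ => r) (fun m => j m) (fun m => e m)
          (fun m => lo m) ω‖ₑ ∂P := lintegral_mono fun ω => enorm_sum_le _ _
    _ ≤ ∑ r ∈ Finset.univ.filter fun r : Fin T => (r : ℕ) < i, ENNReal.ofReal (1 * (√F * ℓ / √T)) := by
        rw [lintegral_finsetSum]
        swap
        · exact fun r _ => ((hmeas _ _).mul (hε.measurable_shockForm _ _ _ _ _ _)).enorm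
        exact Finset.sum_le_sum fun r _ => hr r
    _ ≤ ℓ * ENNReal.ofReal (1 * (√F * ℓ / √T)) := by
        rw [Finset.sum_const, nsmul_eq_mul]
        gcongr
        have h1 : (Finset.univ.filter fun r : Fin T => (r : ℕ) < i).card ≤ (Finset.range i).card :=
          Finset.card_le_card_of_injOn (fun r => (r : ℕ)) (fun r hr => by simpa using hr)
            (fun r _ r' _ h => Fin.ext h)
        rw [Finset.card_range] at h1
        exact h1.trans hi
    _ ≤ _ := by
        rw [← ENNReal.ofReal_natCast, ← ENNReal.ofReal_mul (by positivity)]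
        refine ENNReal.ofReal_le_ofReal ?_
        have h2 : √F ≤ slotConst P ε k C := le_add_of_nonneg_left (Real.sqrt_nonneg _)
        calc (ℓ : ℝ) * (1 * (√F * ℓ / √T)) = √F * ℓ ^ 2 / √T := by ring
          _ ≤ _ := by gcongr

end ShockSlotMoments

/-! ### Expansion of errors and residuals in shocks -/

section ShockExpansion

variable {d p q : ℕ}

/-- The indices of the terms in the expansion of a filtered series in shocks: the lag of the filter,
the lag of the moving average, and the components of the series and of the shock. -/
abbrev TermIndex (d : ℕ) : Type := ℕ × ℤ × Fin d × Fin d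

/-- A path `z = ∑_l Ψ_l x_{· - l}` of a two-sided moving average whose geometrically discounted
shocks are summable at every time. -/
structure IsMovingAveragePath (Ψ : ℤ → Matrix (Fin d) (Fin d) ℝ) (ρ : ℝ) (x z : ℤ → Fin d → ℝ) :
    Prop where
  hasSum : ∀ t, HasSum (fun l => (Ψ l).mulVec (x (t - l))) (z t)
  summable : ∀ t, Summable fun i : TermIndex d =>
    ρ ^ i.1 * ρ ^ i.2.1.natAbs * ‖x (t - ((i.1 : ℤ) + i.2.1))‖

variable {Ψ : ℤ → Matrix (Fin d) (Fin d) ℝ} {ρ CΨ : ℝ} {x z : ℤ → Fin d → ℝ}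

/-- Filtering a moving average with the lags in `act`, as one absolutely convergent multiple
series in the shocks. -/
lemma IsMovingAveragePath.hasSum_filter (h : IsMovingAveragePath Ψ ρ x z) (hρ : 0 ≤ ρ)
    (hΨ0 : 0 ≤ CΨ) (hΨ : ∀ l a b, |Ψ l a b| ≤ CΨ * ρ ^ l.natAbs)
    {κ : ℕ → Matrix (Fin d) (Fin d) ℝ} {C : ℝ} (hC : 0 ≤ C) (hκ : ∀ n a b, |κ n a b| ≤ C * ρ ^ n)
    (act : ℕ → Prop) [DecidablePred act] (t : ℤ) (a : Fin d) :
    ∃ v, HasSum (fun i : TermIndex d => κ i.1 a i.2.2.1 * Ψ i.2.1 i.2.2.1 i.2.2.2 *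
        (if act i.1 then x (t - ((i.1 : ℤ) + i.2.1)) i.2.2.2 else 0)) v ∧
      HasSum (fun n => if act n then ((κ n).mulVec (z (t - n))) a else 0) v := by
  set f : TermIndex d → ℝ := fun i => κ i.1 a i.2.2.1 * Ψ i.2.1 i.2.2.1 i.2.2.2 *
    (if act i.1 then x (t - ((i.1 : ℤ) + i.2.1)) i.2.2.2 else 0) with hf
  have hs : Summable f := by
    refine Summable.of_norm_bounded (g := fun i : TermIndex d => C * CΨ *
      (ρ ^ i.1 * ρ ^ i.2.1.natAbs * ‖x (t - ((i.1 : ℤ) + i.2.1))‖)) ((h.summable t).mul_left _)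
      fun i => ?_
    rw [hf, norm_mul, norm_mul]
    have h1 : ‖(if act i.1 then x (t - ((i.1 : ℤ) + i.2.1)) i.2.2.2 else 0)‖ ≤
        ‖x (t - ((i.1 : ℤ) + i.2.1))‖ := by
      split_ifs
      · exact norm_le_pi_norm _ _
      · rw [norm_zero]; exact norm_nonneg _
    calc _ ≤ C * ρ ^ i.1 * (CΨ * ρ ^ i.2.1.natAbs) * ‖x (t - ((i.1 : ℤ) + i.2.1))‖ := by
          refine mul_le_mul (mul_le_mul (hκ _ _ _) (hΨ _ _ _) (norm_nonneg _) (by positivity)) h1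
            (norm_nonneg _) (by positivity)
      _ = _ := by ring
  refine ⟨∑' i, f i, hs.hasSum, hs.hasSum.prod_fiberwise fun n => ?_⟩
  have hn := hs.prod_factor n
  have h1 := hn.hasSum.prod_fiberwise fun l => hasSum_fintype _
  have h2 : HasSum (fun l : ℤ => ∑ be : Fin d × Fin d, f (n, l, be))
      (if act n then ((κ n).mulVec (z (t - n))) a else 0) := by
    by_cases hact : act n
    · rw [if_pos hact]
      have h3 : HasSum (fun l : ℤ => ∑ b, κ n a b * (Ψ l).mulVec (x (t - n - l)) b)
          (((κ n).mulVec (z (t - n))) a) :=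
        hasSum_sum fun b _ => ((Pi.hasSum.1 (h.hasSum (t - n))) b).mul_left _
      refine h3.congr_fun fun l => ?_
      rw [Fintype.sum_prod_type]
      refine Finset.sum_congr rfl fun b _ => ?_
      rw [Matrix.mulVec, dotProduct, Finset.mul_sum]
      refine Finset.sum_congr rfl fun e _ => ?_
      simp only [hf, if_pos hact, sub_sub]
      ring
    · rw [if_neg hact]
      refine hasSum_zero.congr_fun fun l => ?_
      simp [hf, hact]
  rw [← h1.unique h2]
  exact hn.hasSum

lemma IsMovingAveragePath.hasSum_rfError (h : IsMovingAveragePath Ψ ρ x z) (hρ : 0 ≤ ρ)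
    (hΨ0 : 0 ≤ CΨ) (hΨ : ∀ l a b, |Ψ l a b| ≤ CΨ * ρ ^ l.natAbs)
    {θ : Coeff d p q} {C : ℝ} (hC : 0 ≤ C) (hκ : ∀ n a b, |invCoeff θ n a b| ≤ C * ρ ^ n)
    (t : ℤ) (a : Fin d) :
    HasSum (fun n : ℕ => ((invCoeff θ n).mulVec (z (t - n))) a) (rfError θ z t a) := by
  have h1 : ∀ a, Summable fun n : ℕ => ((invCoeff θ n).mulVec (z (t - n))) a := fun a => by
    obtain ⟨v, -, hv⟩ := h.hasSum_filter hρ hΨ0 hΨ hC hκ (fun _ => True) t a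
    simpa using hv.summable
  exact Pi.hasSum.1 (Pi.summable.2 h1).hasSum a

/-- The residuals as filtered series with lags up to the sample time. -/
lemma hasSum_rfResidual (θ : Coeff d p q) (z : ℤ → Fin d → ℝ) {T : ℕ} (t : Fin T) (a : Fin d) :
    HasSum (fun n : ℕ => if n ≤ (t : ℕ) then ((invCoeff θ n).mulVec (z ((t : ℕ) - n))) a else 0)
      (rfResidual θ (sample z T) t a) := by
  have h1 : rfResidual θ (sample z T) t a =
      ∑ n ∈ Finset.range ((t : ℕ) + 1),
        if n ≤ (t : ℕ) then ((invCoeff θ n).mulVec (z ((t : ℕ) - n))) a else 0 := by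
    have h2 : rfResidual θ (sample z T) t a = ∑ s : Fin T, if (s : ℕ) ≤ t then
        ((invCoeff θ ((t : ℕ) - s)).mulVec (z ((s : ℕ) : ℤ))) a else 0 := by
      rw [rfResidual, Finset.sum_apply]
      refine Finset.sum_congr rfl fun s _ => ?_
      simp only [sample, Fin.le_def]
      split_ifs <;> rfl
    rw [h2, Fin.sum_univ_eq_sum_range (fun s => if s ≤ (t : ℕ) then
      ((invCoeff θ ((t : ℕ) - s)).mulVec (z (s : ℤ))) a else 0) T, ← Finset.sum_filter]
    have h3 : (Finset.range T).filter (fun s => s ≤ (t : ℕ)) = Finset.range ((t : ℕ) + 1) := by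
      ext s
      simp only [Finset.mem_filter, Finset.mem_range]
      have := t.2
      omega
    rw [h3, ← Finset.sum_range_reflect]
    refine Finset.sum_congr rfl fun n hn => ?_
    have hn' : n ≤ (t : ℕ) := by simpa [Nat.lt_succ_iff] using hn
    rw [if_pos hn', show (t : ℕ) + 1 - 1 - n = t - n by omega,
      show (t : ℕ) - (t - n) = n by omega, Nat.cast_sub hn']
  rw [h1]
  refine hasSum_sum_of_ne_finset_zero fun n hn => if_neg fun h => hn ?_
  simpa [Nat.lt_succ_iff] using h

/-- The bound `G ρ^i ρ^{|l|}` on the coefficients in the expansion of a filtered series. -/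
def termBound (G ρ : ℝ) (i : TermIndex d) : ℝ := G * (ρ ^ i.1 * ρ ^ i.2.1.natAbs)

end ShockExpansion

section Telescoping

variable {Ω : Type*} {d p q k T : ℕ} {ε : ℤ → Ω → Fin d → ℝ}
  {Ψ : ℤ → Matrix (Fin d) (Fin d) ℝ} {ρ CΨ : ℝ} {z : ℤ → Fin d → ℝ}

/-- The active times in the telescoped forms with a difference of filters in slot `m₀`: the slots up
to `m₀` carry filters truncated to the sample, the later ones full filters. -/
def longActive (m₀ : Fin k) (i : Fin k → TermIndex d) (m : Fin k) (n : ℕ) : Prop :=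
  (if m ≤ m₀ then (i m).1 else 0) ≤ n

/-- The active times in the telescoped forms with the pre-sample part of a filter in slot `m₀`. -/
def shortActive (m₀ : Fin k) (i : Fin k → TermIndex d) (m : Fin k) (n : ℕ) : Prop :=
  if m = m₀ then n < (i m).1 else (if m < m₀ then (i m).1 else 0) ≤ n

/-- The form in the shocks that the terms `i` of the slots select. -/
def termForm (ε : ℤ → Ω → Fin d → ℝ) (w : (Fin k → Fin T) → ℝ) (act : Fin k → ℕ → Prop)
    (i : Fin k → TermIndex d) (ω : Ω) : ℂ :=
  spectralForm w fun m => shockSlot ε (act m) ((i m).1 + (i m).2.1) (i m).2.2.2 ω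

/-- The difference of the forms in the reduced-form errors and in the residuals, bounded termwise by
forms in lagged shocks. A slot with the difference of the filters is small with the estimation
error `D`, a slot with the pre-sample part of the filter is active at the first few times only. -/
theorem enorm_spectralForm_rfError_sub_rfResidual_le {ω : Ω}
    (h : IsMovingAveragePath Ψ ρ (fun t => ε t ω) z) (hρ : 0 ≤ ρ)
    (hΨ0 : 0 ≤ CΨ) (hΨ : ∀ l a b, |Ψ l a b| ≤ CΨ * ρ ^ l.natAbs) {θ θ' : Coeff d p q} {C D : ℝ}
    (hC : 0 ≤ C) (hD : 0 ≤ D) (hκ : ∀ n a b, |invCoeff θ n a b| ≤ C * ρ ^ n)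
    (hκ' : ∀ n a b, |invCoeff θ' n a b| ≤ C * ρ ^ n)
    (hκD : ∀ n a b, |invCoeff θ n a b - invCoeff θ' n a b| ≤ C * D * ρ ^ n)
    (w : (Fin k → Fin T) → ℝ) (c : Fin k → Fin d) :
    ‖spectralForm w (fun m t => sample (rfError θ z) T t (c m)) -
        spectralForm w (fun m t => rfResidual θ' (sample z T) t (c m))‖ₑ ≤
      ∑ m₀, ((∑' i : Fin k → TermIndex d, (∏ m, ENNReal.ofReal (termBound (C * CΨ) ρ (i m))) *
          (ENNReal.ofReal D * ‖termForm ε w (longActive m₀ i) i ω‖ₑ)) +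
        ∑' i : Fin k → TermIndex d, (∏ m, ENNReal.ofReal (termBound (C * CΨ) ρ (i m))) *
          ‖termForm ε w (shortActive m₀ i) i ω‖ₑ) := by
  classical
  let κ : ℕ → Matrix (Fin d) (Fin d) ℝ := fun n => invCoeff θ n - invCoeff θ' n
  -- `G` is the difference of the filters on the lags within the sample, `G'` the pre-sample part of
  -- the filter of the errors, `U` the errors and `V` the residuals, so that `U - V = G + G'`.
  choose G hG hGn using fun (m : Fin k) (t : Fin T) => h.hasSum_filter hρ hΨ0 hΨ (κ := κ)
    (mul_nonneg hC hD) hκD (fun n => n ≤ (t : ℕ)) ((t : ℕ) : ℤ) (c m)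
  choose G' hG' hGn' using fun (m : Fin k) (t : Fin T) => h.hasSum_filter hρ hΨ0 hΨ hC hκ
    (fun n => (t : ℕ) < n) ((t : ℕ) : ℤ) (c m)
  choose U hU hUn using fun (m : Fin k) (t : Fin T) => h.hasSum_filter hρ hΨ0 hΨ hC hκ
    (fun n => 0 ≤ (t : ℕ)) ((t : ℕ) : ℤ) (c m)
  choose V hV hVn using fun (m : Fin k) (t : Fin T) => h.hasSum_filter hρ hΨ0 hΨ hC hκ'
    (fun n => n ≤ (t : ℕ)) ((t : ℕ) : ℤ) (c m)
  have hUe : (fun m t => sample (rfError θ z) T t (c m)) = U := by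
    ext m t
    refine (h.hasSum_rfError hρ hΨ0 hΨ hC hκ _ _).unique ?_
    simpa using hUn m t
  have hVe : (fun m t => rfResidual θ' (sample z T) t (c m)) = V := by
    ext m t
    exact (hasSum_rfResidual θ' z t (c m)).unique (hVn m t)
  have hUV : ∀ m t, U m t - V m t = G m t + G' m t := by
    intro m t
    refine ((hUn m t).sub (hVn m t)).unique (((hGn m t).add (hGn' m t)).congr_fun fun n => ?_)
    simp only [κ, Matrix.sub_mulVec, Pi.sub_apply, zero_le, if_true]
    by_cases hn : n ≤ (t : ℕ)
    · simp [hn, hn.not_gt]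
    · simp [hn, not_le.1 hn]
  rw [hUe, hVe, spectralForm_sub_eq_sum w hUV]
  refine (enorm_sum_le _ _).trans (Finset.sum_le_sum fun m₀ _ => (enorm_add_le _ _).trans
    (add_le_add ?_ ?_))
  · have h1 := enorm_spectralForm_le_tsum_mul w
      (x := fun m => if m = m₀ then G m else if m < m₀ then V m else U m)
      (c := fun m (i : TermIndex d) =>
        (if m = m₀ then κ i.1 else if m < m₀ then invCoeff θ' i.1 else invCoeff θ i.1) (c m) i.2.2.1 *
          Ψ i.2.1 i.2.2.1 i.2.2.2)
      (S := fun m (i : TermIndex d) => shockSlot ε (fun n => (if m ≤ m₀ then i.1 else 0) ≤ n)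
        (i.1 + i.2.1) i.2.2.2 ω)
      (D := fun m => if m = m₀ then D else 1) (p := termBound (C * CΨ) ρ) (fun m t => ?_)
      (fun m => by split_ifs <;> [exact hD; exact zero_le_one]) (fun m i => ?_)
    · rw [Finset.prod_ite_eq' Finset.univ m₀ fun _ => D, if_pos (Finset.mem_univ _)] at h1
      exact h1
    · rcases lt_trichotomy m m₀ with hm | hm | hm
      · simp only [hm.ne, hm, hm.le, if_true, if_false]
        exact (hV m t).congr_fun fun i => by unfold shockSlot; congr
      · simp only [hm, le_refl, if_true]
        exact (hG m₀ t).congr_fun fun i => by unfold shockSlot; congr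
      · simp only [hm.ne', hm.not_gt, hm.not_ge, if_false]
        exact (hU m t).congr_fun fun i => by unfold shockSlot; congr
    · have hb : ∀ {A : ℝ}, |(if m = m₀ then κ i.1 else if m < m₀ then invCoeff θ' i.1
          else invCoeff θ i.1) (c m) i.2.2.1| ≤ C * A * ρ ^ i.1 → 0 ≤ A →
          |(if m = m₀ then κ i.1 else if m < m₀ then invCoeff θ' i.1
          else invCoeff θ i.1) (c m) i.2.2.1 * Ψ i.2.1 i.2.2.1 i.2.2.2| ≤
            A * termBound (C * CΨ) ρ i := by
        intro A hA hA0
        rw [abs_mul]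
        refine (mul_le_mul hA (hΨ _ _ _) (abs_nonneg _) (by positivity)).trans (le_of_eq ?_)
        unfold termBound
        ring
      split_ifs with h1 h2
      · subst h1
        simp only [if_true] at hb
        exact hb (hκD _ _ _) hD
      · simp only [h1, h2, if_true, if_false] at hb
        exact hb (by simpa using hκ' _ _ _) zero_le_one
      · simp only [h1, h2, if_false] at hb
        exact hb (by simpa using hκ _ _ _) zero_le_one
  · have h1 := enorm_spectralForm_le_tsum_mul w
      (x := fun m => if m = m₀ then G' m else if m < m₀ then V m else U m)
      (c := fun m (i : TermIndex d) =>
        (if m < m₀ then invCoeff θ' i.1 else invCoeff θ i.1) (c m) i.2.2.1 *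
          Ψ i.2.1 i.2.2.1 i.2.2.2)
      (S := fun m (i : TermIndex d) => shockSlot ε (fun n => if m = m₀ then n < i.1 else
        (if m < m₀ then i.1 else 0) ≤ n) (i.1 + i.2.1) i.2.2.2 ω)
      (D := fun _ => 1) (p := termBound (C * CΨ) ρ) (fun m t => ?_)
      (fun m => zero_le_one) (fun m i => ?_)
    · simp only [Finset.prod_const_one, ENNReal.ofReal_one, one_mul] at h1
      exact h1
    · rcases lt_trichotomy m m₀ with hm | hm | hm
      · simp only [hm.ne, hm, if_true, if_false]
        exact (hV m t).congr_fun fun i => by unfold shockSlot; congr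
      · simp only [hm, lt_irrefl, if_true, if_false]
        exact (hG' m₀ t).congr_fun fun i => by unfold shockSlot; congr
      · simp only [hm.ne', hm.not_gt, if_false]
        exact (hU m t).congr_fun fun i => by unfold shockSlot; congr
    · rw [abs_mul, one_mul]
      have hb : |(if m < m₀ then invCoeff θ' i.1 else invCoeff θ i.1) (c m) i.2.2.1| ≤
          C * ρ ^ i.1 := by
        split_ifs
        · exact hκ' _ _ _
        · exact hκ _ _ _
      refine (mul_le_mul hb (hΨ _ _ _) (abs_nonneg _) (by positivity)).trans (le_of_eq ?_)
      unfold termBound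
      ring

end Telescoping

/-! ### Summation over the lags -/

section LagSums

variable {d : ℕ}

/-- A bound on the lags and truncation times in a term of the expansion. As it is at least one, its
product over the slots bounds each of them, and that product factorizes in sums over all terms. -/
def lagSize (i : TermIndex d) : ℕ := (1 + i.1) * (1 + i.2.1.natAbs)

lemma one_le_lagSize (i : TermIndex d) : 1 ≤ lagSize i :=
  Nat.one_le_iff_ne_zero.2 (by unfold lagSize; positivity)

lemma fst_le_lagSize (i : TermIndex d) : i.1 ≤ lagSize i := by
  calc i.1 ≤ (1 + i.1) * 1 := by omega
    _ ≤ _ := Nat.mul_le_mul_left _ (by omega)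

lemma natAbs_lag_le_lagSize (i : TermIndex d) : ((i.1 : ℤ) + i.2.1).natAbs ≤ lagSize i := by
  have h1 : ((i.1 : ℤ) + i.2.1).natAbs ≤ i.1 + i.2.1.natAbs := by omega
  refine h1.trans ?_
  unfold lagSize
  nlinarith [Nat.zero_le (i.1 * i.2.1.natAbs)]

lemma summable_termIndex {f : ℕ → ℝ} (hf0 : ∀ n, 0 ≤ f n) (hf : Summable f) :
    Summable fun i : TermIndex d => f i.1 * f i.2.1.natAbs := by
  have h1 : Summable fun l : ℤ => f l.natAbs := by
    refine Summable.of_nat_of_neg ?_ ?_ <;> simpa using hf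
  have h2 : Summable fun x : ℤ × Fin d × Fin d => f x.1.natAbs * (1 : ℝ) :=
    h1.mul_of_nonneg (g := fun _ : Fin d × Fin d => (1 : ℝ)) Summable.of_finite
      (fun _ => hf0 _) (fun _ => zero_le_one)
  simp only [mul_one] at h2
  exact hf.mul_of_nonneg h2 hf0 fun _ => hf0 _

lemma tsum_termBound_mul_lagSize_sq_ne_top {G ρ : ℝ} (h0 : 0 < ρ) (h1 : ρ < 1) :
    ∑' i : TermIndex d, ENNReal.ofReal (termBound G ρ i * (lagSize i : ℝ) ^ 2) ≠ ⊤ := by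
  have hs : Summable fun n : ℕ => (1 + (n : ℝ)) ^ 2 * ρ ^ n := by
    have h2 := (summable_nat_add_iff 1).2 (summable_pow_mul_geometric_of_norm_lt_one 2
      (r := ρ) (by rwa [Real.norm_eq_abs, abs_of_pos h0]))
    refine (h2.mul_left ρ⁻¹).congr fun n => ?_
    push_cast
    field_simp
    ring
  refine (((summable_termIndex (d := d) (fun n => by positivity) hs).mul_left G).congr
    fun i => ?_).tsum_ofReal_ne_top
  unfold termBound lagSize
  push_cast
  ring

/-- The expansions of the slots sum up, also with the squares of the lags as weights. -/
lemma tsum_prod_termBound_mul_le {k : ℕ} {G ρ : ℝ} (hG : 0 ≤ G) (hρ : 0 ≤ ρ)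
    {E : (Fin k → TermIndex d) → ENNReal} {b : ℝ} (hb : 0 ≤ b)
    (hE : ∀ i, E i ≤ ENNReal.ofReal (b * ((∏ m, lagSize (i m) : ℕ) : ℝ) ^ 2)) :
    ∑' i : Fin k → TermIndex d, (∏ m, ENNReal.ofReal (termBound G ρ (i m))) * E i ≤
      ENNReal.ofReal b *
        (∑' i : TermIndex d, ENNReal.ofReal (termBound G ρ i * (lagSize i : ℝ) ^ 2)) ^ k := by
  have htb : ∀ i : TermIndex d, 0 ≤ termBound G ρ i := fun i => by unfold termBound; positivity
  calc _ ≤ ∑' i : Fin k → TermIndex d, ENNReal.ofReal b *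
        ∏ m, ENNReal.ofReal (termBound G ρ (i m) * (lagSize (i m) : ℝ) ^ 2) := by
        refine ENNReal.tsum_le_tsum fun i => (mul_le_mul_right (hE i) _).trans (le_of_eq ?_)
        rw [ENNReal.ofReal_mul hb, mul_left_comm]
        congr 1
        push_cast
        rw [← Finset.prod_pow, ENNReal.ofReal_prod_of_nonneg fun m _ => by positivity,
          ← Finset.prod_mul_distrib]
        exact Finset.prod_congr rfl fun m _ => (ENNReal.ofReal_mul (htb _)).symm
    _ ≤ _ := by
        rw [ENNReal.tsum_mul_left]
        gcongr
        refine (tsum_pi_prod_le fun (_ : Fin k) (i : TermIndex d) =>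
          ENNReal.ofReal (termBound G ρ i * (lagSize i : ℝ) ^ 2)).trans (le_of_eq ?_)
        rw [Finset.prod_const, Finset.card_univ, Fintype.card_fin]

end LagSums

/-! ### The estimation error -/

section Estimator

variable {Ω : Type*} [MeasurableSpace Ω] {P : Measure Ω} {d p q : ℕ}

lemma distSq_nonneg (θ θ' : Coeff d p q) : 0 ≤ distSq θ θ' := by
  unfold distSq
  positivity

lemma continuous_distSq (θ' : Coeff d p q) : Continuous fun θ : Coeff d p q => distSq θ θ' := by
  have h1 : ∀ (j : Fin p) a b, Continuous fun θ : Coeff d p q => θ.1 j a b := fun j a b =>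
    ((continuous_apply j).comp continuous_fst).matrix_elem a b
  have h2 : ∀ (j : Fin q) a b, Continuous fun θ : Coeff d p q => θ.2 j a b := fun j a b =>
    ((continuous_apply j).comp continuous_snd).matrix_elem a b
  unfold distSq
  refine Continuous.add ?_ ?_
  · exact continuous_finsetSum _ fun j _ => continuous_finsetSum _ fun a _ =>
      continuous_finsetSum _ fun b _ => ((h1 j a b).sub continuous_const).pow 2
  · exact continuous_finsetSum _ fun j _ => continuous_finsetSum _ fun a _ =>
      continuous_finsetSum _ fun b _ => ((h2 j a b).sub continuous_const).pow 2

lemma aemeasurable_distSq {θ : Ω → Coeff d p q} (h1 : ∀ j a b, AEMeasurable (fun ω => (θ ω).1 j a b) P)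
    (h2 : ∀ j a b, AEMeasurable (fun ω => (θ ω).2 j a b) P) (θ' : Coeff d p q) :
    AEMeasurable (fun ω => distSq (θ ω) θ') P := by
  unfold distSq
  refine AEMeasurable.add ?_ ?_
  · exact Finset.aemeasurable_fun_sum _ fun j _ => Finset.aemeasurable_fun_sum _ fun a _ =>
      Finset.aemeasurable_fun_sum _ fun b _ => ((h1 j a b).sub_const _).pow_const 2
  · exact Finset.aemeasurable_fun_sum _ fun j _ => Finset.aemeasurable_fun_sum _ fun a _ =>
      Finset.aemeasurable_fun_sum _ fun b _ => ((h2 j a b).sub_const _).pow_const 2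

lemma aemeasurable_invCoeff {θ : Ω → Coeff d p q}
    (h1 : ∀ j a b, AEMeasurable (fun ω => (θ ω).1 j a b) P)
    (h2 : ∀ j a b, AEMeasurable (fun ω => (θ ω).2 j a b) P) (n : ℕ) (a b : Fin d) :
    AEMeasurable (fun ω => invCoeff (θ ω) n a b) P := by
  induction n using Nat.strong_induction_on generalizing a b with
  | _ n ih =>
    have har : AEMeasurable (fun ω => arCoeff (θ ω) n a b) P := by
      cases n with
      | zero => exact aemeasurable_const
      | succ n =>
        simp only [arCoeff]
        split_ifs with h
        · exact (h1 ⟨n, h⟩ a b).neg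
        · exact aemeasurable_const
    have hterm : ∀ i : Fin q, AEMeasurable (fun ω =>
        (if _h : (i : ℕ) + 1 ≤ n then (θ ω).2 i * invCoeff (θ ω) (n - ((i : ℕ) + 1)) else 0 :
          Matrix (Fin d) (Fin d) ℝ) a b) P := by
      intro i
      split_ifs with h
      · simp only [Matrix.mul_apply]
        exact Finset.aemeasurable_fun_sum _ fun e _ => (h2 i a e).mul (ih _ (by omega) e b)
      · exact aemeasurable_const
    have hrec : (fun ω => invCoeff (θ ω) n a b) = fun ω => arCoeff (θ ω) n a b - ∑ i : Fin q,
        (if _h : (i : ℕ) + 1 ≤ n then (θ ω).2 i * invCoeff (θ ω) (n - ((i : ℕ) + 1)) else 0 :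
          Matrix (Fin d) (Fin d) ℝ) a b := by
      ext ω
      rw [invCoeff, Matrix.sub_apply, Matrix.sum_apply]
    rw [hrec]
    exact har.sub (Finset.aemeasurable_fun_sum _ fun i _ => hterm i)

variable {y : ℤ → Ω → Fin d → ℝ} {θf : Coeff d p q} {K : Set (Coeff d p q)}
  {est : (T : ℕ) → (Fin T → Fin d → ℝ) → Coeff d p q}

lemma aemeasurable_sample (hy : ∀ t, AEMeasurable (y t) P) (T : ℕ) :
    AEMeasurable (fun ω => sample (fun t => y t ω) T) P :=
  aemeasurable_pi_lambda _ fun t => hy ((t : ℕ) : ℤ)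

lemma IsRootTEstimator.aemeasurable_ar (hest : IsRootTEstimator P y θf K est)
    (hy : ∀ t, AEMeasurable (y t) P) (T : ℕ) (j : Fin p) (a b : Fin d) :
    AEMeasurable (fun ω => (est T (sample (fun t => y t ω) T)).1 j a b) P :=
  (hest.measurable_ar T j a b).comp_aemeasurable (aemeasurable_sample hy T)

lemma IsRootTEstimator.aemeasurable_ma (hest : IsRootTEstimator P y θf K est)
    (hy : ∀ t, AEMeasurable (y t) P) (T : ℕ) (j : Fin q) (a b : Fin d) :
    AEMeasurable (fun ω => (est T (sample (fun t => y t ω) T)).2 j a b) P :=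
  (hest.measurable_ma T j a b).comp_aemeasurable (aemeasurable_sample hy T)

/-- Root-`T` consistency in mean square as a bound on a Lebesgue integral. The parameter space being
compact, the squared error is bounded, so that the integral in the assumption is a genuine one. -/
lemma IsRootTEstimator.exists_lintegral_distSq_le [IsProbabilityMeasure P]
    (hest : IsRootTEstimator P y θf K est) (hy : ∀ t, AEMeasurable (y t) P) :
    ∃ b : ℝ, 0 ≤ b ∧ ∀ T : ℕ, 1 ≤ T → ∫⁻ ω, ENNReal.ofReal
      (√(distSq (est T (sample (fun t => y t ω) T)) θf)) ^ 2 ∂P ≤ ENNReal.ofReal ((b / √T) ^ 2) := by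
  obtain ⟨M, hM⟩ := hest.rate
  obtain ⟨Q, hQ⟩ := hest.compact.exists_bound_of_continuousOn (continuous_distSq θf).continuousOn
  refine ⟨√(max M 0), Real.sqrt_nonneg _, fun T hT => ?_⟩
  have hm := aemeasurable_distSq (hest.aemeasurable_ar hy T) (hest.aemeasurable_ma hy T) θf
  have hint : Integrable (fun ω => distSq (est T (sample (fun t => y t ω) T)) θf) P :=
    Integrable.of_bound hm.aestronglyMeasurable Q
      (Eventually.of_forall fun ω => hQ _ (hest.mem T _))
  have h1 : ∀ ω, ENNReal.ofReal (√(distSq (est T (sample (fun t => y t ω) T)) θf)) ^ 2 =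
      ENNReal.ofReal (distSq (est T (sample (fun t => y t ω) T)) θf) := fun ω => by
    rw [← ENNReal.ofReal_pow (Real.sqrt_nonneg _), Real.sq_sqrt (distSq_nonneg _ _)]
  simp_rw [h1]
  rw [← ofReal_integral_eq_lintegral_ofReal hint (Eventually.of_forall fun ω => distSq_nonneg _ _)]
  refine ENNReal.ofReal_le_ofReal ((hM T hT).trans ?_)
  rw [div_pow, Real.sq_sqrt (le_max_right _ _), Real.sq_sqrt (Nat.cast_nonneg T)]
  gcongr
  exact le_max_left _ _

end Estimator

/-! ### First moments of the discrepancy -/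

section FirstMoment

variable {Ω : Type*} [MeasurableSpace Ω] {P : Measure Ω} {d p q pf qf k : ℕ}
  {ε y : ℤ → Ω → Fin d → ℝ}

/-- Almost every path of the process is a moving average of the shocks, with a common geometric
rate at least as large as a given one. -/
theorem IsSVARMA.exists_isMovingAveragePath [IsProbabilityMeasure P] {θ₀ : Coeff d p q}
    {B : Matrix (Fin d) (Fin d) ℝ} (hε : IsStructuralShock P ε) (hy : IsSVARMA P θ₀ B ε y)
    {ρ₀ : ℝ} (hρ₀ : ρ₀ < 1) :
    ∃ (Ψ : ℤ → Matrix (Fin d) (Fin d) ℝ) (C ρ : ℝ), 0 ≤ C ∧ 0 < ρ ∧ ρ < 1 ∧ ρ₀ ≤ ρ ∧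
      (∀ l a b, |Ψ l a b| ≤ C * ρ ^ l.natAbs) ∧
      ∀ᵐ ω ∂P, IsMovingAveragePath Ψ ρ (fun t => ε t ω) (fun t => y t ω) := by
  obtain ⟨Ψ, C, ρ, hC, hρ0, hρ1, hΨ, hsum⟩ := hy.exists_movingAverage hε
  have hr0 : 0 < max ρ ρ₀ := lt_max_of_lt_left hρ0
  have hr1 : max ρ ρ₀ < 1 := max_lt hρ1 hρ₀
  refine ⟨Ψ, C, max ρ ρ₀, hC, hr0, hr1, le_max_right _ _, fun l a b => (hΨ l a b).trans ?_, ?_⟩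
  · gcongr
    exact le_max_left _ _
  · have hs := ae_forall_summable_mul_norm
      (ENNReal.mul_ne_top (ENNReal.natCast_ne_top _) ENNReal.ofReal_ne_top)
      (fun t => (hε.measurable t).aemeasurable) hε.lintegral_enorm_le
      (fun i : TermIndex d => by positivity)
      (summable_termIndex (d := d) (fun n => by positivity)
        (summable_geometric_of_lt_one hr0.le hr1)) (fun i => (i.1 : ℤ) + i.2.1)
    filter_upwards [hsum, hs] with ω h1 h2
    exact ⟨h1, h2⟩

/-- The forms in the reduced-form errors and in the residuals differ by `O(T^{-1/2})` in mean,
uniformly over the weights with a common `WeightBound`. -/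
theorem exists_lintegral_spectralForm_sub_le [IsProbabilityMeasure P] (hk4 : k ≤ 4)
    {θ₀ : Coeff d p q} {B : Matrix (Fin d) (Fin d) ℝ} (hε : IsStructuralShock P ε)
    (hy : IsSVARMA P θ₀ B ε y) {θf : Coeff d pf qf} {K : Set (Coeff d pf qf)}
    {est : (T : ℕ) → (Fin T → Fin d → ℝ) → Coeff d pf qf}
    (hest : IsRootTEstimator P y θf K est) {C₀ : ℝ} (hC₀ : 0 ≤ C₀) :
    ∃ C : ℝ, 0 ≤ C ∧ ∀ T : ℕ, 1 ≤ T → ∀ w : (Fin k → Fin T) → ℝ, WeightBound w C₀ →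
      ∀ c : Fin k → Fin d,
        ∫⁻ ω, ‖spectralForm w (fun m t => sample (rfError θf fun s => y s ω) T t (c m)) -
          spectralForm w (fun m t => rfResidual (est T (sample (fun s => y s ω) T))
            (sample (fun s => y s ω) T) t (c m))‖ₑ ∂P ≤ ENNReal.ofReal (C / √T) := by
  obtain ⟨Cπ, ρπ, hCπ, hρπ0, hρπ1, hπ⟩ := exists_invCoeff_bounds hest.compact hest.roots
  obtain ⟨Ψ, CΨ, ρ, hCΨ, hρ0, hρ1, hρ, hΨ, hpath⟩ := hy.exists_isMovingAveragePath hε hρπ1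
  have hym : ∀ t, AEMeasurable (y t) P := fun t => (hy.stationary.memLp t).1.aemeasurable
  obtain ⟨b, hb, hbT⟩ := hest.exists_lintegral_distSq_le hym
  have hπρ : ∀ n : ℕ, ρπ ^ n ≤ ρ ^ n := fun n => pow_le_pow_left₀ hρπ0.le hρ n
  have hκ : ∀ θ ∈ K, ∀ n a b, |invCoeff θ n a b| ≤ Cπ * ρ ^ n := fun θ hθ n a b =>
    ((hπ θ hθ n a b).1).trans (mul_le_mul_of_nonneg_left (hπρ n) hCπ)
  set Z := ∑' i : TermIndex d, ENNReal.ofReal (termBound (Cπ * CΨ) ρ i * (lagSize i : ℝ) ^ 2) with hZ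
  have hZtop : Z ≠ ⊤ := tsum_termBound_mul_lagSize_sq_ne_top hρ0 hρ1
  set σ := slotConst P ε k C₀ with hσ
  have hσ0 : 0 ≤ σ := slotConst_nonneg k C₀
  refine ⟨k * ((b * σ + σ) * Z.toReal ^ k), by positivity, fun T hT w hw c => ?_⟩
  set D : Ω → ℝ := fun ω => √(distSq (est T (sample (fun s => y s ω) T)) θf) with hD
  have hDm : AEMeasurable (fun ω => ENNReal.ofReal (D ω)) P :=
    ((aemeasurable_distSq (hest.aemeasurable_ar hym T) (hest.aemeasurable_ma hym T) θf).sqrt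
      ).ennreal_ofReal
  have hbound : ∀ᵐ ω ∂P,
      ‖spectralForm w (fun m t => sample (rfError θf fun s => y s ω) T t (c m)) -
          spectralForm w (fun m t => rfResidual (est T (sample (fun s => y s ω) T))
            (sample (fun s => y s ω) T) t (c m))‖ₑ ≤
      ∑ m₀, ((∑' i : Fin k → TermIndex d, (∏ m, ENNReal.ofReal (termBound (Cπ * CΨ) ρ (i m))) *
          (ENNReal.ofReal (D ω) * ‖termForm ε w (longActive m₀ i) i ω‖ₑ)) +
        ∑' i : Fin k → TermIndex d, (∏ m, ENNReal.ofReal (termBound (Cπ * CΨ) ρ (i m))) *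
          ‖termForm ε w (shortActive m₀ i) i ω‖ₑ) := by
    filter_upwards [hpath] with ω h
    refine enorm_spectralForm_rfError_sub_rfResidual_le h hρ0.le hCΨ hΨ hCπ (Real.sqrt_nonneg _)
      (hκ _ hest.true_mem) (hκ _ (hest.mem T _)) (fun n a b => ?_) w c
    rw [abs_sub_comm]
    exact ((hπ _ (hest.mem T _) n a b).2 _ hest.true_mem).trans
      (mul_le_mul_of_nonneg_left (hπρ n) (by positivity))
  have hfm : ∀ (act : Fin k → ℕ → Prop) (i : Fin k → TermIndex d),
      Measurable fun ω => ‖termForm ε w act i ω‖ₑ := fun act i =>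
    (hε.measurable_spectralForm w act _ _).enorm
  have hDf : ∀ (act : Fin k → ℕ → Prop) (i : Fin k → TermIndex d),
      AEMeasurable (fun ω => ENNReal.ofReal (D ω) * ‖termForm ε w act i ω‖ₑ) P := fun act i =>
    hDm.mul (hfm act i).aemeasurable
  have hlag : ∀ (i : Fin k → TermIndex d) m, lagSize (i m) ≤ ∏ m, lagSize (i m) := fun i m =>
    Finset.single_le_prod' (fun m _ => one_le_lagSize (i m)) (Finset.mem_univ m)
  have hlag1 : ∀ i : Fin k → TermIndex d, 1 ≤ ∏ m, lagSize (i m) := fun i =>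
    Finset.one_le_prod' fun m _ => one_le_lagSize (i m)
  -- The estimation error is of order `T^{-1/2}` in mean square and the form of order one.
  have hlong : ∀ m₀, ∫⁻ ω, ∑' i : Fin k → TermIndex d,
      (∏ m, ENNReal.ofReal (termBound (Cπ * CΨ) ρ (i m))) *
        (ENNReal.ofReal (D ω) * ‖termForm ε w (longActive m₀ i) i ω‖ₑ) ∂P ≤
      ENNReal.ofReal (b * σ / √T) * Z ^ k := by
    intro m₀
    rw [lintegral_tsum fun i => (hDf _ i).const_mul _]
    simp_rw [lintegral_const_mul'' _ (hDf _ _)]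
    refine tsum_prod_termBound_mul_le (by positivity) hρ0.le (by positivity) fun i => ?_
    refine (hε.lintegral_mul_spectralForm_le hk4 hT hC₀ hw
      (lo := fun m => if m ≤ m₀ then (i m).1 else 0) (fun m n => Iff.rfl) _ _ (hlag1 i)
      (fun m => (natAbs_lag_le_lagSize (i m)).trans (hlag i m)) (fun m => ?_) hDm hb
      (hbT T hT)).trans (ENNReal.ofReal_le_ofReal (le_of_eq (by ring)))
    split_ifs
    · exact (fst_le_lagSize (i m)).trans (hlag i m)
    · exact Nat.zero_le _
  -- The coefficients are bounded uniformly here, and the frozen slot supplies the order `T^{-1/2}`.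
  have hshort : ∀ m₀, ∫⁻ ω, ∑' i : Fin k → TermIndex d,
      (∏ m, ENNReal.ofReal (termBound (Cπ * CΨ) ρ (i m))) *
        ‖termForm ε w (shortActive m₀ i) i ω‖ₑ ∂P ≤ ENNReal.ofReal (σ / √T) * Z ^ k := by
    intro m₀
    rw [lintegral_tsum fun i => (hfm _ i).aemeasurable.const_mul _]
    simp_rw [lintegral_const_mul'' _ (hfm _ _).aemeasurable]
    refine tsum_prod_termBound_mul_le (by positivity) hρ0.le (by positivity) fun i => ?_
    refine (hε.lintegral_spectralForm_short_le hk4 hT hC₀ hw m₀ (i := (i m₀).1)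
      (lo := fun m => if m < m₀ then (i m).1 else 0) (fun n => by simp [shortActive])
      (fun m hm n => by simp [shortActive, hm]) _ _ (hlag1 i)
      (fun m => (natAbs_lag_le_lagSize (i m)).trans (hlag i m)) (fun m => ?_)
      ((fst_le_lagSize (i m₀)).trans (hlag i m₀))).trans
      (ENNReal.ofReal_le_ofReal (le_of_eq (by ring)))
    split_ifs
    · exact (fst_le_lagSize (i m)).trans (hlag i m)
    · exact Nat.zero_le _
  refine (lintegral_mono_ae hbound).trans ?_
  have hlm : ∀ m₀, AEMeasurable (fun ω => ∑' i : Fin k → TermIndex d,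
      (∏ m, ENNReal.ofReal (termBound (Cπ * CΨ) ρ (i m))) *
        (ENNReal.ofReal (D ω) * ‖termForm ε w (longActive m₀ i) i ω‖ₑ)) P := fun m₀ =>
    AEMeasurable.tsum fun i => (hDf _ i).const_mul _
  have hsm : ∀ m₀, AEMeasurable (fun ω => ∑' i : Fin k → TermIndex d,
      (∏ m, ENNReal.ofReal (termBound (Cπ * CΨ) ρ (i m))) *
        ‖termForm ε w (shortActive m₀ i) i ω‖ₑ) P := fun m₀ =>
    AEMeasurable.tsum fun i => (hfm _ i).aemeasurable.const_mul _
  rw [lintegral_finsetSum']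
  swap
  · exact fun m₀ _ => (hlm m₀).add (hsm m₀)
  calc _ ≤ ∑ _m₀ : Fin k, (ENNReal.ofReal (b * σ / √T) * Z ^ k +
        ENNReal.ofReal (σ / √T) * Z ^ k) := by
        refine Finset.sum_le_sum fun m₀ _ => ?_
        rw [lintegral_add_left' (hlm m₀)]
        exact add_le_add (hlong m₀) (hshort m₀)
    _ = _ := by
        rw [Finset.sum_const, Finset.card_univ, Fintype.card_fin, nsmul_eq_mul, ← add_mul,
          ← ENNReal.ofReal_add (by positivity) (by positivity), ← ENNReal.ofReal_toReal hZtop,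
          ← ENNReal.ofReal_pow ENNReal.toReal_nonneg, ← ENNReal.ofReal_mul (by positivity),
          ← ENNReal.ofReal_natCast, ← ENNReal.ofReal_mul (by positivity),
          ENNReal.toReal_ofReal ENNReal.toReal_nonneg]
        congr 1
        ring

lemma aemeasurable_spectralForm {T : ℕ} (w : (Fin k → Fin T) → ℝ) {X : Fin k → Fin T → Ω → ℝ}
    (hX : ∀ m t, AEMeasurable (X m t) P) :
    AEMeasurable (fun ω => spectralForm w fun m t => X m t ω) P := by
  refine Finset.aemeasurable_fun_sum _ fun t _ => AEMeasurable.const_mul ?_ _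
  exact Complex.measurable_ofReal.comp_aemeasurable
    (Finset.aemeasurable_fun_prod _ fun m _ => hX m (t m))

/-- The bound on the discrepancy of the spectrum estimators for index sets and frequencies whose
weights have a common `WeightBound`. -/
theorem exists_integral_discrepancy_le [IsProbabilityMeasure P] (hk1 : 1 ≤ k) (hk4 : k ≤ 4)
    {θ₀ : Coeff d p q} {B : Matrix (Fin d) (Fin d) ℝ} (hε : IsStructuralShock P ε)
    (hy : IsSVARMA P θ₀ B ε y) {θf : Coeff d pf qf} {K : Set (Coeff d pf qf)}
    {est : (T : ℕ) → (Fin T → Fin d → ℝ) → Coeff d pf qf}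
    (hest : IsRootTEstimator P y θf K est) {C₀ : ℝ} (hC₀ : 0 ≤ C₀) :
    ∃ C : ℝ, 0 ≤ C ∧ ∀ T : ℕ, 1 ≤ T → ∀ (A : Finset (Fin k → Fin T)) (W : (Fin k → ℝ) → ℝ) (h : ℝ),
      0 < h → ∀ lam : Fin k → ℝ, WeightBound (spectralWeight A W h lam) C₀ → ∀ c : Fin k → Fin d,
      Integrable (fun ω => discrepancy T A W h c lam θf
        (est T (sample (fun t => y t ω) T)) (fun t => y t ω)) P ∧
      ∫ ω, discrepancy T A W h c lam θf
        (est T (sample (fun t => y t ω) T)) (fun t => y t ω) ∂P ≤ C * h ^ (((k : ℝ) - 1) / 2) := by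
  obtain ⟨C, hC, hCT⟩ := exists_lintegral_spectralForm_sub_le hk4 hε hy hest hC₀
  obtain ⟨Cπ, ρπ, hCπ, hρπ0, hρπ1, hπ⟩ := exists_invCoeff_bounds hest.compact hest.roots
  obtain ⟨Ψ, CΨ, ρ, hCΨ, hρ0, hρ1, hρ, hΨ, hpath⟩ := hy.exists_isMovingAveragePath hε hρπ1
  have hym : ∀ t, AEMeasurable (y t) P := fun t => (hy.stationary.memLp t).1.aemeasurable
  refine ⟨C, hC, fun T hT A W h hh lam hw c => ?_⟩
  have hT0 : (0 : ℝ) < T := by exact_mod_cast hT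
  -- The errors are measurable as almost sure limits: the series in their definition is known to
  -- converge almost surely only.
  have hu : ∀ (t : ℤ) (a : Fin d), AEMeasurable (fun ω => rfError θf (fun s => y s ω) t a) P := by
    intro t a
    refine aemeasurable_of_tendsto_metrizable_ae atTop (f := fun (N : ℕ) ω =>
      ∑ n ∈ Finset.range N, ((invCoeff θf n).mulVec (y (t - n) ω)) a) (fun N => ?_) ?_
    · refine Finset.aemeasurable_fun_sum _ fun n _ => ?_
      simp only [Matrix.mulVec, dotProduct]
      exact Finset.aemeasurable_fun_sum _ fun b _ =>
        ((measurable_pi_apply b).comp_aemeasurable (hym _)).const_mul _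
    · filter_upwards [hpath] with ω h
      exact (h.hasSum_rfError hρ0.le hCΨ hΨ hCπ (fun n a b => ((hπ _ hest.true_mem n a b).1).trans
        (mul_le_mul_of_nonneg_left (pow_le_pow_left₀ hρπ0.le hρ n) hCπ)) t a).tendsto_sum_nat
  have hv : ∀ (t : Fin T) (a : Fin d), AEMeasurable (fun ω =>
      rfResidual (est T (sample (fun s => y s ω) T)) (sample (fun s => y s ω) T) t a) P := by
    intro t a
    simp only [rfResidual, Finset.sum_apply]
    refine Finset.aemeasurable_fun_sum _ fun s _ => ?_
    split_ifs
    · simp only [Matrix.mulVec, dotProduct]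
      exact Finset.aemeasurable_fun_sum _ fun b _ =>
        (aemeasurable_invCoeff (hest.aemeasurable_ar hym T) (hest.aemeasurable_ma hym T) _ a b).mul
          ((measurable_pi_apply b).comp_aemeasurable (hym _))
    · exact aemeasurable_const
  have hdisc : ∀ ω, discrepancy T A W h c lam θf (est T (sample (fun t => y t ω) T))
      (fun t => y t ω) = √(h ^ (k - 1) * T) *
        ‖spectralForm (spectralWeight A W h lam)
            (fun m t => sample (rfError θf fun s => y s ω) T t (c m)) -
          spectralForm (spectralWeight A W h lam)
            (fun m t => rfResidual (est T (sample (fun s => y s ω) T))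
              (sample (fun s => y s ω) T) t (c m))‖ := fun ω => by
    rw [discrepancy, specEst_eq_spectralForm hk1, specEst_eq_spectralForm hk1]
  simp_rw [hdisc]
  have hm : AEStronglyMeasurable (fun ω => √(h ^ (k - 1) * T) *
        ‖spectralForm (spectralWeight A W h lam)
            (fun m t => sample (rfError θf fun s => y s ω) T t (c m)) -
          spectralForm (spectralWeight A W h lam)
            (fun m t => rfResidual (est T (sample (fun s => y s ω) T))
              (sample (fun s => y s ω) T) t (c m))‖) P :=
    (((aemeasurable_spectralForm _ fun m t => hu _ _).sub
      (aemeasurable_spectralForm _ fun m t => hv _ _)).norm.const_mul _).aestronglyMeasurable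
  have hlint : ∫⁻ ω, ENNReal.ofReal (√(h ^ (k - 1) * T) *
        ‖spectralForm (spectralWeight A W h lam)
            (fun m t => sample (rfError θf fun s => y s ω) T t (c m)) -
          spectralForm (spectralWeight A W h lam)
            (fun m t => rfResidual (est T (sample (fun s => y s ω) T))
              (sample (fun s => y s ω) T) t (c m))‖) ∂P ≤
      ENNReal.ofReal (C * h ^ (((k : ℝ) - 1) / 2)) := by
    simp_rw [ENNReal.ofReal_mul (Real.sqrt_nonneg _), ofReal_norm]
    rw [lintegral_const_mul' _ _ ENNReal.ofReal_ne_top]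
    refine (mul_le_mul_right (hCT T hT _ hw c) _).trans (le_of_eq ?_)
    rw [← ENNReal.ofReal_mul (Real.sqrt_nonneg _)]
    congr 1
    have h1 : √(h ^ (k - 1)) = h ^ (((k : ℝ) - 1) / 2) := by
      rw [Real.sqrt_eq_rpow, ← Real.rpow_natCast, ← Real.rpow_mul hh.le, Nat.cast_sub hk1]
      congr 1
      push_cast
      ring
    have h2 : √(T : ℝ) ≠ 0 := (Real.sqrt_pos.2 hT0).ne'
    rw [Real.sqrt_mul (by positivity), h1]
    field_simp
  refine ⟨⟨hm, ?_⟩, ?_⟩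
  · rw [hasFiniteIntegral_iff_ofReal (Eventually.of_forall fun ω => by positivity)]
    exact hlint.trans_lt ENNReal.ofReal_lt_top
  · rw [integral_eq_lintegral_of_nonneg_ae (Eventually.of_forall fun ω => by positivity) hm]
    exact ENNReal.toReal_le_of_le_ofReal (by positivity) hlint

end FirstMoment

end SVARMA

end

theorem proposition3 {Ω : Type*} [MeasurableSpace Ω] (P : Measure Ω) [IsProbabilityMeasure P]
    {d p q pf qf k : ℕ} (hk : k = 3 ∨ k = 4)
    (θ₀ : Coeff d p q) (B : Matrix (Fin d) (Fin d) ℝ) (ε y : ℤ → Ω → Fin d → ℝ)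
    (hε : IsStructuralShock P ε) (hy : IsSVARMA P θ₀ B ε y)
    (θf : Coeff d pf qf) (hf : IsFundamental P y θf)
    (K : Set (Coeff d pf qf)) (est : (T : ℕ) → (Fin T → Fin d → ℝ) → Coeff d pf qf)
    (hest : IsRootTEstimator P y θf K est)
    (W : (Fin k → ℝ) → ℝ) (hW : IsWeight k W)
    (H : ℕ → ℝ) (hHpos : ∀ T, 1 ≤ T → 0 < H T) (hH : Tendsto H atTop (𝓝 0))
    (hTH : Tendsto (fun T : ℕ => (T : ℝ) * H T ^ (k - 1)) atTop atTop) :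
    -- smoothing off the proper submanifolds: every frequency, one constant
    (∃ C : ℝ, ∀ T : ℕ, 1 ≤ T → ∀ (c : Fin k → Fin d) (lam : Fin k → ℝ),
      SumZeroMod Finset.univ lam →
      Integrable (fun ω => discrepancy T (offSubmanifolds k T) W (H T) c lam θf
        (est T (sample (fun t => y t ω) T)) (fun t => y t ω)) P ∧
      ∫ ω, discrepancy T (offSubmanifolds k T) W (H T) c lam θf
        (est T (sample (fun t => y t ω) T)) (fun t => y t ω) ∂P
          ≤ C * H T ^ (((k : ℝ) - 1) / 2)) ∧
    -- smoothing over all tuples: every frequency with no vanishing subsum of size `2, …, k - 2`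
    (∀ lam : Fin k → ℝ, SumZeroMod Finset.univ lam →
      (∀ S : Finset (Fin k), 2 ≤ S.card → S.card + 2 ≤ k → ¬ SumZeroMod S lam) →
      ∃ C : ℝ, ∀ T : ℕ, 1 ≤ T → ∀ c : Fin k → Fin d,
        Integrable (fun ω => discrepancy T Finset.univ W (H T) c lam θf
          (est T (sample (fun t => y t ω) T)) (fun t => y t ω)) P ∧
        ∫ ω, discrepancy T Finset.univ W (H T) c lam θf
          (est T (sample (fun t => y t ω) T)) (fun t => y t ω) ∂P
            ≤ C * H T ^ (((k : ℝ) - 1) / 2)) ∧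
    -- asymptotic equivalence of the two estimators
    (∀ (c : Fin k → Fin d) (lam : Fin k → ℝ), SumZeroMod Finset.univ lam →
      Tendsto (fun T : ℕ => ∫ ω, discrepancy T (offSubmanifolds k T) W (H T) c lam θf
        (est T (sample (fun t => y t ω) T)) (fun t => y t ω) ∂P) atTop (𝓝 0) ∧
      ((∀ S : Finset (Fin k), 2 ≤ S.card → S.card + 2 ≤ k → ¬ SumZeroMod S lam) →
        Tendsto (fun T : ℕ => ∫ ω, discrepancy T Finset.univ W (H T) c lam θf
          (est T (sample (fun t => y t ω) T)) (fun t => y t ω) ∂P) atTop (𝓝 0))) := by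
  have hk1 : 1 ≤ k := by omega
  have hk4 : k ≤ 4 := by omega
  have hoff : ∃ C : ℝ, ∀ T : ℕ, 1 ≤ T → ∀ (c : Fin k → Fin d) (lam : Fin k → ℝ),
      SumZeroMod Finset.univ lam →
      Integrable (fun ω => discrepancy T (offSubmanifolds k T) W (H T) c lam θf
        (est T (sample (fun t => y t ω) T)) (fun t => y t ω)) P ∧
      ∫ ω, discrepancy T (offSubmanifolds k T) W (H T) c lam θf
        (est T (sample (fun t => y t ω) T)) (fun t => y t ω) ∂P
          ≤ C * H T ^ (((k : ℝ) - 1) / 2) := by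
    obtain ⟨C₀, hC₀, hw⟩ := exists_weightBound_offSubmanifolds hk hW hHpos hH hTH
    obtain ⟨C, -, hC⟩ := exists_integral_discrepancy_le hk1 hk4 hε hy hest hC₀
    exact ⟨C, fun T hT c lam hlam => hC T hT _ W (H T) (hHpos T hT) lam (hw T hT lam hlam) c⟩
  have hall : ∀ lam : Fin k → ℝ, SumZeroMod Finset.univ lam →
      (∀ S : Finset (Fin k), 2 ≤ S.card → S.card + 2 ≤ k → ¬ SumZeroMod S lam) →
      ∃ C : ℝ, ∀ T : ℕ, 1 ≤ T → ∀ c : Fin k → Fin d,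
        Integrable (fun ω => discrepancy T Finset.univ W (H T) c lam θf
          (est T (sample (fun t => y t ω) T)) (fun t => y t ω)) P ∧
        ∫ ω, discrepancy T Finset.univ W (H T) c lam θf
          (est T (sample (fun t => y t ω) T)) (fun t => y t ω) ∂P
            ≤ C * H T ^ (((k : ℝ) - 1) / 2) := by
    intro lam hlam hsub
    obtain ⟨C₀, hC₀, hw⟩ := exists_weightBound_univ hk hW hHpos hH hTH lam hlam hsub
    obtain ⟨C, -, hC⟩ := exists_integral_discrepancy_le hk1 hk4 hε hy hest hC₀
    exact ⟨C, fun T hT c => hC T hT _ W (H T) (hHpos T hT) lam (hw T hT) c⟩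
  have hlim : ∀ C : ℝ, Tendsto (fun T => C * H T ^ (((k : ℝ) - 1) / 2)) atTop (𝓝 0) := by
    intro C
    have hexp : 0 < ((k : ℝ) - 1) / 2 := by
      have : (3 : ℝ) ≤ k := by exact_mod_cast (by omega : 3 ≤ k)
      linarith
    have h := (hH.rpow_const (p := ((k : ℝ) - 1) / 2) (Or.inr hexp.le)).const_mul C
    rwa [Real.zero_rpow hexp.ne', mul_zero] at h
  have hnonneg : ∀ (T : ℕ) (A : Finset (Fin k → Fin T)) (c : Fin k → Fin d) (lam : Fin k → ℝ),
      0 ≤ ∫ ω, discrepancy T A W (H T) c lam θf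
        (est T (sample (fun t => y t ω) T)) (fun t => y t ω) ∂P := fun T A c lam =>
    integral_nonneg fun ω => mul_nonneg (Real.sqrt_nonneg _) (norm_nonneg _)
  refine ⟨hoff, hall, fun c lam hlam => ⟨?_, fun hsub => ?_⟩⟩
  · obtain ⟨C, hC⟩ := hoff
    exact squeeze_zero' (Eventually.of_forall fun T => hnonneg T _ c lam)
      ((eventually_ge_atTop 1).mono fun T hT => (hC T hT c lam hlam).2) (hlim C)
  · obtain ⟨C, hC⟩ := hall lam hlam hsub
    exact squeeze_zero' (Eventually.of_forall fun T => hnonneg T _ c lam)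
      ((eventually_ge_atTop 1).mono fun T hT => (hC T hT c).2) (hlim C)
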